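/- Let $q$ be a power of $2$. A symplectic polar space $\mathcal W(5,q)$ consists of the totally isotropic subspaces of $\mathrm{PG}(5,q)$ with respect to a non-degenerate alternating form; its planes are called generators, and an $m$-ovoid is a set of points meeting every generator in exactly $m$ points. Two $m$-ovoids (possibly in different models of $\mathcal W(5,q)$) are isomorphic if an isomorphism between the polar spaces (a bijection of the points preserving lines in both directions) maps one onto the other. Consider the following sets of points. (a) Let $\omega\in\mathbb F_{q^2}\setminus\mathbb F_q$ with $\omega+\omega^q=1$ and let $\gamma\in\mathbb F_{q^2}$ be such that $X^2+X+\gamma$ is irreducible over $\mathbb F_{q^2}$. Let $\Sigma\cong\mathrm{PG}(5,q)$ be the set of points $(\alpha,\alpha^q,a,\beta,\beta^q,b)$, $\alpha,\beta\in\mathbb F_{q^2}$, $a,b\in\mathbb F_q$, with the polarity induced on $\Sigma$ by the Hermitian form $(x,y)\mapsto x^tJy^{q}$, where $$J=\begin{pmatrix}0&0&0&\omega&0&\omega^q\\0&0&0&0&\omega^q&\omega\\0&0&0&0&0&1\\\omega^q&0&0&0&0&0\\0&\omega&0&0&0&0\\\omega&\omega^q&1&0&0&0\end{pmatrix}.$$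 Let $\mathcal Q=\{x\in\Sigma: x_6=0,\ x_3^2+x_1x_5+x_2x_4=0\}$, let $S_\gamma=\left(\frac{\gamma}{\omega},\frac{\gamma^q}{\omega^q},\frac{\omega^q\gamma}{\omega}+\frac{\omega\gamma^q}{\omega^q},1,1,1\right)$, and let $G$ be the group generated by all matrices $$\begin{pmatrix}a^2&0&0&0&c^2&\frac{c(a+c\omega^q)}{\omega}\\0&a^{2q}&0&c^{2q}&0&\frac{c^q(a^q+c^q\omega)}{\omega^q}\\ab&a^qb^q&1&c^qd^q&cd&\frac{d(a+c\omega^q)}{\omega}+\frac{d^q(a^q+c^q\omega)}{\omega^q}+\frac1{\omega^{q+1}}\\0&b^{2q}&0&d^{2q}&0&\frac{d^q(b^q+d^q\omega)+\omega}{\omega^q}\\b^2&0&0&0&d^2&\frac{d(b+d\omega^q)+\omega^q}{\omega}\\0&0&0&0&0&1\end{pmatrix},\qquad a,b,c,d\in\mathbb F_{q^2},\ ad+bc=1.$$ Put $\mathcal O=\mathcal Q\cup S_\gamma^G$. (b) Let $\delta,\mu\in\mathbb F_q$, $\mu\neq0$, with $X^2+X+\delta$ irreducible over $\mathbb F_q$.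 In $\mathrm{PG}(5,q)$ with the polarity given by the form $\sum_{i=1}^6x_iy_{7-i}$, let $\mathcal O'$ be the quadric $X_1^2+X_1X_6+\delta X_6^2+X_2X_5+X_3X_4+\mu(X_4^2+X_4X_5+\delta X_5^2)=0$. (c) Let $Q$ be a quadratic form on $\mathbb F_q^6$ with non-degenerate polar form $B$, let $v$ be a vector with $Q(v)\ne0$, and consider the pencil of quadrics generated by $Q$ and $B(v,\cdot)^2$, whose base locus $\mathcal Q(4,q)$ is a parabolic quadric of $v^\perp$; take the polar space $\mathcal W(5,q)$ defined by $B$. A relative hemisystem of an elliptic quadric $\mathcal E$ of the pencil is a set of $q^2(q^2-1)/2$ points of $\mathcal E\setminus\mathcal Q(4,q)$ having exactly $q/2$ points in common with every line of $\mathcal E$ that meets $\mathcal Q(4,q)$ in exactly one point. Let $\mathcal O_1=\mathcal R_j\cup\mathcal R_k\cup\mathcal Q(4,q)$, where $\mathcal R_j,\mathcal R_k$ are relative hemisystems of two distinct elliptic quadrics of the pencil (so $q>2$). (d) In a pencil as in (c), let $q=2^{2h+1}$ with $h>0$, and let $Sz(q)$ be the Suzuki group fixing each quadric of the pencil and a Suzuki–Tits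 ovoid $\mathcal T$ of $\mathcal Q(4,q)$. Let $\mathcal O_2=A_j\cup B_k\cup\mathcal Q(4,q)$, where $\mathcal E_j\neq\mathcal E_k$ are elliptic quadrics of the pencil, $A_j$ is the $Sz(q)$-orbit of size $(q^3-q^2)(q-\sqrt{2q}+1)/2$ on $\mathcal E_j\setminus\mathcal Q(4,q)$ and $B_k$ is the $Sz(q)$-orbit of size $(q^3-q^2)(q+\sqrt{2q}+1)/2$ on $\mathcal E_k\setminus\mathcal Q(4,q)$. Then $\mathcal O,\mathcal O',\mathcal O_1,\mathcal O_2$ (whenever defined, and for all choices of the data) are $(q+1)$-ovoids of the respective polar spaces $\mathcal W(5,q)$; the numbers of lines of $\mathcal W(5,q)$ contained in them are, respectively, $q^2+1$, $q^2(q+1)+1$, $(q+1)(q^2+1)$ and $(q+1)(q^2+1)$; and they are pairwise non-isomorphic. Moreover, neither $\mathcal O$ nor $\mathcal O'$ is classical, that is, obtained by field reduction from an $m$-ovoid of a Hermitian polar space $\mathcal H(2n,q^{2t})$ or of a symplectic polar space $\mathcal W(2n-1,q^t)$, $t>1$; and neither is the set of points covered by a $1$-system of $\mathcal W(5,q)$,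 i.e. by $q^3+1$ lines of $\mathcal W(5,q)$ that are pairwise opposite (no point of one is orthogonal to all points of the other). -/

import Mathlib

open scoped LinearAlgebra.Projectivization Pointwise Matrix

namespace OvoidW5

universe u w

/-! ### Polar spaces, ovoids, isomorphisms

A polar space is given by its orthogonality relation `perp` on the underlying vector space. -/

section Polar

variable {F : Type u} [Field F] {V : Type w} [AddCommGroup V] [Module F V]

/-- The set of points of the projective space lying on the subspace `U`. -/
def pointsOf (U : Submodule F V) : Set (ℙ F V) := {P | P.submodule ≤ U}

/-- Totally isotropic subspaces. -/
def TotIsotropic (perp : V → V → Prop) (U : Submodule F V) : Prop :=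
  ∀ x ∈ U, ∀ y ∈ U, perp x y

/-- Generators: totally isotropic subspaces of maximum dimension. -/
def IsGenerator (perp : V → V → Prop) (U : Submodule F V) : Prop :=
  TotIsotropic perp U ∧
    ∀ U' : Submodule F V, TotIsotropic perp U' → Module.finrank F U' ≤ Module.finrank F U

/-- An `m`-ovoid: a set of points of the polar space meeting every generator in `m` points. -/
def IsOvoid (perp : V → V → Prop) (m : ℕ) (X : Set (ℙ F V)) : Prop :=
  (∀ P ∈ X, TotIsotropic perp P.submodule) ∧
    ∀ U : Submodule F V, IsGenerator perp U → (X ∩ pointsOf U).ncard = m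

variable (F) in
/-- `perp` is the orthogonality relation of a non-degenerate alternating form on a
six-dimensional space, that is, the polar space is a `W(5, q)`. -/
def IsW5 (perp : V → V → Prop) : Prop :=
  Module.finrank F V = 6 ∧
    ∃ B : LinearMap.BilinForm F V, B.IsAlt ∧ B.Nondegenerate ∧ ∀ x y, perp x y ↔ B x y = 0

/-- `X` is an `m`-ovoid of the symplectic polar space `W(5, q)` defined by `perp`. -/
def IsOvoidW5 (perp : V → V → Prop) (m : ℕ) (X : Set (ℙ F V)) : Prop :=
  IsW5 F perp ∧ IsOvoid perp m X

/-- Lines of the polar space, as sets of points. -/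
def IsLine (perp : V → V → Prop) (ℓ : Set (ℙ F V)) : Prop :=
  ∃ U : Submodule F V, Module.finrank F U = 2 ∧ TotIsotropic perp U ∧ ℓ = pointsOf U

/-- The set of lines of the polar space contained in `X`. -/
def linesIn (perp : V → V → Prop) (X : Set (ℙ F V)) : Set (Set (ℙ F V)) :=
  {ℓ | IsLine perp ℓ ∧ ℓ ⊆ X}

/-- Two point sets of polar spaces are isomorphic if some isomorphism between the polar spaces
(a bijection between the points that maps lines to lines in both directions) maps one
onto the other. Every (semi)linear similarity induces such a bijection. -/
def Isomorphic {V' : Type*} [AddCommGroup V'] [Module F V']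
    (perp : V → V → Prop) (X : Set (ℙ F V)) (perp' : V' → V' → Prop) (X' : Set (ℙ F V')) : Prop :=
  ∃ φ : ℙ F V ≃ ℙ F V', (∀ ℓ : Set (ℙ F V), IsLine perp ℓ ↔ IsLine perp' (φ '' ℓ)) ∧ φ '' X = X'

/-- Opposite subspaces: no point of either one is orthogonal to all of the other. -/
def Opposite (perp : V → V → Prop) (U U' : Submodule F V) : Prop :=
  (∀ x ∈ U, (∀ y ∈ U', perp x y) → x = 0) ∧ (∀ y ∈ U', (∀ x ∈ U, perp y x) → y = 0)

/-- A `1`-system of `W(5, q)`: `q ^ 3 + 1` pairwise opposite lines. -/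
def IsOneSystem [Fintype F] (perp : V → V → Prop) (S : Set (Submodule F V)) : Prop :=
  (∀ U ∈ S, Module.finrank F U = 2 ∧ TotIsotropic perp U) ∧
    S.ncard = Fintype.card F ^ 3 + 1 ∧ S.Pairwise (Opposite perp)

/-- `X` is the set of points covered by a `1`-system. -/
def FromOneSystem [Fintype F] (perp : V → V → Prop) (X : Set (ℙ F V)) : Prop :=
  ∃ S : Set (Submodule F V), IsOneSystem perp S ∧ X = ⋃ U ∈ S, pointsOf U

/-- Field reduction: `F`-points contained in a member of a set of `L`-points. -/
def reducePoints {L : Type u} [Field L] [Algebra F L] [Module L V] [IsScalarTower F L V]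
    (Y : Set (ℙ L V)) : Set (ℙ F V) :=
  {P | ∃ R ∈ Y, P.submodule ≤ R.submodule.restrictScalars F}

/-- Obtained by field reduction from an ovoid of a Hermitian polar space of odd (vector space)
dimension over an extension field `L`; the form on the `F`-space is `Tr (ε H(x, y))`. -/
def FromHermitian (perp : V → V → Prop) (X : Set (ℙ F V)) : Prop :=
  ∃ (L : Type u) (_ : Field L) (_ : Algebra F L) (_ : Module L V) (_ : IsScalarTower F L V)
    (σ : L →+* L) (H : V →ₛₗ[σ] V →ₗ[L] L) (ε : L) (m : ℕ) (Y : Set (ℙ L V)),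
    FiniteDimensional F L ∧ Odd (Module.finrank L V) ∧
    (∃ a, σ a ≠ a) ∧ (∀ a, σ (σ a) = a) ∧
    (∀ x y, σ (H x y) = H y x) ∧ (∀ x, (∀ y, H x y = 0) → x = 0) ∧
    (∀ x y, perp x y ↔ Algebra.trace F L (ε * H x y) = 0) ∧
    IsOvoid (fun x y => H x y = 0) m Y ∧ X = reducePoints Y

/-- Obtained by field reduction from an ovoid of a symplectic polar space over a proper
extension field `L`; the form on the `F`-space is `Tr (ε A(x, y))`. -/
def FromSymplectic (perp : V → V → Prop) (X : Set (ℙ F V)) : Prop :=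
  ∃ (L : Type u) (_ : Field L) (_ : Algebra F L) (_ : Module L V) (_ : IsScalarTower F L V)
    (A : LinearMap.BilinForm L V) (ε : L) (m : ℕ) (Y : Set (ℙ L V)),
    FiniteDimensional F L ∧ 1 < Module.finrank F L ∧
    A.IsAlt ∧ A.Nondegenerate ∧
    (∀ x y, perp x y ↔ Algebra.trace F L (ε * A x y) = 0) ∧
    IsOvoid (fun x y => A x y = 0) m Y ∧ X = reducePoints Y

/-- Classical: obtained by field reduction. -/
def IsClassical (perp : V → V → Prop) (X : Set (ℙ F V)) : Prop :=
  FromHermitian perp X ∨ FromSymplectic perp X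

/-- Set of projective points at which a (homogeneous) function vanishes. -/
def zeroLocus (f : V → F) : Set (ℙ F V) := {P | ∀ x ∈ P.submodule, f x = 0}

end Polar

/-! ### The elliptic quadric `O'`

`PG(5, q)` with coordinates `x 0, …, x 5`. -/

section First

variable {F : Type u} [Field F]

/-- The symplectic polarity of `W(5, q)` with antidiagonal Gram matrix. -/
def perpZero (x y : Fin 6 → F) : Prop := ∑ i, x i * y i.rev = 0

/-- The quadratic form of the quadric `Q_μ`. -/
def formMu (δ μ : F) (x : Fin 6 → F) : F :=
  x 0 ^ 2 + x 0 * x 5 + δ * x 5 ^ 2 + (x 1 * x 4 + x 2 * x 3) +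
    μ * (x 3 ^ 2 + x 3 * x 4 + δ * x 4 ^ 2)

/-- The set `O'`: the quadric `Q_μ`. -/
def ovoidFirst (δ μ : F) : Set (ℙ F (Fin 6 → F)) := zeroLocus (formMu δ μ)

end First

/-! ### The ovoid `O`

`F` is the field with `q` elements and `K` the field with `q ^ 2` elements. -/

section Second

variable (F : Type u) [Field F] [Fintype F] {K : Type w} [Field K] [Algebra F K]

variable (K) in
/-- The `F`-space of all vectors `(α, α ^ q, a, β, β ^ q, b)` with `a, b` in `F`; its points are
those of the Baer subgeometry `Σ`. -/
def baerSpace : Submodule F (Fin 6 → K) where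
  carrier := {x | x 1 = x 0 ^ Fintype.card F ∧ x 2 ∈ (algebraMap F K).range ∧
    x 4 = x 3 ^ Fintype.card F ∧ x 5 ∈ (algebraMap F K).range}
  zero_mem' := by
    refine ⟨?_, zero_mem _, ?_, zero_mem _⟩ <;> simp [Fintype.card_ne_zero]
  add_mem' := by
    rintro x y ⟨h1, h2, h3, h4⟩ ⟨k1, k2, k3, k4⟩
    have hadd (a b : K) := map_add (FiniteField.frobeniusAlgHom F K) a b
    simp only [FiniteField.coe_frobeniusAlgHom] at hadd
    exact ⟨by simp [h1, k1, hadd], add_mem h2 k2, by simp [h3, k3, hadd], add_mem h4 k4⟩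
  smul_mem' := by
    rintro c x ⟨h1, h2, h3, h4⟩
    have hsmul (a : K) := map_smul (FiniteField.frobeniusAlgHom F K) c a
    simp only [FiniteField.coe_frobeniusAlgHom] at hsmul
    refine ⟨by simp [h1, hsmul], ?_, by simp [h3, hsmul], ?_⟩
    · rw [Pi.smul_apply, Algebra.smul_def]
      exact mul_mem ⟨c, rfl⟩ h2
    · rw [Pi.smul_apply, Algebra.smul_def]
      exact mul_mem ⟨c, rfl⟩ h4

/-- Gram matrix of the sesquilinear form of the Hermitian variety `H(5, q ^ 2)`. -/
def gramJ (ω : K) : Matrix (Fin 6) (Fin 6) K :=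
  !![0, 0, 0, ω, 0, ω ^ Fintype.card F;
     0, 0, 0, 0, ω ^ Fintype.card F, ω;
     0, 0, 0, 0, 0, 1;
     ω ^ Fintype.card F, 0, 0, 0, 0, 0;
     0, ω, 0, 0, 0, 0;
     ω, ω ^ Fintype.card F, 1, 0, 0, 0]

/-- The symplectic polarity induced on `Σ` by the Hermitian variety. -/
def perpBaer (ω : K) (x y : baerSpace F K) : Prop :=
  (x : Fin 6 → K) ⬝ᵥ (gramJ F ω *ᵥ fun i => (y : Fin 6 → K) i ^ Fintype.card F) = 0

/-- The matrices `M_{a,b,c,d}`. -/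
def matM (ω a b c d : K) : Matrix (Fin 6) (Fin 6) K :=
  let q := Fintype.card F
  !![a ^ 2, 0, 0, 0, c ^ 2, c * (a + c * ω ^ q) / ω;
     0, a ^ (2 * q), 0, c ^ (2 * q), 0, c ^ q * (a ^ q + c ^ q * ω) / ω ^ q;
     a * b, a ^ q * b ^ q, 1, c ^ q * d ^ q, c * d,
       d * (a + c * ω ^ q) / ω + d ^ q * (a ^ q + c ^ q * ω) / ω ^ q + 1 / ω ^ (q + 1);
     0, b ^ (2 * q), 0, d ^ (2 * q), 0, (d ^ q * (b ^ q + d ^ q * ω) + ω) / ω ^ q;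
     b ^ 2, 0, 0, 0, d ^ 2, (d * (b + d * ω ^ q) + ω ^ q) / ω;
     0, 0, 0, 0, 0, 1]

/-- The group `G` generated by the matrices `M_{a,b,c,d}` with `ad + bc = 1`. -/
def groupG (ω : K) : Subgroup (GL (Fin 6) K) :=
  Subgroup.closure {g | ∃ a b c d : K, a * d + b * c = 1 ∧
    (g : Matrix (Fin 6) (Fin 6) K) = matM F ω a b c d}

/-- The vector spanning the point `S_γ`. -/
def vecS (ω γ : K) : Fin 6 → K :=
  let q := Fintype.card F
  ![γ / ω, γ ^ q / ω ^ q, ω ^ q * γ / ω + ω * γ ^ q / ω ^ q, 1, 1, 1]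

/-- The parabolic quadric `Q` in the hyperplane `Π : X₆ = 0` of `Σ`. -/
def quadricQ : Set (ℙ F (baerSpace F K)) :=
  {P | ∀ x ∈ P.submodule, (x : Fin 6 → K) 5 = 0 ∧
    (x : Fin 6 → K) 2 ^ 2 + (x : Fin 6 → K) 0 * (x : Fin 6 → K) 4
      + (x : Fin 6 → K) 1 * (x : Fin 6 → K) 3 = 0}

/-- The orbit of the point `S_γ` under `G`, as a set of points of `Σ`. -/
def orbitS (ω γ : K) : Set (ℙ F (baerSpace F K)) :=
  {P | ∃ g ∈ groupG F ω, ∀ x ∈ P.submodule, ∃ c : K,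
    (x : Fin 6 → K) = c • ((g : Matrix (Fin 6) (Fin 6) K) *ᵥ vecS F ω γ)}

/-- The set `O`. -/
def ovoidSecond (ω γ : K) : Set (ℙ F (baerSpace F K)) := quadricQ F ∪ orbitS F ω γ

end Second

/-! ### The ovoids `O₁` and `O₂` -/

section Known

variable {F : Type u} [Field F]

/-- Elliptic quadrics of `PG(5, q)`: non-degenerate, with maximal totally singular subspaces
being lines. -/
def IsElliptic (f : QuadraticForm F (Fin 6 → F)) : Prop :=
  (∀ x, (∀ y, QuadraticMap.polar f x y = 0) → x = 0) ∧
  (∃ U : Submodule F (Fin 6 → F), Module.finrank F U = 2 ∧ ∀ x ∈ U, f x = 0) ∧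
  ∀ U : Submodule F (Fin 6 → F), (∀ x ∈ U, f x = 0) → Module.finrank F U ≤ 2

/-- The polarity of a quadratic form. -/
def perpOf (Q : QuadraticForm F (Fin 6 → F)) (x y : Fin 6 → F) : Prop :=
  QuadraticMap.polar Q x y = 0

/-- A pencil of quadrics is specified by one non-degenerate quadratic form `Q` and the vertex `v`,
a point off the quadric. Its members are the forms `Q + t B(v, ·) ^ 2`, with `B` the polar form
of `Q`, and the square `B(v, ·) ^ 2` defining the hyperplane `v^⊥` (this is the cone with vertex
the nucleus `v` over the base locus). -/
def IsPencil (Q : QuadraticForm F (Fin 6 → F)) (v : Fin 6 → F) : Prop :=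
  (∀ x, (∀ y, QuadraticMap.polar Q x y = 0) → x = 0) ∧ Q v ≠ 0

/-- The member of the pencil with parameter `t`. -/
def member (Q : QuadraticForm F (Fin 6 → F)) (v : Fin 6 → F) (t : F) :
    QuadraticForm F (Fin 6 → F) :=
  Q + t • QuadraticMap.linMulLin (Q.polarBilin v) (Q.polarBilin v)

/-- The base locus of the pencil, a parabolic quadric `Q(4, q)` of the hyperplane `v^⊥`. -/
def base (Q : QuadraticForm F (Fin 6 → F)) (v : Fin 6 → F) : Set (ℙ F (Fin 6 → F)) :=
  zeroLocus Q ∩ zeroLocus (QuadraticMap.polar Q v)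

/-- `R` is a relative hemisystem of the elliptic quadric `E` with respect to `C = Q(4, q)`. -/
def IsRelHemisystem [Fintype F] (E : QuadraticForm F (Fin 6 → F))
    (C R : Set (ℙ F (Fin 6 → F))) : Prop :=
  R ⊆ zeroLocus E \ C ∧
  2 * R.ncard = Fintype.card F ^ 2 * (Fintype.card F ^ 2 - 1) ∧
  ∀ U : Submodule F (Fin 6 → F), Module.finrank F U = 2 → (∀ x ∈ U, E x = 0) →
    (C ∩ pointsOf U).ncard = 1 → 2 * (R ∩ pointsOf U).ncard = Fintype.card F

/-- `X` is a set `O₁`, constructed in the pencil given by `Q` and `v` from relative hemisystems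
of two distinct elliptic quadrics. -/
def IsHemisystemOvoid [Fintype F] (Q : QuadraticForm F (Fin 6 → F)) (v : Fin 6 → F)
    (X : Set (ℙ F (Fin 6 → F))) : Prop :=
  IsPencil Q v ∧ ∃ (j k : F) (Rj Rk : Set (ℙ F (Fin 6 → F))), j ≠ k ∧
    IsElliptic (member Q v j) ∧ IsElliptic (member Q v k) ∧
    IsRelHemisystem (member Q v j) (base Q v) Rj ∧
    IsRelHemisystem (member Q v k) (base Q v) Rk ∧
    X = Rj ∪ Rk ∪ base Q v

/-- `T` is a Suzuki-Tits ovoid of the base `Q(4, q)`, `q = 2 ^ (2 h + 1)`: in suitable coordinates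
of `v^⊥` in which `Q(4, q)` has equation `X₁ X₅ + X₂ X₄ + X₃ ^ 2 = 0`, it consists of the point
`(0, 0, 0, 0, 1)` and the points `(1, x, z, y, x y + z ^ 2)` with
`z ^ 2 = x ^ (σ + 2) + y ^ σ`, where `σ = 2 ^ (h + 1)`. -/
def IsSuzukiTits (h : ℕ) (Q : QuadraticForm F (Fin 6 → F)) (v : Fin 6 → F)
    (T : Set (ℙ F (Fin 6 → F))) : Prop :=
  ∃ e : (Fin 5 → F) →ₗ[F] (Fin 6 → F), Function.Injective e ∧
    LinearMap.range e = LinearMap.ker (Q.polarBilin v) ∧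
    (∀ x, Q (e x) = x 0 * x 4 + x 1 * x 3 + x 2 ^ 2) ∧
    T = {P | P.submodule = F ∙ e ![0, 0, 0, 0, 1] ∨
      ∃ x y z : F, z ^ 2 = x ^ (2 ^ (h + 1) + 2) + y ^ (2 ^ (h + 1)) ∧
        P.submodule = F ∙ e ![1, x, z, y, x * y + z ^ 2]}

/-- The linear isometries of `Q`. -/
def isometries (Q : QuadraticForm F (Fin 6 → F)) : Subgroup ((Fin 6 → F) ≃ₗ[F] (Fin 6 → F)) where
  carrier := {g | ∀ x, Q (g x) = Q x}
  one_mem' := fun _ => rfl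
  mul_mem' := fun {a b} ha hb x => (ha (b x)).trans (hb x)
  inv_mem' := fun {a} ha x =>
    (ha (a⁻¹ x)).symm.trans (congrArg Q (a.apply_symm_apply x))

/-- The stabilizer of the Suzuki-Tits ovoid `T` among the isometries fixing every member of the
pencil. It is `Sz(q) × 2`, the factor of order two being generated by the transvection with
centre `v`, which is trivial on `v^⊥`. -/
def stabT (Q : QuadraticForm F (Fin 6 → F)) (v : Fin 6 → F) (T : Set (ℙ F (Fin 6 → F))) :
    Subgroup ((Fin 6 → F) ≃ₗ[F] (Fin 6 → F)) :=
  isometries Q ⊓ MulAction.stabilizer _ v ⊓ MulAction.stabilizer _ T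

/-- The Suzuki group `Sz(q)`, `q > 2`, fixing `T`: the derived subgroup of `Sz(q) × 2`. -/
def suzuki (Q : QuadraticForm F (Fin 6 → F)) (v : Fin 6 → F) (T : Set (ℙ F (Fin 6 → F))) :
    Subgroup ((Fin 6 → F) ≃ₗ[F] (Fin 6 → F)) :=
  ⁅stabT Q v T, stabT Q v T⁆

/-- The points of the quadric `E`, off the base, on orbits of `Sz(q)` of size `s / 2`. -/
def suzukiOrbit (Q : QuadraticForm F (Fin 6 → F)) (v : Fin 6 → F) (T : Set (ℙ F (Fin 6 → F)))
    (E : QuadraticForm F (Fin 6 → F)) (s : ℤ) : Set (ℙ F (Fin 6 → F)) :=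
  {P | P ∈ zeroLocus E \ base Q v ∧ 2 * ((MulAction.orbit (suzuki Q v T) P).ncard : ℤ) = s}

/-- `X` is a set `O₂`, for `q = 2 ^ (2 h + 1)`, `h > 0`: the union of the smaller `Sz(q)`-orbit
`A_j` on one elliptic quadric of the pencil, the larger `Sz(q)`-orbit `B_k` on another one, and
the base. Here `2 ^ (h + 1)` is the square root of `2 q`. -/
def IsSuzukiOvoid [Fintype F] (Q : QuadraticForm F (Fin 6 → F)) (v : Fin 6 → F)
    (X : Set (ℙ F (Fin 6 → F))) : Prop :=
  IsPencil Q v ∧ ∃ (h : ℕ) (T : Set (ℙ F (Fin 6 → F))) (j k : F),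
    0 < h ∧ Fintype.card F = 2 ^ (2 * h + 1) ∧ IsSuzukiTits h Q v T ∧ j ≠ k ∧
    IsElliptic (member Q v j) ∧ IsElliptic (member Q v k) ∧
    X = suzukiOrbit Q v T (member Q v j)
          (((Fintype.card F : ℤ) ^ 3 - (Fintype.card F : ℤ) ^ 2) *
            ((Fintype.card F : ℤ) - 2 ^ (h + 1) + 1)) ∪
        suzukiOrbit Q v T (member Q v k)
          (((Fintype.card F : ℤ) ^ 3 - (Fintype.card F : ℤ) ^ 2) *
            ((Fintype.card F : ℤ) + 2 ^ (h + 1) + 1)) ∪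
        base Q v

end Known

end OvoidW5

open OvoidW5

set_option linter.unusedSectionVars false

namespace OvoidW5

universe u w

open Module Projectivization

/-! It suffices to show that every totally isotropic 3-space U contains q² vectors of the cone over
the set. For O, O' and for each elliptic quadric of a pencil one device gives this number. On U the
cone is the zero set of a quadratic form over F whose polar form has a nonsingular radical vector r.
Squaring is bijective in characteristic 2, so each coset x + Fr contains exactly one zero, and there
are q³/q zeros (`ncard_mul_of_existsUnique`).

For O' the form on U has polar form μ(x₃y₄ + x₄y₃), and the anisotropy of X² + XY + δY² supplies r.
For O one uses that W(5,q) is the projection of Q(6,q) from its nucleus. Here Q(6,q) is Tr(phi/ω) =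
0 on the vectors (U, V, w, Z) with U, V, w in K and Z in F, where phi defines an elliptic quadric of
PG(3,q²). Vectors of W(5,q) lift uniquely to Q(6,q), additively on orthogonal pairs, and O consists
of the vectors whose lift is a zero of phi itself (`IsBaerDatum.mem_cone_ovoidSecond`). The elliptic
quadric contains no line; this yields r, and it identifies the lines contained in O with the q² + 1
points of the conic Z = 0.

O₁ and O₂ are treated together through `IsBalanced`. A totally isotropic plane meets each of the two
elliptic quadrics in a line, and both lines meet Q(4,q) in the same points. Either they are one line
of Q(4,q), or they are tangent at one point P, and the two halves must contribute q points together.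
For relative hemisystems this is q/2 + q/2. For the Suzuki group, an orbit is characterized by the
number of points of the Tits ovoid orthogonal to its points. This number is q + 1 ± √(2q), by a
Gauss sum of square 2q, and double counting along a tangent line shows that the difference of the
two class sizes depends on P only (`ActsAsSuzuki.line_counts`).

The numbers of contained lines separate all pairs except O₁ and O₂. Consider for these the lines
that meet the union of the contained lines, which is Q(4,q), in one point: they carry 1 or q/2 + 1
points of O₁, while some carry (q - √(2q))/2 + 1 points of O₂. Finally, classical sets and sets
covered by 1-systems are partitioned by totally isotropic subspaces of dimension at least 2. But
some points of O lie on no contained line, and O' has two non-orthogonal points all of whose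
contained lines pass through one common point. -/

/-! ### Points, cones and counting -/

section Counting

variable {F : Type u} [Field F] {V : Type w} [AddCommGroup V] [Module F V]

/-- The vectors spanning points of `X`, together with the zero vector. -/
def cone (X : Set (ℙ F V)) : Set V := {x | ∀ hx : x ≠ 0, mk F x hx ∈ X}

lemma mem_cone_of_ne {X : Set (ℙ F V)} {x : V} (hx : x ≠ 0) : x ∈ cone X ↔ mk F x hx ∈ X :=
  ⟨fun h => h hx, fun h _ => h⟩

lemma zero_mem_cone (X : Set (ℙ F V)) : (0 : V) ∈ cone X := fun h => (h rfl).elim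

lemma cone_inter (X Y : Set (ℙ F V)) : cone (X ∩ Y) = cone X ∩ cone Y := by
  ext x; exact ⟨fun h => ⟨fun hx => (h hx).1, fun hx => (h hx).2⟩, fun h hx => ⟨h.1 hx, h.2 hx⟩⟩

lemma cone_mono {X Y : Set (ℙ F V)} (h : X ⊆ Y) : cone X ⊆ cone Y := fun _ hx hx0 => h (hx hx0)

lemma mk_mem_pointsOf {U : Submodule F V} {x : V} (hx : x ≠ 0) :
    mk F x hx ∈ pointsOf U ↔ x ∈ U := by
  simp [pointsOf, submodule_mk, Submodule.span_singleton_le_iff_mem]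

lemma cone_pointsOf (U : Submodule F V) : cone (pointsOf U) = U := by
  ext x
  by_cases hx : x = 0
  · simp [hx, zero_mem_cone]
  · rw [mem_cone_of_ne hx, mk_mem_pointsOf hx]; rfl

lemma subset_of_cone_subset {X Y : Set (ℙ F V)} (h : cone X ⊆ cone Y) : X ⊆ Y := by
  intro P hP
  induction P using Projectivization.ind with
  | h x hx => exact h ((mem_cone_of_ne hx).2 hP) hx

lemma pointsOf_injective : Function.Injective (pointsOf : Submodule F V → Set (ℙ F V)) := by
  intro U U' h
  apply SetLike.coe_injective
  rw [← cone_pointsOf, ← cone_pointsOf, h]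

lemma pointsOf_subset_iff {U : Submodule F V} {X : Set (ℙ F V)} :
    pointsOf U ⊆ X ↔ (U : Set V) ⊆ cone X := by
  rw [← cone_pointsOf]
  exact ⟨cone_mono, subset_of_cone_subset⟩

lemma mem_submodule_iff {P : ℙ F V} {x : V} (hx : x ≠ 0) : x ∈ P.submodule ↔ P = mk F x hx := by
  constructor
  · intro h
    induction P using Projectivization.ind with
    | h y hy =>
      rw [submodule_mk, Submodule.mem_span_singleton] at h
      obtain ⟨a, rfl⟩ := h
      rw [mk_eq_mk_iff']
      refine ⟨a⁻¹, ?_⟩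
      have : a ≠ 0 := fun h => hx (by simp [h])
      rw [smul_smul, inv_mul_cancel₀ this, one_smul]
  · rintro rfl
    rw [submodule_mk]; exact Submodule.mem_span_singleton_self x

lemma mk_mem_zeroLocus {f : V → F} (hf : ∀ (c : F) x, f (c • x) = c ^ 2 * f x) {x : V}
    (hx : x ≠ 0) : mk F x hx ∈ zeroLocus f ↔ f x = 0 := by
  constructor
  · intro h
    exact h x (by rw [submodule_mk]; exact Submodule.mem_span_singleton_self x)
  · intro h y hy
    rw [submodule_mk, Submodule.mem_span_singleton] at hy
    obtain ⟨c, rfl⟩ := hy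
    rw [hf, h, mul_zero]

lemma cone_zeroLocus {f : V → F} (hf : ∀ (c : F) x, f (c • x) = c ^ 2 * f x) :
    cone (zeroLocus f) = {x | f x = 0} := by
  ext x
  by_cases hx : x = 0
  · have := hf 0 x
    simp only [zero_smul, ne_eq, OfNat.ofNat_ne_zero, not_false_eq_true, zero_pow, zero_mul] at this
    simp [hx, zero_mem_cone, this]
  · rw [mem_cone_of_ne hx, mk_mem_zeroLocus hf hx]; rfl

variable [Finite F] [Finite V]

instance finite_projectivization : Finite (ℙ F V) :=
  Finite.of_injective (fun P => P.submodule) Projectivization.submodule_injective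

omit [Finite F] in
lemma ncard_cone (X : Set (ℙ F V)) : (cone X).ncard = X.ncard * (Nat.card F - 1) + 1 := by
  have h1 : (cone X \ {0}).ncard + 1 = (cone X).ncard :=
    Set.ncard_sdiff_singleton_add_one (zero_mem_cone X) (Set.toFinite _)
  have h2 : (cone X \ {0}).ncard = X.ncard * (Nat.card F - 1) := by
    rw [← Nat.card_units, ← Nat.card_coe_set_eq, ← Nat.card_coe_set_eq, ← Nat.card_prod]
    let e := nonZeroEquivProjectivizationProdUnits F V
    have he : ∀ v : {v : V // v ≠ 0}, (e v).1 = mk F v.1 v.2 := fun v => rfl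
    refine Nat.card_congr
      { toFun := fun v => (⟨(e ⟨v.1, v.2.2⟩).1, ?_⟩, (e ⟨v.1, v.2.2⟩).2)
        invFun := fun p => ⟨(e.symm (p.1.1, p.2)).1, ?_, (e.symm (p.1.1, p.2)).2⟩
        left_inv := ?_
        right_inv := ?_ }
    · exact v.2.1 v.2.2
    · intro hx
      have := he (e.symm (p.1.1, p.2))
      rw [Equiv.apply_symm_apply] at this
      change mk F (e.symm (p.1.1, p.2)).1 _ ∈ X
      rw [← this]; exact p.1.2
    · intro v
      simp
    · intro p
      have : e ⟨(e.symm (p.1.1, p.2)).1, (e.symm (p.1.1, p.2)).2⟩ = (p.1.1, p.2) :=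
        Equiv.apply_symm_apply e _
      ext <;> simp only [this]
  omega

lemma ncard_eq_of_cone {X : Set (ℙ F V)} {n : ℕ}
    (h : (cone X).ncard = n * (Nat.card F - 1) + 1) : X.ncard = n := by
  rw [ncard_cone] at h
  have : 0 < Nat.card F - 1 := by
    have := Finite.one_lt_card (α := F); omega
  exact Nat.eq_of_mul_eq_mul_right this (by omega)

/-- Since q² = (q + 1)(q - 1) + 1, counting q² vectors in the cone is the form in which all ovoid
counts are made. -/
lemma ncard_of_cone_sq {X : Set (ℙ F V)} (h : (cone X).ncard = Nat.card F ^ 2) :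
    X.ncard = Nat.card F + 1 := by
  apply ncard_eq_of_cone
  rw [h]
  have : 1 < Nat.card F := Finite.one_lt_card
  obtain ⟨k, hk⟩ : ∃ k, Nat.card F = k + 1 := ⟨Nat.card F - 1, by omega⟩
  rw [hk, Nat.add_sub_cancel]; ring

omit [Finite F] [Finite V] in
lemma natCard_submodule [FiniteDimensional F V] (U : Submodule F V) : 
    (U : Set V).ncard = Nat.card F ^ finrank F U := by
  rw [← Nat.card_coe_set_eq]
  exact Module.natCard_eq_pow_finrank (K := F) (V := U)

lemma ncard_pointsOf_of_finrank_two {U : Submodule F V} (hU : finrank F U = 2) :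
    (pointsOf U).ncard = Nat.card F + 1 := by
  have : FiniteDimensional F V := Module.Finite.of_finite
  apply ncard_of_cone_sq
  rw [cone_pointsOf, natCard_submodule, hU]

lemma finrank_eq_of_ncard {U : Submodule F V} {n : ℕ} (h : (U : Set V).ncard = Nat.card F ^ n) :
    finrank F U = n := by
  have : FiniteDimensional F V := Module.Finite.of_finite
  rw [natCard_submodule] at h
  exact Nat.pow_right_injective (Finite.one_lt_card (α := F)) h

omit [Finite F] [Finite V] in
/-- A set meeting every line in the direction `r` of `U` in a single vector. -/
lemma ncard_mul_of_existsUnique {U : Submodule F V} {Z : Set V} (hZ : Z ⊆ U) {r : V} (hr : r ∈ U)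
    (h : ∀ x ∈ U, ∃! c : F, x + c • r ∈ Z) : (U : Set V).ncard = Z.ncard * Nat.card F := by
  rw [← Nat.card_coe_set_eq, ← Nat.card_coe_set_eq, ← Nat.card_prod]
  symm
  apply Nat.card_congr
  refine Equiv.ofBijective (fun p : Z × F => (⟨p.1.1 - p.2 • r, 
    U.sub_mem (hZ p.1.2) (U.smul_mem _ hr)⟩ : (U : Set V))) ⟨?_, ?_⟩
  · rintro ⟨⟨z, hz⟩, c⟩ ⟨⟨z', hz'⟩, c'⟩ hh
    simp only [Subtype.mk.injEq] at hh
    have hu := h (z - c • r) (U.sub_mem (hZ hz) (U.smul_mem _ hr))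
    have : c = c' := hu.unique (by simpa using hz) (by rw [hh]; simpa using hz')
    subst this
    simp at hh
    simp [hh]
  · rintro ⟨x, hx⟩
    obtain ⟨c, hc, -⟩ := h x hx
    exact ⟨(⟨_, hc⟩, c), by simp⟩

end Counting

/-! ### Generators, isomorphisms and coverings -/

section PolarSpace

variable {F : Type u} [Field F] {V : Type w} [AddCommGroup V] [Module F V]

lemma totIsotropic_sup_span {perp : V → V → Prop} {B : LinearMap.BilinForm F V} (hB : B.IsAlt)
    (hp : ∀ x y, perp x y ↔ B x y = 0) {U : Submodule F V} (hU : TotIsotropic perp U) {x : V}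
    (hx : ∀ y ∈ U, B y x = 0) : TotIsotropic perp (U ⊔ F ∙ x) := by
  intro a ha b hb
  obtain ⟨y, hy, z, hz, rfl⟩ := Submodule.mem_sup.1 ha
  obtain ⟨y', hy', z', hz', rfl⟩ := Submodule.mem_sup.1 hb
  obtain ⟨c, rfl⟩ := Submodule.mem_span_singleton.1 hz
  obtain ⟨c', rfl⟩ := Submodule.mem_span_singleton.1 hz'
  have h1 : B y y' = 0 := (hp _ _).1 (hU y hy y' hy')
  have h2 : B x y' = 0 := hB.isRefl _ _ (hx y' hy')
  rw [hp]
  simp [h1, h2, hx y hy, hB.self_eq_zero]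

/-- A totally isotropic U lies in its perp, of dimension 6 - dim U. If the inclusion is strict,
adjoining a vector of the perp gives a larger totally isotropic subspace; if not, dim U = 3. -/
lemma IsW5.finrank_generator {perp : V → V → Prop} (h : IsW5 F perp) {U : Submodule F V}
    (hU : IsGenerator perp U) : finrank F U = 3 := by
  obtain ⟨h6, B, hB, hn, hp⟩ := h
  have : FiniteDimensional F V := FiniteDimensional.of_finrank_pos (by omega)
  have horth := LinearMap.BilinForm.finrank_orthogonal hn U
  have hle : U ≤ B.orthogonal U := fun x hx y hy => (hp _ _).1 (hU.1 y hy x hx)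
  have h1 := Submodule.finrank_mono hle
  by_contra hne
  have hlt : U < B.orthogonal U := lt_of_le_of_ne hle fun he => by
    rw [← he] at horth; omega
  obtain ⟨x, hx, hxU⟩ := SetLike.exists_of_lt hlt
  have h2 := hU.2 (U ⊔ F ∙ x) (totIsotropic_sup_span hB hp hU.1 hx)
  have h3 : U < U ⊔ F ∙ x := left_lt_sup.2 (by simpa using hxU)
  exact absurd (Submodule.finrank_lt_finrank_of_lt h3) (by omega)

lemma IsW5.totIsotropic_point {perp : V → V → Prop} (h : IsW5 F perp) (P : ℙ F V) :
    TotIsotropic perp P.submodule := by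
  obtain ⟨-, B, hB, -, hp⟩ := h
  induction P using Projectivization.ind with
  | h v hv =>
    rw [submodule_mk]
    intro x hx y hy
    obtain ⟨c, rfl⟩ := Submodule.mem_span_singleton.1 hx
    obtain ⟨c', rfl⟩ := Submodule.mem_span_singleton.1 hy
    rw [hp]; simp [hB.self_eq_zero]

lemma IsW5.isOvoidW5 [Finite F] {perp : V → V → Prop} (h : IsW5 F perp) {X : Set (ℙ F V)}
    (hX : ∀ U : Submodule F V, finrank F U = 3 → TotIsotropic perp U →
      (X ∩ pointsOf U).ncard = Nat.card F + 1) : IsOvoidW5 perp (Nat.card F + 1) X :=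
  ⟨h, fun P _ => h.totIsotropic_point P, fun U hU => hX U (h.finrank_generator hU) hU.1⟩

lemma linesIn_eq_image (perp : V → V → Prop) (X : Set (ℙ F V)) : linesIn perp X =
    pointsOf '' {U : Submodule F V | finrank F U = 2 ∧ TotIsotropic perp U ∧ pointsOf U ⊆ X} := by
  ext ℓ
  constructor
  · rintro ⟨⟨U, h1, h2, rfl⟩, h3⟩
    exact ⟨U, ⟨h1, h2, h3⟩, rfl⟩
  · rintro ⟨U, ⟨h1, h2, h3⟩, rfl⟩
    exact ⟨⟨U, h1, h2, rfl⟩, h3⟩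

lemma ncard_linesIn (perp : V → V → Prop) (X : Set (ℙ F V)) : (linesIn perp X).ncard =
    {U : Submodule F V | finrank F U = 2 ∧ TotIsotropic perp U ∧ pointsOf U ⊆ X}.ncard := by
  rw [linesIn_eq_image, Set.ncard_image_of_injective _ pointsOf_injective]

/-! ### Invariants of isomorphic point sets -/

section Isom

variable {V' : Type*} [AddCommGroup V'] [Module F V'] {perp : V → V → Prop} {X : Set (ℙ F V)}
  {perp' : V' → V' → Prop} {X' : Set (ℙ F V')}

lemma image_linesIn {φ : ℙ F V ≃ ℙ F V'} 
    (hφ : ∀ ℓ : Set (ℙ F V), IsLine perp ℓ ↔ IsLine perp' (φ '' ℓ)) :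
    (φ '' ·) '' linesIn perp X = linesIn perp' (φ '' X) := by
  ext ℓ
  constructor
  · rintro ⟨m, ⟨h1, h2⟩, rfl⟩
    exact ⟨(hφ m).1 h1, Set.image_mono h2⟩
  · rintro ⟨h1, h2⟩
    have h3 : φ '' (φ ⁻¹' ℓ) = ℓ := Set.image_preimage_eq _ φ.surjective
    refine ⟨φ ⁻¹' ℓ, ⟨(hφ _).2 (by rwa [h3]), ?_⟩, h3⟩
    rw [← h3] at h2
    exact (Set.image_subset_image_iff φ.injective).1 h2

lemma Isomorphic.ncard_linesIn_eq (h : Isomorphic perp X perp' X') :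
    (linesIn perp X).ncard = (linesIn perp' X').ncard := by
  obtain ⟨φ, hφ, rfl⟩ := h
  rw [← image_linesIn hφ, Set.ncard_image_of_injective _ φ.injective.image_injective]

/-- The numbers of points of `X` on lines meeting the union of the lines in `X` in one point. -/
def tangentNumbers (perp : V → V → Prop) (X : Set (ℙ F V)) : Set ℕ :=
  {n | ∃ ℓ : Set (ℙ F V), IsLine perp ℓ ∧ (⋃₀ linesIn perp X ∩ ℓ).ncard = 1 ∧ (X ∩ ℓ).ncard = n}

lemma Isomorphic.tangentNumbers_eq (h : Isomorphic perp X perp' X') :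
    tangentNumbers perp X = tangentNumbers perp' X' := by
  obtain ⟨φ, hφ, rfl⟩ := h
  have h1 : ⋃₀ linesIn perp' (φ '' X) = φ '' ⋃₀ linesIn perp X := by
    rw [← image_linesIn hφ, Set.image_sUnion]
  ext n
  constructor
  · rintro ⟨ℓ, h2, h3, h4⟩
    refine ⟨φ '' ℓ, (hφ _).1 h2, ?_, ?_⟩
    · rw [h1, ← Set.image_inter φ.injective, Set.ncard_image_of_injective _ φ.injective, h3]
    · rw [← Set.image_inter φ.injective, Set.ncard_image_of_injective _ φ.injective, h4]
  · rintro ⟨ℓ, h2, h3, h4⟩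
    have h5 : φ '' (φ ⁻¹' ℓ) = ℓ := Set.image_preimage_eq _ φ.surjective
    rw [← h5] at h2 h3 h4
    rw [h1, ← Set.image_inter φ.injective, Set.ncard_image_of_injective _ φ.injective] at h3
    rw [← Set.image_inter φ.injective, Set.ncard_image_of_injective _ φ.injective] at h4
    exact ⟨_, (hφ _).2 h2, h3, h4⟩

end Isom

/-- `X` is partitioned by totally isotropic subspaces other than points. -/
def IsPartitioned (perp : V → V → Prop) (X : Set (ℙ F V)) : Prop :=
  ∃ S : Set (Submodule F V), (∀ U ∈ S, TotIsotropic perp U ∧ 2 ≤ finrank F U) ∧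
    (∀ U ∈ S, ∀ U' ∈ S, ∀ x ∈ U, x ∈ U' → x ≠ 0 → U = U') ∧ X = ⋃ U ∈ S, pointsOf U

/-- A point over L is an F-space of dimension [L : F], and distinct points over L share only the
zero vector. -/
lemma isPartitioned_reducePoints {perp : V → V → Prop} {L : Type u} [Field L] [Algebra F L]
    [Module L V] [IsScalarTower F L V] (hL : 2 ≤ finrank F L) {Y : Set (ℙ L V)} 
    (hY : ∀ R ∈ Y, ∀ x ∈ R.submodule, ∀ y ∈ R.submodule, perp x y) :
    IsPartitioned perp (reducePoints (F := F) Y) := by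
  refine ⟨(fun R => R.submodule.restrictScalars F) '' Y, ?_, ?_, ?_⟩
  · rintro _ ⟨R, hR, rfl⟩
    refine ⟨fun x hx y hy => hY R hR x hx y hy, ?_⟩
    have h1 : finrank L R.submodule = 1 := R.finrank_submodule
    have h2 := Module.finrank_mul_finrank F L R.submodule
    rw [h1, mul_one] at h2
    exact (hL.trans h2.le)
  · rintro _ ⟨R, hR, rfl⟩ _ ⟨R', hR', rfl⟩ x hx hx' hx0
    have h1 := (mem_submodule_iff hx0).1 ((Submodule.restrictScalars_mem F _ _).1 hx)
    have h2 := (mem_submodule_iff hx0).1 ((Submodule.restrictScalars_mem F _ _).1 hx')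
    rw [h1, h2]
  · ext P
    simp [reducePoints, pointsOf]

lemma IsClassical.isPartitioned {perp : V → V → Prop} {X : Set (ℙ F V)} (h6 : finrank F V = 6)
    (h : IsClassical perp X) : IsPartitioned perp X := by
  rcases h with ⟨L, _, _, _, _, σ, H, ε, m, Y, _, hodd, -, -, -, -, hp, hY, rfl⟩ |
    ⟨L, _, _, _, _, A, ε, m, Y, _, ht, -, -, hp, hY, rfl⟩
  · apply isPartitioned_reducePoints
    · have h2 := Module.finrank_mul_finrank F L V
      rw [h6] at h2
      by_contra hlt
      -- Degree 0 contradicts the product formula; degree 1 makes the dimension over L equal to 6,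
      -- which is even.
      interval_cases hF : finrank F L
      · omega
      · rw [one_mul] at h2
        rw [h2] at hodd
        exact absurd hodd (by decide)
    · intro R hR x hx y hy
      rw [hp, hY.1 R hR x hx y hy, mul_zero, map_zero]
  · apply isPartitioned_reducePoints ht
    intro R hR x hx y hy
    rw [hp, hY.1 R hR x hx y hy, mul_zero, map_zero]

/-- A vector on two lines of the system is orthogonal to the whole of the second line, which is
totally isotropic, so opposition makes it zero. -/
lemma FromOneSystem.isPartitioned [Fintype F] {perp : V → V → Prop} {X : Set (ℙ F V)}
    (h : FromOneSystem perp X) : IsPartitioned perp X := by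
  obtain ⟨S, ⟨h1, -, h2⟩, rfl⟩ := h
  refine ⟨S, fun U hU => ⟨(h1 U hU).2, (h1 U hU).1.ge⟩, ?_, rfl⟩
  intro U hU U' hU' x hx hx' hx0
  by_contra hne
  exact hx0 ((h2 hU hU' hne).1 x hx fun y hy => (h1 U' hU').2 x hx' y hy)

/-- A vector of a subspace of dimension at least two lies in a subspace of dimension two. -/
lemma exists_finrank_two {U : Submodule F V} (hU : 2 ≤ finrank F U) {x : V} (hx : x ∈ U)
    (hx0 : x ≠ 0) : ∃ y ∈ U, y ∉ F ∙ x ∧ finrank F (Submodule.span F {x, y}) = 2 ∧ 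
      Submodule.span F {x, y} ≤ U := by
  have hfin : FiniteDimensional F U := FiniteDimensional.of_finrank_pos (by omega)
  obtain ⟨y, hy, hyx⟩ : ∃ y ∈ U, y ∉ F ∙ x := by
    by_contra! hcon
    have hle : U ≤ F ∙ x := hcon
    have := Submodule.finrank_mono hle
    rw [finrank_span_singleton hx0] at this
    omega
  refine ⟨y, hy, hyx, ?_, ?_⟩
  · have hli : LinearIndependent F ![x, y] := by
      rw [LinearIndependent.pair_iff' hx0]
      exact fun a ha => hyx (Submodule.mem_span_singleton.2 ⟨a, ha⟩)
    have := finrank_span_eq_card hli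
    rwa [Matrix.range_cons_cons_empty, Fintype.card_fin] at this
  · rw [Submodule.span_le]
    rintro z (rfl | rfl) <;> assumption

end PolarSpace

/-! ### Fields of characteristic two and forms over them -/

section CharTwo

variable {F : Type u} [Field F]

lemma no_root_of_irreducible {δ : F}
    (h : Irreducible (Polynomial.X ^ 2 + Polynomial.X + Polynomial.C δ : Polynomial F)) (x : F) :
    x ^ 2 + x + δ ≠ 0 := by
  intro hx
  have h1 := Polynomial.degree_eq_one_of_irreducible_of_root h (x := x) (by simp [hx])
  have h2 : (Polynomial.X ^ 2 + Polynomial.X + Polynomial.C δ : Polynomial F).degree = 2 := by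
    compute_degree!
  rw [h2] at h1
  exact absurd h1 (by decide)

lemma eq_zero_of_anisotropic {δ : F} (h : ∀ x : F, x ^ 2 + x + δ ≠ 0) {x y : F}
    (hxy : x ^ 2 + x * y + δ * y ^ 2 = 0) : x = 0 ∧ y = 0 := by
  by_cases hy : y = 0
  · subst hy; simpa using hxy
  · refine absurd ?_ (h (x / y))
    field_simp
    linear_combination hxy

lemma nondegenerate_of_isAlt {V : Type w} [AddCommGroup V] [Module F V] 
    {B : LinearMap.BilinForm F V} (hB : B.IsAlt) (h : ∀ x, (∀ y, B x y = 0) → x = 0) :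
    B.Nondegenerate :=
  ⟨h, fun y hy => h y fun x => hB.isRefl _ _ (hy x)⟩

variable [CharP F 2]

lemma add_self_char_two (a : F) : a + a = 0 := CharTwo.add_self_eq_zero a

lemma eq_of_add_eq_zero_char_two {a b : F} (h : a + b = 0) : a = b := by
  linear_combination h - add_self_char_two b

lemma exists_sq_eq [Finite F] (a : F) : ∃ c : F, c ^ 2 = a := by
  obtain ⟨c, hc⟩ := (bijective_frobenius F 2).2 a
  exact ⟨c, hc⟩

lemma sq_injective_char_two {a b : F} (h : a ^ 2 = b ^ 2) : a = b := by
  have : (a + b) ^ 2 = 0 := by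
    linear_combination h + (b ^ 2 + a * b) * (CharTwo.two_eq_zero (R := F))
  exact eq_of_add_eq_zero_char_two (pow_eq_zero_iff (two_ne_zero) |>.1 this)

/-- Squaring is a bijection here. This is the source of every count of one zero per coset of a
nonsingular radical vector. -/
lemma existsUnique_add_sq_mul [Finite F] (a : F) {b : F} (hb : b ≠ 0) :
    ∃! c : F, a + c ^ 2 * b = 0 := by
  obtain ⟨c, hc⟩ := exists_sq_eq (a / b)
  refine ⟨c, ?_, fun d hd => ?_⟩
  · simp only [hc]; rw [div_mul_cancel₀ _ hb]; exact add_self_char_two a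
  · apply sq_injective_char_two
    rw [hc, eq_div_iff hb]
    exact (eq_of_add_eq_zero_char_two hd).symm

end CharTwo

/-! ### Common zeros of linear functionals -/

section Kernel

variable {F : Type u} [Field F] {V : Type w} [AddCommGroup V] [Module F V]

lemma exists_mem_of_two_functionals {U : Submodule F V} (hU : finrank F U = 3) (f g : V →ₗ[F] F) :
    ∃ y ∈ U, y ≠ 0 ∧ f y = 0 ∧ g y = 0 := by
  have : FiniteDimensional F U := FiniteDimensional.of_finrank_pos (by omega)
  have h1 := LinearMap.ker_ne_bot_of_finrank_lt (f := (f.prod g).domRestrict U)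
    (by rw [hU]; simp)
  obtain ⟨y, hy, hy0⟩ := Submodule.exists_mem_ne_zero_of_ne_bot h1
  have h2 : f y = 0 ∧ g y = 0 := by simpa using hy
  exact ⟨y, y.2, by simpa using hy0, h2.1, h2.2⟩

lemma exists_mem_of_functional {U : Submodule F V} (hU : finrank F U = 2) (f : V →ₗ[F] F) :
    ∃ y ∈ U, y ≠ 0 ∧ f y = 0 := by
  have : FiniteDimensional F U := FiniteDimensional.of_finrank_pos (by omega)
  have h1 := LinearMap.ker_ne_bot_of_finrank_lt (f := f.domRestrict U) (by rw [hU]; simp)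
  obtain ⟨y, hy, hy0⟩ := Submodule.exists_mem_ne_zero_of_ne_bot h1
  exact ⟨y, y.2, by simpa using hy0, by simpa using hy⟩

lemma finrank_span_pair_eq_two {x y : V} (h : LinearIndependent F ![x, y]) :
    finrank F (Submodule.span F {x, y}) = 2 := by
  have := finrank_span_eq_card h
  rwa [Matrix.range_cons_cons_empty, Fintype.card_fin] at this

end Kernel

/-! ### The quadric `O'` -/

section First

variable {F : Type u} [Field F] [CharP F 2]

omit [CharP F 2] in
lemma perpZero_iff (x y : Fin 6 → F) : perpZero x y ↔
    x 0 * y 5 + x 1 * y 4 + x 2 * y 3 + x 3 * y 2 + x 4 * y 1 + x 5 * y 0 = 0 := by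
  rw [perpZero, Fin.sum_univ_six]; rfl

lemma isW5_perpZero : IsW5 F (perpZero (F := F)) := by
  let B : LinearMap.BilinForm F (Fin 6 → F) := LinearMap.mk₂ F (fun x y => ∑ i, x i * y i.rev)
    (fun x y z => by simp [add_mul, Finset.sum_add_distrib])
    (fun c x y => by simp [Finset.mul_sum, mul_assoc])
    (fun x y z => by simp [mul_add, Finset.sum_add_distrib])
    (fun c x y => by simp [Finset.mul_sum, mul_left_comm])
  have hBe : ∀ x y, B x y = ∑ i, x i * y i.rev := fun x y => rfl
  have hB : B.IsAlt := fun x => by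
    rw [hBe, Fin.sum_univ_six]
    change x 0 * x 5 + x 1 * x 4 + x 2 * x 3 + x 3 * x 2 + x 4 * x 1 + x 5 * x 0 = 0
    linear_combination (x 0 * x 5 + x 1 * x 4 + x 2 * x 3) * CharTwo.two_eq_zero (R := F)
  refine ⟨by simp, B, hB, nondegenerate_of_isAlt hB fun x hx => ?_, fun x y => Iff.rfl⟩
  ext i
  have := hx (Pi.single i.rev 1)
  rw [hBe, Finset.sum_eq_single i] at this
  · simpa using this
  · intro j _ hj
    rw [Pi.single_eq_of_ne (by simpa using hj), mul_zero]
  · simp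

variable {δ μ : F}

omit [CharP F 2] in
lemma formMu_smul (c : F) (x : Fin 6 → F) : formMu δ μ (c • x) = c ^ 2 * formMu δ μ x := by
  simp only [formMu, Pi.smul_apply, smul_eq_mul]; ring

/-- The polar form is the symplectic form of `perpZero` plus the rank-two term with factor μ, so on
totally isotropic subspaces only that term survives. -/
lemma formMu_add (x y : Fin 6 → F) : formMu δ μ (x + y) = formMu δ μ x + formMu δ μ y +
    (x 0 * y 5 + x 1 * y 4 + x 2 * y 3 + x 3 * y 2 + x 4 * y 1 + x 5 * y 0 +
      μ * (x 3 * y 4 + x 4 * y 3)) := by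
  simp only [formMu, Pi.add_apply]
  linear_combination (x 0 * y 0 + δ * x 5 * y 5 + μ * x 3 * y 3 + μ * δ * x 4 * y 4) * 
    CharTwo.two_eq_zero (R := F)

omit [CharP F 2] in
lemma cone_ovoidFirst : cone (ovoidFirst δ μ) = {x | formMu δ μ x = 0} :=
  cone_zeroLocus formMu_smul

omit [CharP F 2] in
lemma formMu_of_eq_zero {x : Fin 6 → F} (h3 : x 3 = 0) (h4 : x 4 = 0) :
    formMu δ μ x = x 0 ^ 2 + x 0 * x 5 + δ * x 5 ^ 2 := by
  simp [formMu, h3, h4]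

omit [CharP F 2] in
lemma end_coords_eq_zero (hδ : ∀ x : F, x ^ 2 + x + δ ≠ 0) {x : Fin 6 → F} 
    (hx : formMu δ μ x = 0) (h3 : x 3 = 0) (h4 : x 4 = 0) : x 0 = 0 ∧ x 5 = 0 := by
  rw [formMu_of_eq_zero h3 h4] at hx
  exact eq_zero_of_anisotropic hδ hx

-- If the radical were singular throughout, its vectors with vanishing coordinates 3 and 4 would lie
-- on the axis x₀ = x₃ = x₄ = x₅ = 0, by anisotropy. Orthogonality then forces all of U into the
-- axis, which has dimension only 2.
omit [CharP F 2] in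
lemma exists_nonsingular_radical (hδ : ∀ x : F, x ^ 2 + x + δ ≠ 0)
    {U : Submodule F (Fin 6 → F)} (hU : finrank F U = 3) (hp : TotIsotropic perpZero U) :
    ∃ r ∈ U, formMu δ μ r ≠ 0 ∧ ∀ x ∈ U, x 3 * r 4 + x 4 * r 3 = 0 := by
  by_contra! hcon
  -- Such a vector is automatically radical, hence singular by assumption.
  have hN : ∀ r ∈ U, r 3 = 0 → r 4 = 0 → r 0 = 0 ∧ r 5 = 0 := by
    intro r hr h3 h4
    refine end_coords_eq_zero (μ := μ) hδ ?_ h3 h4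
    by_contra hne
    obtain ⟨x, hx, hx'⟩ := hcon r hr hne
    simp [h3, h4] at hx'
  let p : Fin 6 → ((Fin 6 → F) →ₗ[F] F) := LinearMap.proj
  obtain ⟨r, hr, hr0, h3, h4⟩ := exists_mem_of_two_functionals hU (p 3) (p 4)
  change r 3 = 0 at h3; change r 4 = 0 at h4
  obtain ⟨h0, h5⟩ := hN r hr h3 h4
  have hrx : ∀ x ∈ U, r 1 * x 4 + r 2 * x 3 = 0 := by
    intro x hx
    have := (perpZero_iff _ _).1 (hp r hr x hx)
    simpa [h0, h3, h4, h5] using this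
  -- Orthogonality to r gives one linear relation between coordinates 3 and 4. It allows a second,
  -- independent axis vector y to be found in U, and y gives the other relation.
  have hvan : ∀ x ∈ U, x 3 = 0 ∧ x 4 = 0 := by
    by_cases h1 : r 1 = 0
    · have h2 : r 2 ≠ 0 := fun h2 => hr0 (by ext i; fin_cases i <;> assumption)
      have hx3 : ∀ x ∈ U, x 3 = 0 := fun x hx => by
        have := hrx x hx
        simpa [h1, h2] using this
      obtain ⟨y, hy, hy0, hy4, hy2⟩ := exists_mem_of_two_functionals hU (p 4) (p 2)
      change y 4 = 0 at hy4; change y 2 = 0 at hy2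
      obtain ⟨k0, k5⟩ := hN y hy (hx3 y hy) hy4
      have k1 : y 1 ≠ 0 := fun k1 => hy0 (by ext i; fin_cases i <;> [exact k0; exact k1; exact hy2; exact hx3 y hy; exact hy4; exact k5])
      intro x hx
      refine ⟨hx3 x hx, ?_⟩
      have := (perpZero_iff _ _).1 (hp y hy x hx)
      simpa [k0, k5, hx3 y hy, hy4, hy2, k1] using this
    · have hx4 : ∀ x ∈ U, x 3 = 0 → x 4 = 0 := fun x hx hx3 => by
        have := hrx x hx
        simpa [h1, hx3] using this
      obtain ⟨y, hy, hy0, hy3, hy1⟩ := exists_mem_of_two_functionals hU (p 3) (p 1)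
      change y 3 = 0 at hy3; change y 1 = 0 at hy1
      have hy4 := hx4 y hy hy3
      obtain ⟨k0, k5⟩ := hN y hy hy3 hy4
      have k2 : y 2 ≠ 0 := fun k2 => hy0 (by ext i; fin_cases i <;> [exact k0; exact hy1; exact k2; exact hy3; exact hy4; exact k5])
      intro x hx
      have hx3 : x 3 = 0 := by
        have := (perpZero_iff _ _).1 (hp y hy x hx)
        simpa [k0, k5, hy3, hy4, hy1, k2] using this
      exact ⟨hx3, hx4 x hx hx3⟩
  obtain ⟨y, hy, hy0, hy1, hy2⟩ := exists_mem_of_two_functionals hU (p 1) (p 2)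
  obtain ⟨k3, k4⟩ := hvan y hy
  obtain ⟨k0, k5⟩ := hN y hy k3 k4
  exact hy0 (by ext i; fin_cases i <;> assumption)

/-- In the direction of a nonsingular radical vector r the form changes by c² times its value at r,
so each line of direction r contains one singular vector. -/
theorem isOvoidW5_ovoidFirst [Finite F] (hδ : ∀ x : F, x ^ 2 + x + δ ≠ 0) :
    IsOvoidW5 perpZero (Nat.card F + 1) (ovoidFirst δ μ) := by
  refine isW5_perpZero.isOvoidW5 fun U hU hp => ncard_of_cone_sq ?_
  rw [cone_inter, cone_pointsOf, cone_ovoidFirst]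
  obtain ⟨r, hr, hr0, hrad⟩ := exists_nonsingular_radical (μ := μ) hδ hU hp
  have h1 := ncard_mul_of_existsUnique (Z := {x | formMu δ μ x = 0} ∩ U)
    Set.inter_subset_right hr fun x hx => by
      have h : ∀ c : F, x + c • r ∈ {x | formMu δ μ x = 0} ∩ (U : Set (Fin 6 → F)) ↔
          formMu δ μ x + c ^ 2 * formMu δ μ r = 0 := by
        intro c
        have h2 : x + c • r ∈ U := U.add_mem hx (U.smul_mem c hr)
        have h3 := (perpZero_iff _ _).1 (hp x hx r hr)
        simp only [Set.mem_inter_iff, SetLike.mem_coe, h2, and_true, Set.mem_ofPred_eq]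
        rw [formMu_add, formMu_smul]
        simp only [Pi.smul_apply, smul_eq_mul]
        have h4 := hrad x hx
        constructor <;> intro h
        · linear_combination h - c * h3 - μ * c * h4
        · linear_combination h + c * h3 + μ * c * h4
      simp only [h]
      exact existsUnique_add_sq_mul _ hr0
  rw [natCard_submodule, hU, pow_succ] at h1
  exact (Nat.eq_of_mul_eq_mul_right Nat.card_pos h1).symm

omit [CharP F 2] in
lemma mem_pair_iff {V : Type w} [AddCommGroup V] [Module F V] {x y z : V} :
    z ∈ Submodule.span F {x, y} ↔ ∃ a b : F, a • x + b • y = z := Submodule.mem_span_pair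

omit [CharP F 2] in
lemma eq_span_pair {V : Type w} [AddCommGroup V] [Module F V] {U : Submodule F V}
    (hU : finrank F U = 2) {x y : V} (hx : x ∈ U) (hy : y ∈ U)
    (h : LinearIndependent F ![x, y]) : Submodule.span F {x, y} = U := by
  have : FiniteDimensional F U := FiniteDimensional.of_finrank_pos (by omega)
  apply Submodule.eq_of_le_of_finrank_eq
  · rw [Submodule.span_le]
    rintro z (rfl | rfl) <;> assumption
  · rw [finrank_span_pair_eq_two h, hU]

/-- The subspaces that are the lines of `W(5, q)` contained in `O'`. -/
def lineSpacesFirst (δ μ : F) : Set (Submodule F (Fin 6 → F)) :=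
  {U | finrank F U = 2 ∧ TotIsotropic perpZero U ∧ pointsOf U ⊆ ovoidFirst δ μ}

omit [CharP F 2] in
lemma singular_of_mem_lineSpacesFirst {U : Submodule F (Fin 6 → F)}
    (hU : U ∈ lineSpacesFirst δ μ) {x : Fin 6 → F} (hx : x ∈ U) : formMu δ μ x = 0 := by
  have := pointsOf_subset_iff.1 hU.2.2 hx
  rwa [cone_ovoidFirst] at this

/-- On such a line both the polar form of the quadric and the symplectic form vanish; their
difference is μ times this expression. -/
lemma wedge_of_mem_lineSpacesFirst (hμ : μ ≠ 0) {U : Submodule F (Fin 6 → F)}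
    (hU : U ∈ lineSpacesFirst δ μ) {x y : Fin 6 → F} (hx : x ∈ U) (hy : y ∈ U) :
    x 3 * y 4 + x 4 * y 3 = 0 := by
  have h := formMu_add (δ := δ) (μ := μ) x y
  rw [singular_of_mem_lineSpacesFirst hU hx, singular_of_mem_lineSpacesFirst hU hy,
    singular_of_mem_lineSpacesFirst hU (U.add_mem hx hy),
    (perpZero_iff _ _).1 (hU.2.1 x hx y hy)] at h
  simpa [hμ] using h.symm

/-- The vanishing wedge makes the map (x₃, x₄) of rank at most 1 on U, so it has a nonzero kernel
vector, and anisotropy removes coordinates 0 and 5. Thus every contained line meets the axis. -/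
lemma exists_mem_axis (hδ : ∀ x : F, x ^ 2 + x + δ ≠ 0) (hμ : μ ≠ 0) 
    {U : Submodule F (Fin 6 → F)} (hU : U ∈ lineSpacesFirst δ μ) :
    ∃ r ∈ U, r ≠ 0 ∧ r 0 = 0 ∧ r 3 = 0 ∧ r 4 = 0 ∧ r 5 = 0 := by
  suffices h : ∃ r ∈ U, r ≠ 0 ∧ r 3 = 0 ∧ r 4 = 0 by
    obtain ⟨r, hr, hr0, h3, h4⟩ := h
    obtain ⟨h0, h5⟩ := end_coords_eq_zero hδ (singular_of_mem_lineSpacesFirst hU hr) h3 h4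
    exact ⟨r, hr, hr0, h0, h3, h4, h5⟩
  obtain ⟨r, hr, hr0, h3⟩ := exists_mem_of_functional hU.1 (LinearMap.proj 3)
  change r 3 = 0 at h3
  by_cases h4 : r 4 = 0
  · exact ⟨r, hr, hr0, h3, h4⟩
  · have hx3 : ∀ x ∈ U, x 3 = 0 := fun x hx => by
      have := wedge_of_mem_lineSpacesFirst hμ hU hx hr
      simpa [h3, h4] using this
    obtain ⟨s, hs, hs0, h4⟩ := exists_mem_of_functional hU.1 (LinearMap.proj 4)
    exact ⟨s, hs, hs0, hx3 s hs, h4⟩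

/-- A spanning pair for each of the lines of `O'`. -/
def firstPair (δ μ : F) : Option (Option F × F × F) → (Fin 6 → F) × (Fin 6 → F)
  | none => (![0, 1, 0, 0, 0, 0], ![0, 0, 1, 0, 0, 0])
  | some (none, a, b) => (![0, 0, 1, 0, 0, 0], 
      ![a, a ^ 2 + a * b + δ * b ^ 2 + μ * δ, 0, 0, 1, b])
  | some (some m, a, b) => (![0, 1, m, 0, 0, 0],
      ![a, 0, a ^ 2 + a * b + δ * b ^ 2 + μ * (1 + m + δ * m ^ 2), 1, m, b])

/-- The line of `O'` spanned by `firstPair`. -/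
def firstLine (δ μ : F) (p : Option (Option F × F × F)) : Submodule F (Fin 6 → F) :=
  Submodule.span F {(firstPair δ μ p).1, (firstPair δ μ p).2}

omit [CharP F 2] in
lemma linearIndependent_firstPair (p : Option (Option F × F × F)) :
    LinearIndependent F ![(firstPair δ μ p).1, (firstPair δ μ p).2] := by
  rw [LinearIndependent.pair_iff]
  intro s t h
  match p with
  | none => 
    have h1 := congrFun h 1
    have h2 := congrFun h 2
    simpa [firstPair] using And.intro h1 h2
  | some (none, a, b) =>
    have h1 := congrFun h 2
    have h2 := congrFun h 4
    simpa [firstPair] using And.intro h1 h2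
  | some (some m, a, b) =>
    have h1 := congrFun h 1
    have h2 := congrFun h 3
    simpa [firstPair] using And.intro h1 h2

lemma firstLine_mem (p : Option (Option F × F × F)) :
    firstLine δ μ p ∈ lineSpacesFirst δ μ := by
  have h2 : (2 : F) = 0 := CharTwo.two_eq_zero
  have hQ : formMu δ μ (firstPair δ μ p).1 = 0 ∧ formMu δ μ (firstPair δ μ p).2 = 0 ∧
      perpZero (firstPair δ μ p).1 (firstPair δ μ p).2 ∧ 
      (firstPair δ μ p).1 3 = 0 ∧ (firstPair δ μ p).1 4 = 0 := by
    rw [perpZero_iff]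
    match p with
    | none => simp [firstPair, formMu]
    | some (none, a, b) => 
      simp only [firstPair, formMu]
      refine ⟨by simp, ?_, by simp, by simp, by simp⟩
      simp
      linear_combination (a ^ 2 + a * b + δ * b ^ 2 + μ * δ) * h2
    | some (some m, a, b) =>
      simp only [firstPair, formMu]
      refine ⟨by simp, ?_, ?_, by simp, by simp⟩
      · simp
        linear_combination (a ^ 2 + a * b + δ * b ^ 2 + μ * (1 + m + δ * m ^ 2)) * h2
      · simp
        linear_combination m * h2
  obtain ⟨q1, q2, hp, q3, q4⟩ := hQ
  set x := (firstPair δ μ p).1 with hx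
  set y := (firstPair δ μ p).2 with hy
  refine ⟨finrank_span_pair_eq_two (linearIndependent_firstPair p), ?_, ?_⟩
  · intro z hz z' hz'
    obtain ⟨a, b, rfl⟩ := mem_pair_iff.1 hz
    obtain ⟨a', b', rfl⟩ := mem_pair_iff.1 hz'
    rw [perpZero_iff] at hp ⊢
    simp only [← hx, ← hy, Pi.add_apply, Pi.smul_apply, smul_eq_mul]
    linear_combination (a * b' + a' * b) * hp + (a * a' * (x 0 * x 5 + x 1 * x 4 + x 2 * x 3) +
      b * b' * (y 0 * y 5 + y 1 * y 4 + y 2 * y 3)) * h2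
  · rw [pointsOf_subset_iff, cone_ovoidFirst]
    intro z hz
    obtain ⟨a, b, rfl⟩ := mem_pair_iff.1 hz
    rw [perpZero_iff] at hp
    simp only [← hx, ← hy, Set.mem_ofPred_eq, formMu_add, formMu_smul, q1, q2, Pi.smul_apply, smul_eq_mul, q3, q4]
    linear_combination a * b * hp - a * b * y 2 * q3 - a * b * y 1 * q4

omit [CharP F 2] in
lemma firstLine_injective : Function.Injective (firstLine δ μ) := by
  intro p p' h
  have h2 : (firstPair δ μ p').2 ∈ firstLine δ μ p := by
    rw [h]; exact Submodule.subset_span (by simp)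
  have h1 : (firstPair δ μ p).2 ∈ firstLine δ μ p' := by
    rw [← h]; exact Submodule.subset_span (by simp)
  obtain ⟨s, t, h2⟩ := mem_pair_iff.1 h2
  obtain ⟨s', t', h1⟩ := mem_pair_iff.1 h1
  match p, p' with
  | none, none => rfl
  | none, some (none, a, b) => simpa [firstPair] using congrFun h2 4
  | none, some (some m, a, b) => simpa [firstPair] using congrFun h2 3
  | some (none, a, b), none => simpa [firstPair] using congrFun h1 4
  | some (some m, a, b), none => simpa [firstPair] using congrFun h1 3
  | some (none, a, b), some (some m', a', b') => simpa [firstPair] using congrFun h2 3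
  | some (some m', a', b'), some (none, a, b) => simpa [firstPair] using congrFun h1 3
  | some (none, a, b), some (none, a', b') =>
    have k4 : t = 1 := by simpa [firstPair] using congrFun h2 4
    have k0 := congrFun h2 0
    have k5 := congrFun h2 5
    simp [firstPair, k4] at k0 k5
    rw [k0, k5]
  | some (some m, a, b), some (some m', a', b') =>
    have k4 : t = 1 := by simpa [firstPair] using congrFun h2 3
    have k0 := congrFun h2 0
    have k1 := congrFun h2 1
    have km := congrFun h2 4
    have k5 := congrFun h2 5
    simp [firstPair, k4] at k0 k5 k1 km
    rw [k0, k5, km]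

/-- The point where the line meets the axis gives the slope m in F ∪ {∞}. A second vector, reduced
modulo the first and scaled, has free coordinates a and b, and singularity determines the last one.
Only the axis itself has no such second vector. -/
lemma exists_firstLine_eq (hδ : ∀ x : F, x ^ 2 + x + δ ≠ 0) (hμ : μ ≠ 0)
    {U : Submodule F (Fin 6 → F)} (hU : U ∈ lineSpacesFirst δ μ) : ∃ p, firstLine δ μ p = U := by
  have htwo : (2 : F) = 0 := CharTwo.two_eq_zero
  suffices h : ∃ p, (firstPair δ μ p).1 ∈ U ∧ (firstPair δ μ p).2 ∈ U by
    obtain ⟨p, h1, h2⟩ := h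
    exact ⟨p, eq_span_pair hU.1 h1 h2 (linearIndependent_firstPair p)⟩
  obtain ⟨r, hr, hr0, r0, r3, r4, r5⟩ := exists_mem_axis hδ hμ hU
  by_cases hall : ∀ x ∈ U, x 3 = 0 ∧ x 4 = 0
  · have hle : U ≤ firstLine δ μ none := by
      intro x hx
      obtain ⟨h3, h4⟩ := hall x hx
      obtain ⟨h0, h5⟩ := end_coords_eq_zero hδ (singular_of_mem_lineSpacesFirst hU hx) h3 h4
      refine mem_pair_iff.2 ⟨x 1, x 2, ?_⟩
      ext i; fin_cases i <;> simp [firstPair, *]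
    have heq := Submodule.eq_of_le_of_finrank_eq hle 
      (hU.1.trans (firstLine_mem (δ := δ) (μ := μ) none).1.symm)
    refine ⟨none, ?_, ?_⟩ <;> rw [heq] <;> exact Submodule.subset_span (by simp)
  · push Not at hall
    obtain ⟨x, hx, hx34⟩ := hall
    have hperp := (perpZero_iff _ _).1 (hU.2.1 r hr x hx)
    simp only [r0, r3, r4, r5, zero_mul, zero_add, add_zero] at hperp
    by_cases r1 : r 1 = 0
    · have r2 : r 2 ≠ 0 := fun r2 => hr0 (by ext i; fin_cases i <;> assumption)
      have x3 : x 3 = 0 := by simpa [r1, r2] using hperp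
      have x4 := hx34 x3
      -- The normalized second vector: coordinate 2 is removed with r and coordinate 4 becomes 1.
      have hx2 : (x 4)⁻¹ • (x - (x 2 / r 2) • r) ∈ U :=
        U.smul_mem _ (U.sub_mem hx (U.smul_mem _ hr))
      refine ⟨some (none, x 0 / x 4, x 5 / x 4), ?_, ?_⟩
      · convert U.smul_mem (r 2)⁻¹ hr using 1
        ext i; fin_cases i <;> simp [firstPair, *]
      · convert hx2 using 1
        have hs := singular_of_mem_lineSpacesFirst hU hx2
        simp only [formMu, Pi.smul_apply, Pi.sub_apply, smul_eq_mul, r0, r1, r3, r4, r5, x3,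
          mul_zero, sub_zero, inv_mul_cancel₀ x4, div_mul_cancel₀ _ r2, sub_self, zero_mul] at hs
        ext i; fin_cases i
        · simp [firstPair, r0]; field_simp
        · simp [firstPair, r1]
          linear_combination (norm := (field_simp; ring)) hs - (x 1 / x 4) * htwo
        · simp [firstPair, r2]
        · simp [firstPair, x3, r3]
        · simp [firstPair, x4, r4]
        · simp [firstPair, r5]; field_simp
    · have x3 : x 3 ≠ 0 := fun x3 => hx34 x3 (by simpa [x3, r1] using hperp)
      -- Orthogonality to r makes (x₃, x₄) proportional to (r₁, r₂), so the slope m occurs in both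
      -- spanning vectors.
      have hm : x 4 = r 2 / r 1 * x 3 := by
        field_simp
        linear_combination hperp - r 2 * x 3 * htwo
      have hx2 : (x 3)⁻¹ • (x - (x 1 / r 1) • r) ∈ U :=
        U.smul_mem _ (U.sub_mem hx (U.smul_mem _ hr))
      refine ⟨some (some (r 2 / r 1), x 0 / x 3, x 5 / x 3), ?_, ?_⟩
      · convert U.smul_mem (r 1)⁻¹ hr using 1
        ext i; fin_cases i <;> simp [firstPair, *]; field_simp
      · convert hx2 using 1
        have hs := singular_of_mem_lineSpacesFirst hU hx2
        simp only [formMu, Pi.smul_apply, Pi.sub_apply, smul_eq_mul, r0, r3, r4, r5,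
          mul_zero, sub_zero, inv_mul_cancel₀ x3, div_mul_cancel₀ _ r1, sub_self, zero_mul] at hs
        ext i; fin_cases i
        · simp [firstPair, r0]; field_simp
        · simp [firstPair, r1]
        · simp [firstPair]
          rw [hm] at hs
          linear_combination (norm := (field_simp; ring)) hs - 
            (x 2 / x 3 - x 1 / r 1 * r 2 / x 3) * htwo
        · simp [firstPair, x3, r3]
        · simp [firstPair, r4, hm]; field_simp
        · simp [firstPair, r5]; field_simp

theorem ncard_linesIn_ovoidFirst [Finite F] (hδ : ∀ x : F, x ^ 2 + x + δ ≠ 0) (hμ : μ ≠ 0) :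
    (linesIn perpZero (ovoidFirst δ μ)).ncard = Nat.card F ^ 2 * (Nat.card F + 1) + 1 := by
  rw [ncard_linesIn]
  have : lineSpacesFirst δ μ = Set.range (firstLine δ μ) := by
    ext U
    constructor
    · exact fun hU => exists_firstLine_eq hδ hμ hU
    · rintro ⟨p, rfl⟩; exact firstLine_mem p
  change (lineSpacesFirst δ μ).ncard = _
  rw [this, ← Nat.card_coe_set_eq, Nat.card_range_of_injective firstLine_injective,
    Finite.card_option, Nat.card_prod, Nat.card_prod, Finite.card_option]
  ring

/-- All contained lines through certain points pass through one point of the axis, so these points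
would lie in the same member of a partition. Two of them are not orthogonal. -/
theorem not_isPartitioned_ovoidFirst [Finite F] (hδ : ∀ x : F, x ^ 2 + x + δ ≠ 0) (hμ : μ ≠ 0) :
    ¬ IsPartitioned perpZero (ovoidFirst δ μ) := by
  have htwo : (2 : F) = 0 := CharTwo.two_eq_zero
  rintro ⟨S, hS, hdisj, hX⟩
  -- A contained line through x meets the axis in a vector r orthogonal to x, and x₃ = 1, x₄ = 0
  -- give r₂ = 0.
  have key : ∀ x : Fin 6 → F, formMu δ μ x = 0 → x 3 = 1 → x 4 = 0 →
      ∃ U ∈ S, x ∈ U ∧ ![0, 1, 0, 0, 0, 0] ∈ U := by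
    intro x hx h3 h4
    have hx0 : x ≠ 0 := fun h => by simp [h] at h3
    have hm : mk F x hx0 ∈ ovoidFirst δ μ := (mk_mem_zeroLocus formMu_smul hx0).2 hx
    rw [hX] at hm
    obtain ⟨U, hU, hxU⟩ := Set.mem_iUnion₂.1 hm
    rw [mk_mem_pointsOf] at hxU
    obtain ⟨y, hy, -, hdim, hle⟩ := exists_finrank_two (hS U hU).2 hxU hx0
    have hmem : Submodule.span F {x, y} ∈ lineSpacesFirst δ μ := by
      refine ⟨hdim, fun a ha b hb => (hS U hU).1 a (hle ha) b (hle hb), ?_⟩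
      rw [hX]
      exact fun P hP => Set.mem_iUnion₂.2 ⟨U, hU, le_trans hP hle⟩
    obtain ⟨r, hr, hr0, r0, r3, r4, r5⟩ := exists_mem_axis hδ hμ hmem
    have hperp := (perpZero_iff _ _).1 ((hS U hU).1 r (hle hr) x hxU)
    simp only [r0, r3, r4, r5, h3, h4, zero_mul, zero_add, add_zero, mul_zero, mul_one] at hperp
    have r1 : r 1 ≠ 0 := fun r1 => hr0 (by ext i; fin_cases i <;> assumption)
    refine ⟨U, hU, hxU, ?_⟩
    convert U.smul_mem (r 1)⁻¹ (hle hr) using 1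
    ext i; fin_cases i <;> simp [*]
  -- This vector and the next one are singular, and their symplectic product is μ + (μ + 1) = 1.
  obtain ⟨U, hU, hx, hr⟩ := key ![0, 0, μ, 1, 0, 0] (by
    simp [formMu]; exact add_self_char_two μ) rfl rfl
  obtain ⟨U', hU', hx', hr'⟩ := key ![1, 0, μ + 1, 1, 0, 0] (by
    simp [formMu]; linear_combination (μ + 1) * htwo) rfl rfl
  have heq := hdisj U hU U' hU' _ hr hr' (fun h => by simpa using congrFun h 1)
  subst heq
  have := (perpZero_iff _ _).1 ((hS U hU).1 _ hx _ hx')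
  simp at this
  exact one_ne_zero (α := F) (by linear_combination this - μ * htwo)

end First

/-! ### Additive maps with kernel of order two, alternating forms in dimension three -/

section Auxiliary

variable {F : Type u} [Field F]

/-- The kernel is {0, 1}, so the range has index 2. The lemma is applied to x ↦ x² + x and to b ↦ b
+ ρ b. -/
lemma add_mem_range_iff [Finite F] (f : F →+ F) (h1 : f 1 = 0)
    (hker : ∀ x, f x = 0 → x = 0 ∨ x = 1) (a b : F) :
    a + b ∈ f.range ↔ (a ∈ f.range ↔ b ∈ f.range) := by
  apply AddSubgroup.add_mem_iff_of_index_two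
  have h2 : Nat.card f.ker = 2 := by
    have : (f.ker : Set F) = {0, 1} := by
      ext x
      constructor
      · exact fun hx => hker x hx
      · rintro (rfl | rfl)
        · exact map_zero f
        · exact h1
    rw [← SetLike.coe_sort_coe, Nat.card_coe_set_eq, this, Set.ncard_pair zero_ne_one]
  have h3 := f.ker.card_mul_index
  rw [AddSubgroup.index_ker, h2] at h3
  have h4 := f.range.card_mul_index
  rw [← h3, mul_comm] at h4
  exact Nat.eq_of_mul_eq_mul_right Nat.card_pos h4

/-- In a basis the radical vector is the cross product formed from the three values of the form; if
all of them vanish, any basis vector serves. -/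
lemma exists_mem_radical {W : Type w} [AddCommGroup W] [Module F W] (h3 : finrank F W = 3)
    {B : LinearMap.BilinForm F W} (hB : B.IsAlt) : ∃ r, r ≠ 0 ∧ ∀ x, B x r = 0 := by
  have : FiniteDimensional F W := FiniteDimensional.of_finrank_pos (by omega)
  let b := finBasisOfFinrankEq F W h3
  have hsymm : ∀ x y, B x y = - B y x := fun x y => (hB.neg_eq y x).symm
  have hexp : ∀ r, (∀ i, B (b i) r = 0) → ∀ x, B x r = 0 := by
    intro r hr x
    have h : B.flip r = 0 := b.ext fun i => by simpa using hr i
    simpa using LinearMap.congr_fun h x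
  by_cases hz : B (b 1) (b 2) = 0 ∧ B (b 0) (b 2) = 0 ∧ B (b 0) (b 1) = 0
  · refine ⟨b 0, b.ne_zero 0, hexp _ fun i => ?_⟩
    fin_cases i
    · exact hB _
    · change B (b 1) (b 0) = 0
      rw [hsymm, hz.2.2, neg_zero]
    · change B (b 2) (b 0) = 0
      rw [hsymm, hz.2.1, neg_zero]
  · refine ⟨B (b 1) (b 2) • b 0 - B (b 0) (b 2) • b 1 + B (b 0) (b 1) • b 2, ?_, hexp _ fun i => ?_⟩
    · intro h
      have hr : ∀ i, b.repr (B (b 1) (b 2) • b 0 - B (b 0) (b 2) • b 1 + B (b 0) (b 1) • b 2) i = 0 :=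
        fun i => by rw [h]; simp
      have k0 := hr 0
      have k1 := hr 1
      have k2 := hr 2
      simp at k0 k1 k2
      exact hz ⟨k0, k1, k2⟩
    · fin_cases i
      · simp only [Fin.zero_eta, Fin.isValue, map_add, map_sub, map_smul, smul_eq_mul, hB (b 0)]
        ring
      · simp only [Fin.mk_one, Fin.isValue, map_add, map_sub, map_smul, smul_eq_mul, hB (b 1)]
        rw [hsymm (b 1) (b 0)]; ring
      · simp only [Fin.reduceFinMk, Fin.isValue, map_add, map_sub, map_smul, smul_eq_mul, hB (b 2)]
        rw [hsymm (b 2) (b 0), hsymm (b 2) (b 1)]; ring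

end Auxiliary

/-! ### The elliptic quadric of `PG(3, q ^ 2)` -/

section QuadricK

variable {K : Type w} [Field K]

/-- The quadratic form `UV + W ^ 2 + WZ + γ Z ^ 2`. -/
def phi (γ : K) (x : Fin 4 → K) : K := x 0 * x 1 + x 2 ^ 2 + x 2 * x 3 + γ * x 3 ^ 2

/-- The polar form of `phi`. -/
def polarPhi (x y : Fin 4 → K) : K := x 0 * y 1 + x 1 * y 0 + x 2 * y 3 + x 3 * y 2

lemma polarPhi_add_left (x y z : Fin 4 → K) :
    polarPhi (x + y) z = polarPhi x z + polarPhi y z := by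
  simp only [polarPhi, Pi.add_apply]; ring

lemma polarPhi_smul_left (c : K) (x z : Fin 4 → K) : polarPhi (c • x) z = c * polarPhi x z := by
  simp only [polarPhi, Pi.smul_apply, smul_eq_mul]; ring

lemma polarPhi_comm (x y : Fin 4 → K) : polarPhi x y = polarPhi y x := by
  simp only [polarPhi]; ring

lemma phi_smul (γ c : K) (x : Fin 4 → K) : phi γ (c • x) = c ^ 2 * phi γ x := by
  simp only [phi, Pi.smul_apply, smul_eq_mul]; ring

variable [CharP K 2]

lemma polarPhi_self (x : Fin 4 → K) : polarPhi x x = 0 := by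
  simp only [polarPhi]
  linear_combination (x 0 * x 1 + x 2 * x 3) * CharTwo.two_eq_zero (R := K)

lemma phi_add (γ : K) (x y : Fin 4 → K) : phi γ (x + y) = phi γ x + phi γ y + polarPhi x y := by
  simp only [phi, polarPhi, Pi.add_apply]
  linear_combination (x 2 * y 2 + γ * x 3 * y 3) * CharTwo.two_eq_zero (R := K)

/-- The quadric contains no line. -/
lemma exists_smul_eq_of_singular {γ : K} (hγ : ∀ x : K, x ^ 2 + x + γ ≠ 0) {x y : Fin 4 → K}
    (hx : phi γ x = 0) (hy : phi γ y = 0) (hxy : polarPhi x y = 0) (hy0 : y ≠ 0) :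
    ∃ c : K, x = c • y := by
  have htwo : (2 : K) = 0 := CharTwo.two_eq_zero
  have aux : ∀ x y : Fin 4 → K, phi γ x = 0 → phi γ y = 0 → polarPhi x y = 0 → y 3 = 0 → y ≠ 0 →
      ∃ c : K, x = c • y := by
    intro x y hx hy hxy h3 hy0
    simp only [phi, polarPhi, h3] at hx hy hxy
    by_cases h0 : y 0 = 0
    · have h2 : y 2 = 0 := by simpa [h0] using hy
      have h1 : y 1 ≠ 0 := fun h1 => hy0 (by ext i; fin_cases i <;> assumption)
      have x0 : x 0 = 0 := by simpa [h0, h1, h2] using hxy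
      obtain ⟨k2, k3⟩ := eq_zero_of_anisotropic hγ (x := x 2) (y := x 3) (by
        linear_combination hx - x 1 * x0)
      refine ⟨x 1 / y 1, ?_⟩
      ext i; fin_cases i <;> simp [*]
    -- Eliminating coordinate 1 of both vectors from the three hypotheses leaves the anisotropic
    -- binary form.
    · obtain ⟨k2, k3⟩ := eq_zero_of_anisotropic hγ (x := x 2 * y 0 + x 0 * y 2) (y := y 0 * x 3) (by
        linear_combination y 0 ^ 2 * hx + x 0 * y 0 * hxy + x 0 ^ 2 * hy +
          (x 2 * x 0 * y 0 * y 2 - x 0 ^ 2 * y 0 * y 1 - x 0 * x 1 * y 0 ^ 2) * htwo)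
      have x3 : x 3 = 0 := by simpa [h0] using k3
      rw [x3] at hxy
      have x2 : x 2 * y 0 = x 0 * y 2 := eq_of_add_eq_zero_char_two k2
      have x1 : x 1 * y 0 = x 0 * y 1 := eq_of_add_eq_zero_char_two (by linear_combination hxy)
      refine ⟨x 0 / y 0, ?_⟩
      ext i; fin_cases i
      · simp [h0]
      · simp; field_simp; exact x1
      · simp; field_simp; exact x2
      · simp [x3, h3]
  by_cases h3 : y 3 = 0
  · exact aux x y hx hy hxy h3 hy0
  -- Modulo y the vector x can be given last coordinate 0. If the result s is nonzero, the special
  -- case with the roles exchanged makes y a multiple of s, against y 3 ≠ 0.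
  · set s := x + (x 3 / y 3) • y with hs
    have s3 : s 3 = 0 := by
      simp [hs, h3]; exact add_self_char_two _
    have hs1 : polarPhi y s = 0 := by
      rw [polarPhi_comm, hs, polarPhi_add_left, polarPhi_smul_left, polarPhi_self, hxy]; ring
    have hs2 : phi γ s = 0 := by
      rw [hs, phi_add, phi_smul, polarPhi_comm, polarPhi_smul_left, polarPhi_comm, hx, hy, hxy]
      ring
    by_cases hs0 : s = 0
    · refine ⟨x 3 / y 3, ?_⟩
      ext i
      have := congrFun hs0 i
      rw [hs] at this
      exact eq_of_add_eq_zero_char_two this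
    · obtain ⟨c, hc⟩ := aux y s hy hs2 hs1 s3 hs0
      exact absurd (by rw [hc]; simp [s3]) h3

end QuadricK

/-! ### The seven-dimensional model of `O` -/

/-- The conditions on `ω` and `γ`, with the trace in place of the Frobenius map. -/
structure IsAdmissible (F : Type u) [Field F] {K : Type w} [Field K] [Algebra F K] (ω γ : K) :
    Prop where
  finrank_eq : finrank F K = 2
  trace_eq : Algebra.trace F K ω = 1
  exists_norm : ∃ N : F, algebraMap F K N = ω ^ 2 + ω
  trace_sq : ∀ x : K, Algebra.trace F K (x ^ 2) = Algebra.trace F K x ^ 2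
  ne_zero : ∀ x : K, x ^ 2 + x + γ ≠ 0

section Second

variable {F : Type u} [Field F] [CharP F 2] {K : Type w} [Field K] [CharP K 2] [Algebra F K]
  {ω γ : K}

/-- The alternating form in the coordinates `U, V, A, Z`. -/
noncomputable def formB (ω : K) (c d : K × K × F × F) : F :=
  Algebra.trace F K ((c.1 * d.2.1 + d.1 * c.2.1) / ω) + (c.2.2.1 * d.2.2.2 + d.2.2.1 * c.2.2.2)

/-- A lift of a vector to the quadric. -/
def liftVec (c : K × K × F × F) (w : K) : Fin 4 → K :=
  ![c.1, c.2.1, w, algebraMap F K c.2.2.2]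

/-- The vectors spanning points of `O`, in the coordinates `U, V, A, Z`. -/
def zerosSecond (ω γ : K) : Set (K × K × F × F) :=
  {c | ∃ w : K, Algebra.trace F K (w / ω) = c.2.2.1 ∧ phi γ (liftVec c w) = 0}

/-- The lifts used on totally isotropic subspaces. -/
def IsLift (ω γ : K) (c : K × K × F × F) (w : K) : Prop :=
  Algebra.trace F K (w / ω) = c.2.2.1 ∧ Algebra.trace F K (phi γ (liftVec c w) / ω) = 0

namespace IsAdmissible

variable (h : IsAdmissible F ω γ)
include h

lemma trace_algebraMap_mul (a : F) (x : K) :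
    Algebra.trace F K (algebraMap F K a * x) = a * Algebra.trace F K x := by
  rw [← Algebra.smul_def, map_smul, smul_eq_mul]

lemma trace_algebraMap (a : F) : Algebra.trace F K (algebraMap F K a) = 0 := by
  rw [Algebra.trace_algebraMap, h.finrank_eq, two_smul]
  exact add_self_char_two a

lemma omega_ne_zero : ω ≠ 0 := by
  rintro rfl
  simpa using h.trace_eq

lemma omega_notMem : ω ∉ (algebraMap F K).range := by
  rintro ⟨a, ha⟩
  have := h.trace_eq
  rw [← ha, h.trace_algebraMap] at this
  exact zero_ne_one this

lemma exists_algebraMap_of_trace {x : K} (hx : Algebra.trace F K x = 0) :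
    ∃ a : F, x = algebraMap F K a := by
  have hli : LinearIndependent F ![(1 : K), ω] := by
    rw [LinearIndependent.pair_iff' one_ne_zero]
    intro a ha
    exact h.omega_notMem ⟨a, by rw [← ha, Algebra.smul_def, mul_one]⟩
  have := eq_span_pair (U := (⊤ : Submodule F K)) (by rw [finrank_top, h.finrank_eq])
    Submodule.mem_top Submodule.mem_top hli
  obtain ⟨a, b, rfl⟩ := mem_pair_iff.1 (this ▸ (Submodule.mem_top : x ∈ ⊤))
  rw [map_add, map_smul, map_smul, h.trace_eq, ← map_one (algebraMap F K), h.trace_algebraMap] at hx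
  simp only [smul_eq_mul, mul_zero, mul_one, zero_add] at hx
  exact ⟨a, by rw [hx, Algebra.smul_def]; simp⟩

/-- The w with a given value of Tr(w/ω) form a coset of ωF. Replacing w by w + ωt adds t² to the
trace of phi/ω, and squaring is bijective. Geometrically, each line through the nucleus of Q(6,q)
carries one point of the quadric. -/
lemma existsUnique_lift [Finite F] (c : K × K × F × F) : ∃! w, IsLift ω γ c w := by
  have htwo : (2 : K) = 0 := CharTwo.two_eq_zero
  have hω := h.omega_ne_zero
  obtain ⟨N, hN⟩ := h.exists_norm
  have hshift : ∀ (w : K) (t : F), Algebra.trace F K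
      (phi γ (liftVec c (w + ω * algebraMap F K t)) / ω) =
      Algebra.trace F K (phi γ (liftVec c w) / ω) + t ^ 2 * 1 := by
    intro w t
    have : phi γ (liftVec c (w + ω * algebraMap F K t)) / ω = phi γ (liftVec c w) / ω +
        algebraMap F K (t ^ 2) * ω + algebraMap F K (t * c.2.2.2) := by
      simp only [phi, liftVec, map_mul, map_pow]
      simp
      field_simp
      linear_combination w * algebraMap F K t * ω * htwo
    rw [this, map_add, map_add, h.trace_algebraMap, h.trace_algebraMap_mul, h.trace_eq]
    ring
  -- Hence A·N is an element of F whose quotient by ω has trace A; it serves as a base point of the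
  -- fibre.
  have hinv : N * Algebra.trace F K (1 / ω) = 1 := by
    rw [← h.trace_algebraMap_mul, hN, show (ω ^ 2 + ω) * (1 / ω) = ω + algebraMap F K 1 by
      rw [map_one]; field_simp, map_add, h.trace_algebraMap, h.trace_eq, add_zero]
  set w₀ : K := algebraMap F K (c.2.2.1 * N) with hw₀
  have hA : Algebra.trace F K (w₀ / ω) = c.2.2.1 := by
    rw [hw₀, div_eq_mul_one_div, h.trace_algebraMap_mul, mul_assoc, hinv, mul_one]
  obtain ⟨t, ht, -⟩ := existsUnique_add_sq_mul 
    (Algebra.trace F K (phi γ (liftVec c w₀) / ω)) (one_ne_zero (α := F))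
  refine ⟨w₀ + ω * algebraMap F K t, ⟨?_, ?_⟩, ?_⟩
  · rw [add_div, map_add, hA, mul_div_cancel_left₀ _ hω, h.trace_algebraMap, add_zero]
  · rw [hshift, ht]
  · rintro w ⟨hw1, hw2⟩
    obtain ⟨s, hs⟩ := h.exists_algebraMap_of_trace (x := (w - w₀) / ω) (by
      rw [sub_div, map_sub, hw1, hA, sub_self])
    have hws : w = w₀ + ω * algebraMap F K s := by
      rw [← hs]; field_simp; ring
    rw [hws, hshift] at hw2
    have := (existsUnique_add_sq_mul _ one_ne_zero).unique hw2 ht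
    rw [hws, this]

/-- The lift of `c`. -/
noncomputable def lift [Finite F] (c : K × K × F × F) : Fin 4 → K :=
  liftVec c (h.existsUnique_lift c).choose

variable [Finite F]

lemma lift_eq {c : K × K × F × F} {w : K} (hw : IsLift ω γ c w) : h.lift c = liftVec c w := by
  rw [lift, ((h.existsUnique_lift c).choose_spec.2 w hw).symm]

lemma exists_lift (c : K × K × F × F) : ∃ w, IsLift ω γ c w ∧ h.lift c = liftVec c w :=
  ⟨_, (h.existsUnique_lift c).choose_spec.1, rfl⟩

/-- A zero of phi certainly satisfies the weaker trace condition, so by uniqueness it is the lift.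
-/
lemma mem_zerosSecond_iff {c : K × K × F × F} :
    c ∈ zerosSecond ω γ ↔ phi γ (h.lift c) = 0 := by
  constructor
  · rintro ⟨w, h1, h2⟩
    rwa [h.lift_eq ⟨h1, by rw [h2, zero_div, map_zero]⟩]
  · intro h0
    obtain ⟨w, ⟨h1, -⟩, h2⟩ := h.exists_lift c
    exact ⟨w, h1, by rwa [← h2]⟩

lemma trace_polarPhi_liftVec {c d : K × K × F × F} {w w' : K}
    (hw : Algebra.trace F K (w / ω) = c.2.2.1) (hw' : Algebra.trace F K (w' / ω) = d.2.2.1) :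
    Algebra.trace F K (polarPhi (liftVec c w) (liftVec d w') / ω) = formB ω c d := by
  have : polarPhi (liftVec c w) (liftVec d w') / ω = (c.1 * d.2.1 + d.1 * c.2.1) / ω +
      algebraMap F K d.2.2.2 * (w / ω) + algebraMap F K c.2.2.2 * (w' / ω) := by
    simp [polarPhi, liftVec]; ring
  rw [this, map_add, map_add, h.trace_algebraMap_mul, h.trace_algebraMap_mul, hw, hw', formB]
  ring

lemma trace_polarPhi (c d : K × K × F × F) :
    Algebra.trace F K (polarPhi (h.lift c) (h.lift d) / ω) = formB ω c d := by
  obtain ⟨w, ⟨h1, -⟩, h2⟩ := h.exists_lift c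
  obtain ⟨w', ⟨h1', -⟩, h2'⟩ := h.exists_lift d
  rw [h2, h2', h.trace_polarPhi_liftVec h1 h1']

/-- Elements of trace zero lie in F, so on lifts phi takes values in ωF. Up to the factor ω it is
therefore a form with values in F. -/
lemma exists_phi_eq (c : K × K × F × F) : ∃ a : F, phi γ (h.lift c) = algebraMap F K a * ω := by
  obtain ⟨w, ⟨-, h1⟩, h2⟩ := h.exists_lift c
  obtain ⟨a, ha⟩ := h.exists_algebraMap_of_trace h1
  exact ⟨a, by rw [h2, ← ha, div_mul_cancel₀ _ h.omega_ne_zero]⟩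

lemma exists_polarPhi_eq {c d : K × K × F × F} (hcd : formB ω c d = 0) :
    ∃ a : F, polarPhi (h.lift c) (h.lift d) = algebraMap F K a * ω := by
  rw [← h.trace_polarPhi] at hcd
  obtain ⟨a, ha⟩ := h.exists_algebraMap_of_trace hcd
  exact ⟨a, by rw [← ha, div_mul_cancel₀ _ h.omega_ne_zero]⟩

/-- The sum of two lifts violates the trace condition exactly by the trace of the polar form, which
is `formB`. So the lift is additive on orthogonal pairs. -/
lemma lift_add {c d : K × K × F × F} (hcd : formB ω c d = 0) :
    h.lift (c + d) = h.lift c + h.lift d := by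
  obtain ⟨w, ⟨h1, k1⟩, h2⟩ := h.exists_lift c
  obtain ⟨w', ⟨h1', k1'⟩, h2'⟩ := h.exists_lift d
  have hv : liftVec (c + d) (w + w') = liftVec c w + liftVec d w' := by
    ext i; fin_cases i <;> simp [liftVec]
  rw [h2, h2', ← hv]
  apply h.lift_eq
  refine ⟨by rw [add_div, map_add, h1, h1']; rfl, ?_⟩
  rw [hv, phi_add, add_div, add_div, map_add, map_add, k1, k1', h.trace_polarPhi_liftVec h1 h1', hcd]
  simp

lemma lift_smul (a : F) (c : K × K × F × F) :
    h.lift (a • c) = algebraMap F K a • h.lift c := by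
  obtain ⟨w, ⟨h1, k1⟩, h2⟩ := h.exists_lift c
  have hv : liftVec (a • c) (algebraMap F K a * w) = algebraMap F K a • liftVec c w := by
    ext i; fin_cases i <;> simp [liftVec, Algebra.smul_def]
  rw [h2, ← hv]
  apply h.lift_eq
  refine ⟨by rw [mul_div_assoc, h.trace_algebraMap_mul, h1]; rfl, ?_⟩
  rw [hv, phi_smul, mul_div_assoc, ← map_pow, h.trace_algebraMap_mul, k1, mul_zero]

lemma lift_injective : Function.Injective h.lift := by
  intro c d hcd
  obtain ⟨w, ⟨h1, k1⟩, h2⟩ := h.exists_lift c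
  obtain ⟨w', ⟨h1', k1'⟩, h2'⟩ := h.exists_lift d
  rw [h2, h2'] at hcd
  have e0 := congrFun hcd 0
  have e1 := congrFun hcd 1
  have e2 := congrFun hcd 2
  have e3 := congrFun hcd 3
  simp [liftVec] at e0 e1 e2 e3
  obtain ⟨u, v, a, z⟩ := c
  obtain ⟨u', v', a', z'⟩ := d
  rw [e2, h1'] at h1
  simp_all

lemma lift_zero : h.lift 0 = 0 := by
  have := h.lift_smul 0 0
  simpa using this

/-- Scaling turns the equation into y² + y = e with e in F, which is solvable in the quadratic
extension: over F the image of y² + y has index 2, and the missing coset is reached by adding ω,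
because N = ω² + ω. -/
lemma exists_zero_pair (a b c : F) (hb : b ≠ 0) : ∃ x y : K, (x, y) ≠ 0 ∧
    algebraMap F K a * x ^ 2 + algebraMap F K b * (x * y) + algebraMap F K c * y ^ 2 = 0 := by
  have htwo : (2 : K) = 0 := CharTwo.two_eq_zero
  by_cases ha : a = 0
  · exact ⟨1, 0, by simp, by simp [ha]⟩
  obtain ⟨N, hN⟩ := h.exists_norm
  let f : F →+ F :=
    { toFun := fun x => x ^ 2 + x
      map_zero' := by simp
      map_add' := fun x y => by linear_combination x * y * CharTwo.two_eq_zero (R := F) }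
  have hf : ∀ x, f x = x ^ 2 + x := fun _ => rfl
  have hker : ∀ x, f x = 0 → x = 0 ∨ x = 1 := fun x hx => by
    have : x * (x + 1) = 0 := by rw [← hx, hf]; ring
    exact (mul_eq_zero.1 this).imp_right eq_of_add_eq_zero_char_two
  -- The only roots of y² + y = N are ω and ω + 1, and neither lies in F.
  have hNr : N ∉ f.range := by
    rintro ⟨x, hx⟩
    have : (algebraMap F K x + ω) * (algebraMap F K x + ω + 1) = 0 := by
      have h2 := congrArg (algebraMap F K) hx
      rw [hN, hf, map_add, map_pow] at h2
      linear_combination h2 + (algebraMap F K x * ω + ω ^ 2 + ω) * htwo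
    rcases mul_eq_zero.1 this with h0 | h0
    · exact h.omega_notMem ⟨x, eq_of_add_eq_zero_char_two h0⟩
    · refine h.omega_notMem ⟨x + 1, eq_of_add_eq_zero_char_two ?_⟩
      rw [map_add, map_one, ← h0]; ring
  suffices hy : ∃ y : K, y ^ 2 + y = algebraMap F K (c * a / b ^ 2) by
    obtain ⟨y, hy⟩ := hy
    refine ⟨algebraMap F K (b / a) * y, 1, by simp, ?_⟩
    have ha' : algebraMap F K a ≠ 0 := by simpa using ha
    have hb' : algebraMap F K b ≠ 0 := by simpa using hb
    rw [map_div₀, map_mul, map_pow] at hy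
    rw [map_div₀]
    field_simp at hy ⊢
    linear_combination hy + algebraMap F K c * algebraMap F K a * htwo
  set e := c * a / b ^ 2
  by_cases he : e ∈ f.range
  · obtain ⟨x, hx⟩ := he
    exact ⟨algebraMap F K x, by rw [← hx, hf, map_add, map_pow]⟩
  · obtain ⟨x, hx⟩ := (add_mem_range_iff f (by rw [hf]; simpa using add_self_char_two (1 : F)) hker e N).2 
      (by simp [he, hNr])
    refine ⟨algebraMap F K x + ω, ?_⟩
    have h2 := congrArg (algebraMap F K) hx
    rw [map_add, hN, hf, map_add, map_pow] at h2
    linear_combination h2 + (algebraMap F K x * ω + ω ^ 2 + ω) * htwo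

end IsAdmissible

end Second

/-! ### Totally isotropic planes in the model of `O` -/

section Second

variable {F : Type u} [Field F] [CharP F 2] {K : Type w} [Field K] [CharP K 2] [Algebra F K]
  {ω γ : K}

namespace IsAdmissible

variable (h : IsAdmissible F ω γ) [Finite F]
include h

/-- Restriction of the lift to a totally isotropic subspace. -/
noncomputable def liftLinear (U : Submodule F (K × K × F × F))
    (hU : ∀ x ∈ U, ∀ y ∈ U, formB ω x y = 0) : U →ₗ[F] (Fin 4 → K) where
  toFun x := h.lift x
  map_add' x y := h.lift_add (hU x x.2 y y.2)
  map_smul' a x := by simp [h.lift_smul]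

/-- The coefficient c determines the lift, and the lift determines the vector. -/
lemma natCard_le (U : Submodule F (K × K × F × F)) (s : Fin 4 → K) 
    (hs : ∀ x ∈ U, ∃ c : K, h.lift x = c • s) : Nat.card U ≤ Nat.card K := by
  have : FiniteDimensional F K := FiniteDimensional.of_finrank_pos (by rw [h.finrank_eq]; omega)
  have : Finite K := Module.finite_of_finite F
  choose c hc using hs
  apply Nat.card_le_card_of_injective (fun x : U => c x x.2)
  intro x y hxy
  apply Subtype.ext
  apply h.lift_injective
  rw [hc x x.2, hc y y.2]
  simp only at hxy
  rw [hxy]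

lemma natCard_eq : Nat.card K = Nat.card F ^ 2 := by
  have : FiniteDimensional F K := FiniteDimensional.of_finrank_pos (by rw [h.finrank_eq]; omega)
  rw [Module.natCard_eq_pow_finrank (K := F), h.finrank_eq]

/-- An alternating form on a 3-space has a radical vector r. Suppose all radical vectors were
singular. If the polar form vanishes on U, all lifts are K-multiples of one vector, too few for q³
elements. Otherwise a nondegenerate binary part acquires a zero over K; this is a singular vector
orthogonal to r, hence a K-multiple of r, hence radical, which contradicts nondegeneracy. -/
lemma exists_nonsingular_radical {U : Submodule F (K × K × F × F)} (h3 : finrank F U = 3)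
    (hU : ∀ x ∈ U, ∀ y ∈ U, formB ω x y = 0) : ∃ r ∈ U, phi γ (h.lift r) ≠ 0 ∧
      ∀ x ∈ U, polarPhi (h.lift x) (h.lift r) = 0 := by
  have : FiniteDimensional F K := FiniteDimensional.of_finrank_pos (by rw [h.finrank_eq]; omega)
  have : Finite K := Module.finite_of_finite F
  by_contra! hcon
  replace hcon : ∀ r ∈ U, (∀ x ∈ U, polarPhi (h.lift x) (h.lift r) = 0) → 
      phi γ (h.lift r) = 0 := fun r hr hx => by
    by_contra hne
    obtain ⟨x, hxU, hx'⟩ := hcon r hr hne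
    exact hx' (hx x hxU)
  -- On U the polar form has values aω with a in F, and a is recovered as the trace because Tr ω =
  -- 1. So the F-valued form `B` below has the radical of the K-valued one.
  have htr : ∀ x ∈ U, ∀ y ∈ U, Algebra.trace F K (polarPhi (h.lift x) (h.lift y)) = 0 →
      polarPhi (h.lift x) (h.lift y) = 0 := by
    intro x hx y hy h0
    obtain ⟨a, ha⟩ := h.exists_polarPhi_eq (hU x hx y hy)
    rw [ha, h.trace_algebraMap_mul, h.trace_eq, mul_one] at h0
    rw [ha, h0, map_zero, zero_mul]
  let Λ := h.liftLinear U hU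
  have hΛ : ∀ x, Λ x = h.lift x := fun _ => rfl
  let B : LinearMap.BilinForm F U := LinearMap.mk₂ F
    (fun x y => Algebra.trace F K (polarPhi (Λ x) (Λ y)))
    (fun x y z => by rw [map_add, polarPhi_add_left, map_add])
    (fun c x y => by 
      rw [map_smul, ← algebraMap_smul K, polarPhi_smul_left, h.trace_algebraMap_mul, smul_eq_mul])
    (fun x y z => by 
      rw [map_add, polarPhi_comm, polarPhi_add_left, map_add, polarPhi_comm, polarPhi_comm (Λ z)])
    (fun c x y => by 
      rw [map_smul, ← algebraMap_smul K, polarPhi_comm, polarPhi_smul_left, 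
        h.trace_algebraMap_mul, smul_eq_mul, polarPhi_comm])
  have hBe : ∀ x y, B x y = Algebra.trace F K (polarPhi (Λ x) (Λ y)) := fun _ _ => rfl
  have hB : B.IsAlt := fun x => by rw [hBe, polarPhi_self, map_zero]
  obtain ⟨r, hr0, hr⟩ := exists_mem_radical h3 hB
  have hrad : ∀ x ∈ U, polarPhi (h.lift x) (h.lift r) = 0 := fun x hx =>
    htr x hx r r.2 (hr ⟨x, hx⟩)
  have hrφ := hcon r r.2 hrad
  have hr0' : h.lift r ≠ 0 := by
    rw [← h.lift_zero]
    exact fun he => hr0 (Subtype.ext (h.lift_injective he))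
  by_cases hz : ∀ x ∈ U, ∀ y ∈ U, polarPhi (h.lift x) (h.lift y) = 0
  · have := h.natCard_le U (h.lift r) fun x hx =>
      exists_smul_eq_of_singular h.ne_zero (hcon x hx fun y hy => hz y hy x hx) hrφ (hrad x hx) hr0'
    rw [h.natCard_eq, Module.natCard_eq_pow_finrank (K := F), h3] at this
    exact absurd (Nat.pow_lt_pow_right (Finite.one_lt_card (α := F)) (by norm_num : 2 < 3))
      (by omega)
  · push Not at hz
    obtain ⟨x, hx, y, hy, hxy⟩ := hz
    obtain ⟨a, ha⟩ := h.exists_phi_eq x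
    obtain ⟨b, hb⟩ := h.exists_polarPhi_eq (hU x hx y hy)
    obtain ⟨c, hc⟩ := h.exists_phi_eq y
    -- The combination s x + t y of lifts has coefficients in K, so it need not be the lift of a
    -- vector of U; only its singularity matters.
    obtain ⟨s, t, hst, hz⟩ := h.exists_zero_pair a b c (by rintro rfl; exact hxy (by rw [hb]; simp))
    have k1 : phi γ (s • h.lift x + t • h.lift y) = 0 := by
      rw [phi_add, phi_smul, phi_smul, polarPhi_smul_left, polarPhi_comm, polarPhi_smul_left,
        polarPhi_comm, ha, hb, hc]
      linear_combination ω * hz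
    have k2 : polarPhi (s • h.lift x + t • h.lift y) (h.lift r) = 0 := by
      rw [polarPhi_add_left, polarPhi_smul_left, polarPhi_smul_left, hrad x hx, hrad y hy]; ring
    obtain ⟨e, he⟩ := exists_smul_eq_of_singular h.ne_zero k1 hrφ k2 hr0'
    have k3 : ∀ z ∈ U, polarPhi (s • h.lift x + t • h.lift y) (h.lift z) = 0 := by
      intro z hz
      rw [he, polarPhi_smul_left, polarPhi_comm, hrad z hz, mul_zero]
    have k4 := k3 x hx
    have k5 := k3 y hy
    rw [polarPhi_add_left, polarPhi_smul_left, polarPhi_smul_left, polarPhi_self] at k4 k5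
    rw [polarPhi_comm (h.lift y)] at k4
    apply hst
    simp [hxy] at k4 k5
    simp [k4, k5]

/-- Along a nonsingular radical vector r the value of phi/ω changes by c² times its value at r, so
there is one zero on each coset of Fr. -/
theorem ncard_zeros_inter {U : Submodule F (K × K × F × F)} (h3 : finrank F U = 3)
    (hU : ∀ x ∈ U, ∀ y ∈ U, formB ω x y = 0) : 
    (zerosSecond ω γ ∩ (U : Set (K × K × F × F))).ncard = Nat.card F ^ 2 := by
  have : FiniteDimensional F K := FiniteDimensional.of_finrank_pos (by rw [h.finrank_eq]; omega)
  have : Finite K := Module.finite_of_finite F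
  obtain ⟨r, hr, hr0, hrad⟩ := h.exists_nonsingular_radical h3 hU
  obtain ⟨b, hb⟩ := h.exists_phi_eq r
  have hω := h.omega_ne_zero
  have hb0 : b ≠ 0 := by rintro rfl; exact hr0 (by rw [hb]; simp)
  have h1 := ncard_mul_of_existsUnique (Z := zerosSecond ω γ ∩ (U : Set (K × K × F × F)))
    Set.inter_subset_right hr fun x hx => by
      obtain ⟨a, ha⟩ := h.exists_phi_eq x
      have hiff : ∀ c : F, x + c • r ∈ zerosSecond ω γ ∩ (U : Set (K × K × F × F)) ↔
          a + c ^ 2 * b = 0 := by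
        intro c
        have hcr : c • r ∈ U := U.smul_mem c hr
        have h2 : x + c • r ∈ U := U.add_mem hx hcr
        simp only [Set.mem_inter_iff, SetLike.mem_coe, h2, and_true]
        rw [h.mem_zerosSecond_iff, h.lift_add (hU x hx _ hcr), h.lift_smul, phi_add, phi_smul,
          polarPhi_comm, polarPhi_smul_left, polarPhi_comm, hrad x hx, ha, hb, mul_zero, add_zero,
          ← mul_assoc, ← add_mul, mul_eq_zero, or_iff_left hω, ← map_pow, ← map_mul, ← map_add,
          map_eq_zero_iff _ (algebraMap F K).injective]
      simp only [hiff]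
      exact existsUnique_add_sq_mul _ hb0
  rw [natCard_submodule, h3, pow_succ] at h1
  exact (Nat.eq_of_mul_eq_mul_right Nat.card_pos h1).symm

/-! ### The lines contained in `O` -/

/-- The parametrization of the line with coordinates `(u, v)` in `PG(1, q ^ 2)`, `s ^ 2 = u v`. -/
noncomputable def lineMap (ω u v s : K) : K →ₗ[F] K × K × F × F :=
  (LinearMap.mulRight F u).prod ((LinearMap.mulRight F v).prod
    ((Algebra.trace F K ∘ₗ LinearMap.mulRight F (s / ω)).prod 0))

end IsAdmissible

omit [CharP F 2] [CharP K 2] in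
lemma lineMap_apply (u v s k : K) : IsAdmissible.lineMap (F := F) ω u v s k = 
    (k * u, k * v, Algebra.trace F K (k * (s / ω)), 0) := rfl

/-- The subspaces that are the lines of `W(5, q)` contained in `O`. -/
def lineSpacesSecond (F : Type u) [Field F] {K : Type w} [Field K] [Algebra F K] (ω γ : K) :
    Set (Submodule F (K × K × F × F)) :=
  {U | finrank F U = 2 ∧ (∀ x ∈ U, ∀ y ∈ U, formB ω x y = 0) ∧
    (U : Set (K × K × F × F)) ⊆ zerosSecond ω γ}

namespace IsAdmissible

variable (h : IsAdmissible F ω γ) [Finite F]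
include h

lemma range_lineMap_mem {u v s : K} (hs : s ^ 2 = u * v) (huv : u ≠ 0 ∨ v ≠ 0) :
    LinearMap.range (lineMap (F := F) ω u v s) ∈ lineSpacesSecond F ω γ := by
  refine ⟨?_, ?_, ?_⟩
  · rw [LinearMap.finrank_range_of_inj, h.finrank_eq]
    intro k k' hk
    rw [lineMap_apply, lineMap_apply] at hk
    simp only [Prod.mk.injEq] at hk
    rcases huv with hu | hu
    · exact mul_right_cancel₀ hu hk.1
    · exact mul_right_cancel₀ hu hk.2.1
  · rintro _ ⟨k, rfl⟩ _ ⟨k', rfl⟩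
    rw [lineMap_apply, lineMap_apply, formB]
    have : k * u * (k' * v) + k' * u * (k * v) = 0 := by
      linear_combination k * u * k' * v * CharTwo.two_eq_zero (R := K)
    simp [this]
  · rintro _ ⟨k, rfl⟩
    refine ⟨k * s, by rw [lineMap_apply, mul_div_assoc], ?_⟩
    rw [lineMap_apply]
    simp [phi, liftVec]
    linear_combination k ^ 2 * hs + k ^ 2 * u * v * CharTwo.two_eq_zero (R := K)

/-- The lifts of the vectors of U are singular and pairwise orthogonal, so they are K-multiples of
one lift. By cardinality every multiple occurs, so U is a full K-point of the quadric, and that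
point lies on the conic Z = 0. -/
lemma exists_range_lineMap_eq {U : Submodule F (K × K × F × F)} (hU : U ∈ lineSpacesSecond F ω γ) :
    ∃ u v s : K, s ^ 2 = u * v ∧ (u = 1 ∨ u = 0 ∧ v = 1) ∧
      LinearMap.range (lineMap (F := F) ω u v s) = U := by
  have htwo : (2 : K) = 0 := CharTwo.two_eq_zero
  have : FiniteDimensional F K := FiniteDimensional.of_finrank_pos (by rw [h.finrank_eq]; omega)
  have : Finite K := Module.finite_of_finite F
  obtain ⟨h2, hiso, hzero⟩ := hU
  have hφ : ∀ x ∈ U, phi γ (h.lift x) = 0 := fun x hx => h.mem_zerosSecond_iff.1 (hzero hx)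
  have hpol : ∀ x ∈ U, ∀ y ∈ U, polarPhi (h.lift x) (h.lift y) = 0 := by
    intro x hx y hy
    have := hφ _ (U.add_mem hx hy)
    rwa [h.lift_add (hiso x hx y hy), phi_add, hφ x hx, hφ y hy, zero_add, zero_add] at this
  obtain ⟨r, hr, hr0, -⟩ := exists_mem_of_functional h2 (0 : (K × K × F × F) →ₗ[F] F)
  have hr0' : h.lift r ≠ 0 := by
    rw [← h.lift_zero]
    exact fun he => hr0 (h.lift_injective he)
  have hmul : ∀ x ∈ U, ∃ c : K, h.lift x = c • h.lift r := fun x hx =>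
    exists_smul_eq_of_singular h.ne_zero (hφ x hx) (hφ r hr) (hpol x hx r hr) hr0'
  choose c hc using hmul
  -- An injective map between two sets of q² elements.
  have hbij : Function.Bijective (fun x : U => c x x.2) := by
    have hfin : Finite U := Module.finite_of_finite F
    rw [Nat.bijective_iff_injective_and_card]
    refine ⟨?_, ?_⟩
    · intro x y hxy
      apply Subtype.ext
      apply h.lift_injective
      rw [hc x x.2, hc y y.2]
      simp only at hxy
      rw [hxy]
    · rw [h.natCard_eq, Module.natCard_eq_pow_finrank (K := F), h2]
  have hsurj : ∀ k : K, ∃ x ∈ U, h.lift x = k • h.lift r := by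
    intro k
    obtain ⟨x, hx⟩ := hbij.2 k
    exact ⟨x, x.2, by rw [hc x x.2]; simp only at hx; rw [hx]⟩
  have hlift3 : ∀ x, h.lift x 3 = algebraMap F K x.2.2.2 := fun x => by
    obtain ⟨w, -, hw⟩ := h.exists_lift x
    rw [hw]; rfl
  -- The last coordinate of a lift is in F, but every K-multiple of the lift of r is a lift; scaling
  -- a nonzero coordinate to ω is impossible.
  have hr3 : h.lift r 3 = 0 := by
    by_contra hne
    obtain ⟨x, -, hx⟩ := hsurj (ω * (h.lift r 3)⁻¹)
    have := congrFun hx 3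
    rw [hlift3, Pi.smul_apply, smul_eq_mul, inv_mul_cancel_right₀ hne] at this
    exact h.omega_notMem ⟨_, this⟩
  have hrφ : (h.lift r 2) ^ 2 = h.lift r 0 * h.lift r 1 := by
    have := hφ r hr
    simp only [phi, hr3] at this
    linear_combination this - h.lift r 0 * h.lift r 1 * htwo
  have hle : U ≤ LinearMap.range (lineMap (F := F) ω (h.lift r 0) (h.lift r 1) (h.lift r 2)) := by
    intro x hx
    refine ⟨c x hx, ?_⟩
    have hx' := hc x hx
    obtain ⟨w, ⟨hw1, -⟩, hw⟩ := h.exists_lift x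
    rw [lineMap_apply]
    rw [hw] at hx'
    have e0 := congrFun hx' 0
    have e1 := congrFun hx' 1
    have e2 := congrFun hx' 2
    have e3 := congrFun hx' 3
    simp [liftVec, hr3] at e0 e1 e2 e3
    obtain ⟨u, v, a, z⟩ := x
    simp only at e0 e1 e3 hw1
    rw [e2] at hw1
    simp only [Prod.mk.injEq]
    exact ⟨e0.symm, e1.symm, by rw [← mul_div_assoc, hw1], e3.symm⟩
  have hne : h.lift r 0 ≠ 0 ∨ h.lift r 1 ≠ 0 := by
    by_contra! hcon
    rw [hcon.1, hcon.2] at hrφ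
    apply hr0'
    ext i; fin_cases i
    · exact hcon.1
    · exact hcon.2
    · simpa using hrφ
    · exact hr3
  have heq := Submodule.eq_of_le_of_finrank_eq hle 
    (h2.trans (h.range_lineMap_mem (F := F) hrφ hne).1.symm)
  -- A K-multiple of (u, v, s) gives the same subspace, which allows u = 1 or (u, v) = (0, 1).
  have hscale : ∀ k u v s : K, k ≠ 0 → LinearMap.range (lineMap (F := F) ω (k * u) (k * v) (k * s)) ≤
      LinearMap.range (lineMap (F := F) ω u v s) := by
    rintro k u v s hk _ ⟨x, rfl⟩
    refine ⟨x * k, ?_⟩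
    rw [lineMap_apply, lineMap_apply]
    simp only [mul_assoc, mul_div_assoc]
  have hscale' : ∀ k u v s : K, k ≠ 0 → LinearMap.range (lineMap (F := F) ω (k * u) (k * v) (k * s)) =
      LinearMap.range (lineMap (F := F) ω u v s) := by
    intro k u v s hk
    refine (hscale k u v s hk).antisymm ?_
    have := hscale k⁻¹ (k * u) (k * v) (k * s) (inv_ne_zero hk)
    simpa [inv_mul_cancel_left₀ hk] using this
  by_cases h0 : h.lift r 0 = 0
  · have h1 := hne.resolve_left (not_not_intro h0)
    have h20 : h.lift r 2 = 0 := by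
      rw [h0, zero_mul] at hrφ
      simpa using hrφ
    refine ⟨0, 1, 0, by simp, Or.inr ⟨rfl, rfl⟩, ?_⟩
    rw [heq, h0, h20, ← hscale' _ 0 1 0 h1]
    simp
  · refine ⟨1, h.lift r 1 / h.lift r 0, h.lift r 2 / h.lift r 0, ?_, Or.inl rfl, ?_⟩
    · field_simp; rw [hrφ]
    · rw [heq, ← hscale' _ _ _ _ h0, mul_one, mul_div_cancel₀ _ h0, mul_div_cancel₀ _ h0]

/-- Square roots are unique in characteristic 2, so the conic s² = uv is parametrized by (u : v) in
PG(1,q²). -/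
theorem ncard_lineSpacesSecond : (lineSpacesSecond F ω γ).ncard = Nat.card F ^ 2 + 1 := by
  have : FiniteDimensional F K := FiniteDimensional.of_finrank_pos (by rw [h.finrank_eq]; omega)
  have : Finite K := Module.finite_of_finite F
  choose s hs using fun v : K => exists_sq_eq v
  let f : Option K → Submodule F (K × K × F × F) := fun o => o.elim
    (LinearMap.range (lineMap ω 0 1 0)) fun v => LinearMap.range (lineMap ω 1 v (s v))
  have hf : Function.Injective f := by
    intro o o' ho
    match o, o' with
    | none, none => rfl
    | none, some v => 
      have : lineMap (F := F) ω 1 v (s v) 1 ∈ f none := by rw [ho]; exact ⟨1, rfl⟩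
      obtain ⟨k, hk⟩ := this
      simp [lineMap_apply] at hk
    | some v, none => 
      have : lineMap (F := F) ω 1 v (s v) 1 ∈ f none := by rw [← ho]; exact ⟨1, rfl⟩
      obtain ⟨k, hk⟩ := this
      simp [lineMap_apply] at hk
    | some v, some v' =>
      have : lineMap (F := F) ω 1 v (s v) 1 ∈ f (some v') := by rw [← ho]; exact ⟨1, rfl⟩
      obtain ⟨k, hk⟩ := this
      simp [lineMap_apply] at hk
      rw [hk.1, one_mul] at hk
      rw [hk.2.1]
  have hrange : lineSpacesSecond F ω γ = Set.range f := by
    ext U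
    constructor
    · intro hU
      obtain ⟨u, v, t, ht, huv, rfl⟩ := h.exists_range_lineMap_eq hU
      rcases huv with rfl | ⟨rfl, rfl⟩
      · refine ⟨some v, ?_⟩
        have : s v = t := sq_injective_char_two (by rw [hs, ht, one_mul])
        simp only [f, Option.elim, this]
      · refine ⟨none, ?_⟩
        have : t = 0 := by simpa using ht
        simp only [f, Option.elim, this]
    · rintro ⟨o, rfl⟩
      match o with
      | none => exact h.range_lineMap_mem (by simp) (by simp)
      | some v => exact h.range_lineMap_mem (by rw [hs, one_mul]) (by simp)
  rw [hrange, ← Nat.card_coe_set_eq, Nat.card_range_of_injective hf, Finite.card_option, h.natCard_eq]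

/-- The lines of `O` lie in the hyperplane `Z = 0`. -/
lemma last_eq_zero {U : Submodule F (K × K × F × F)} (hU : U ∈ lineSpacesSecond F ω γ)
    {x : K × K × F × F} (hx : x ∈ U) : x.2.2.2 = 0 := by
  obtain ⟨u, v, t, -, -, rfl⟩ := h.exists_range_lineMap_eq hU
  obtain ⟨k, rfl⟩ := hx
  rfl

end IsAdmissible

end Second

/-! ### Coordinates for the Baer subgeometry -/

section Baer

variable {F : Type u} [Field F] [Fintype F] [CharP F 2] {K : Type w} [Field K] [Algebra F K]
  {ω γ : K}

variable (F) in
/-- The Frobenius map of `K` over `F`. -/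
def bar : K →ₐ[F] K := FiniteField.frobeniusAlgHom F K

omit [CharP F 2] in
lemma pow_card_eq_bar (x : K) : x ^ Fintype.card F = bar F x := rfl

/-- The vector with coordinates `U, V, A, Z`. -/
noncomputable def baerFun (ω γ : K) (c : K × K × F × F) : Fin 6 → K :=
  ![c.1 / ω, bar F (c.1 / ω),
    algebraMap F K (c.2.2.1 + c.2.2.2 * Algebra.trace F K (bar F ω * γ / ω)),
    bar F ((c.2.1 + (ω + 1) * algebraMap F K c.2.2.2) / ω),
    (c.2.1 + (ω + 1) * algebraMap F K c.2.2.2) / ω, algebraMap F K c.2.2.2]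

/-- The hypotheses on `ω` and `γ`. -/
structure IsBaerDatum (F : Type u) [Field F] [Fintype F] {K : Type w} [Field K] [Algebra F K]
    (ω γ : K) : Prop where
  finrank_eq : finrank F K = 2
  omega_notMem : ω ∉ (algebraMap F K).range
  omega_add : ω + ω ^ Fintype.card F = 1
  ne_zero : ∀ x : K, x ^ 2 + x + γ ≠ 0

namespace IsBaerDatum

variable (h : IsBaerDatum F ω γ)
include h

lemma charP : CharP K 2 := charP_of_injective_algebraMap (algebraMap F K).injective 2

lemma finiteDimensional : FiniteDimensional F K :=
  FiniteDimensional.of_finrank_pos (by rw [h.finrank_eq]; omega)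

lemma finite : Finite K := have := h.finiteDimensional; Module.finite_of_finite F

lemma algebraMap_trace (x : K) :
    algebraMap F K (Algebra.trace F K x) = x + bar F x := by
  have := h.finite
  rw [FiniteField.algebraMap_trace_eq_sum_pow, h.finrank_eq, Finset.sum_range_succ,
    Finset.sum_range_one, ← pow_card_eq_bar]
  simp

lemma frob_frob (x : K) :
    bar F (bar F x) = x := by
  have := h.finite
  have := Fintype.ofFinite K
  have := h.finiteDimensional
  rw [← pow_card_eq_bar, ← pow_card_eq_bar, ← pow_mul, ← sq]
  have hc : Fintype.card K = Fintype.card F ^ 2 := by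
    rw [Module.card_eq_pow_finrank (K := F) (V := K), h.finrank_eq]
  rw [← hc, FiniteField.pow_card]

lemma frob_omega : bar F ω = ω + 1 := by
  have := h.charP
  have h1 := h.omega_add
  rw [← pow_card_eq_bar]
  linear_combination h1 - ω * CharTwo.two_eq_zero (R := K)

lemma isAdmissible : IsAdmissible F ω γ := by
  have := h.charP
  have htwo : (2 : K) = 0 := CharTwo.two_eq_zero
  have hinj := (algebraMap F K).injective
  refine ⟨h.finrank_eq, ?_, ?_, ?_, h.ne_zero⟩
  · apply hinj
    rw [h.algebraMap_trace, h.frob_omega, map_one]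
    linear_combination ω * htwo
  -- The norm ω(ω + 1) is exhibited as an element of F: ω³ + (ω + 1)³ = ω² + ω + 1.
  · have h1 : algebraMap F K (Algebra.trace F K (ω ^ 3)) = 1 + ω ^ 2 + ω := by
      rw [h.algebraMap_trace, map_pow, h.frob_omega]
      linear_combination (ω ^ 3 + ω ^ 2 + ω) * htwo
    exact ⟨Algebra.trace F K (ω ^ 3) + 1, by
      rw [map_add, h1, map_one]; linear_combination htwo⟩
  · intro x
    apply hinj
    rw [h.algebraMap_trace, map_pow, map_pow, h.algebraMap_trace]
    linear_combination - x * bar F x * htwo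

/-- The vector of the Baer subgeometry with coordinates `U, V, A, Z`. -/
noncomputable def baerVec : (K × K × F × F) →ₗ[F] baerSpace F K where
  toFun c := ⟨baerFun ω γ c, rfl, ⟨_, rfl⟩, (h.frob_frob _).symm, ⟨_, rfl⟩⟩
  map_add' c d := by
    ext i
    fin_cases i <;> simp [baerFun, add_div, mul_add, add_mul] <;> ring
  map_smul' a c := by
    ext i
    have h1 : ∀ x y : K, (algebraMap F K a * x + y * (algebraMap F K a * algebraMap F K c.2.2.2)) =
        algebraMap F K a * (x + y * algebraMap F K c.2.2.2) := fun x y => by ring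
    fin_cases i <;> simp [baerFun, Algebra.smul_def, mul_div_assoc, mul_add, h1] <;> ring

lemma coe_baerVec (c : K × K × F × F) : (h.baerVec c : Fin 6 → K) = baerFun ω γ c := rfl

lemma baerVec_bijective : Function.Bijective h.baerVec := by
  have := h.charP
  have hω := h.isAdmissible.omega_ne_zero
  constructor
  · rw [← LinearMap.ker_eq_bot, LinearMap.ker_eq_bot']
    intro c hc
    have hc' : ∀ i, baerFun ω γ c i = 0 := fun i => by rw [← h.coe_baerVec, hc]; rfl
    have e0 := hc' 0
    have e2 := hc' 2
    have e4 := hc' 4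
    have e5 := hc' 5
    obtain ⟨u, v, a, z⟩ := c
    simp [baerFun, hω] at e0 e2 e4 e5
    simp [e5] at e2 e4
    simp [e0, e2, e4, e5]
  · rintro ⟨x, h1, ⟨a, h2⟩, h4, ⟨z, h5⟩⟩
    refine ⟨(ω * x 0, ω * x 4 - (ω + 1) * algebraMap F K z,
      a - z * Algebra.trace F K (bar F ω * γ / ω), z), ?_⟩
    have h3 : bar F (x 4) = x 3 := by
      rw [h4, pow_card_eq_bar, h.frob_frob]
    apply Subtype.ext
    rw [h.coe_baerVec]
    ext i
    simp only [baerFun, sub_add_cancel, mul_div_cancel_left₀ _ hω]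
    fin_cases i
    · rfl
    · exact h1.symm
    · exact h2
    · exact h3
    · rfl
    · exact h5

/-- The coordinates `U, V, A, Z`. -/
noncomputable def baerEquiv : (K × K × F × F) ≃ₗ[F] baerSpace F K :=
  LinearEquiv.ofBijective h.baerVec h.baerVec_bijective

lemma coe_baerEquiv (c : K × K × F × F) : (h.baerEquiv c : Fin 6 → K) = baerFun ω γ c := rfl

/-- With ω^q = ω + 1 the Hermitian expression expands to a trace plus the hyperbolic pair in A and
Z. The constant added to A in `baerFun` contributes a product of the two Z-coordinates twice and
cancels. -/
lemma perpBaer_iff (c d : K × K × F × F) :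
    perpBaer F ω (h.baerEquiv c) (h.baerEquiv d) ↔ formB ω c d = 0 := by
  have := h.charP
  have hω := h.isAdmissible.omega_ne_zero
  have hω1 : ω + 1 ≠ 0 := fun h0 => h.isAdmissible.omega_notMem 
    ⟨1, by rw [map_one]; exact (eq_of_add_eq_zero_char_two h0).symm⟩
  have htwo : (2 : K) = 0 := CharTwo.two_eq_zero
  rw [← map_eq_zero_iff _ (algebraMap F K).injective, formB, map_add, h.algebraMap_trace,
    perpBaer, h.coe_baerEquiv, h.coe_baerEquiv]
  obtain ⟨u, v, a, z⟩ := c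
  obtain ⟨u', v', a', z'⟩ := d
  apply Eq.congr_left
  simp [gramJ, baerFun, Matrix.mulVec, dotProduct, Fin.sum_univ_six, pow_card_eq_bar, h.frob_frob,
    h.frob_omega]
  have hs : ω + 1 + 1 = ω := by linear_combination htwo
  rw [hs]
  generalize algebraMap F K (Algebra.trace F K ((ω + 1) * γ / ω)) = t
  linear_combination (norm := (field_simp; ring)) (u * (ω + 1) * algebraMap F K z' / ω +
    bar F u * ω * algebraMap F K z' / (ω + 1) + algebraMap F K z * algebraMap F K z' * t +
    bar F u' * ω * algebraMap F K z / (ω + 1) + u' * (ω + 1) * algebraMap F K z / ω) * htwo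

lemma isW5_perpBaer : IsW5 F (perpBaer (K := K) F ω) := by
  have := h.charP
  have hfin := h.finiteDimensional
  have hω := h.isAdmissible.omega_ne_zero
  have hω1 := h.isAdmissible.trace_eq
  refine ⟨?_, ?_⟩
  · rw [← h.baerEquiv.finrank_eq]
    simp [h.finrank_eq]
  let B₀ : LinearMap.BilinForm F (K × K × F × F) := LinearMap.mk₂ F (formB ω)
    (fun x y z => by
      simp only [formB, Prod.fst_add, Prod.snd_add]
      rw [show (x.1 + y.1) * z.2.1 + z.1 * (x.2.1 + y.2.1) = (x.1 * z.2.1 + z.1 * x.2.1) +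
        (y.1 * z.2.1 + z.1 * y.2.1) by ring, add_div, map_add]
      ring)
    (fun c x y => by
      simp only [formB, Prod.smul_fst, Prod.smul_snd]
      rw [smul_mul_assoc, mul_smul_comm, ← smul_add, smul_div_assoc, map_smul]
      simp only [smul_eq_mul]; ring)
    (fun x y z => by
      simp only [formB, Prod.fst_add, Prod.snd_add]
      rw [show x.1 * (y.2.1 + z.2.1) + (y.1 + z.1) * x.2.1 = (x.1 * y.2.1 + y.1 * x.2.1) +
        (x.1 * z.2.1 + z.1 * x.2.1) by ring, add_div, map_add]
      ring)
    (fun c x y => by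
      simp only [formB, Prod.smul_fst, Prod.smul_snd]
      rw [smul_mul_assoc, mul_smul_comm, ← smul_add, smul_div_assoc, map_smul]
      simp only [smul_eq_mul]; ring)
  have hB₀ : ∀ x y, B₀ x y = formB ω x y := fun _ _ => rfl
  let B := LinearMap.BilinForm.congr h.baerEquiv B₀
  have hB : ∀ x y, B x y = formB ω (h.baerEquiv.symm x) (h.baerEquiv.symm y) := fun _ _ => rfl
  have halt : B.IsAlt := fun x => by
    rw [hB, formB, add_self_char_two, add_self_char_two, zero_div, map_zero, add_zero]
  refine ⟨B, halt, nondegenerate_of_isAlt halt fun x hx => ?_, fun x y => ?_⟩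
  · obtain ⟨c, rfl⟩ := h.baerEquiv.surjective x
    have hc : ∀ d, formB ω c d = 0 := fun d => by
      have := hx (h.baerEquiv d)
      rwa [hB, LinearEquiv.symm_apply_apply, LinearEquiv.symm_apply_apply] at this
    obtain ⟨u, v, a, z⟩ := c
    have hz : z = 0 := by simpa [formB] using hc (0, 0, 1, 0)
    have ha : a = 0 := by simpa [formB] using hc (0, 0, 0, 1)
    have hu : u = 0 := by
      by_contra hu
      -- Chosen so that the argument of the trace is ω, of trace 1.
      have := hc (0, ω ^ 2 / u, 0, 0)
      simp only [formB] at this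
      rw [show (u * (ω ^ 2 / u) + 0 * v) / ω = ω by field_simp; ring, hω1] at this
      simp at this
    have hv : v = 0 := by
      by_contra hv
      have := hc (ω ^ 2 / v, 0, 0, 0)
      simp only [formB] at this
      rw [show (u * 0 + ω ^ 2 / v * v) / ω = ω by field_simp; ring, hω1] at this
      simp at this
    rw [hu, hv, ha, hz]
    exact map_zero _
  · rw [hB, ← h.perpBaer_iff, LinearEquiv.apply_symm_apply, LinearEquiv.apply_symm_apply]

/-! ### The group `G` -/

/-- The vector of an affine point of `O`. -/
noncomputable def affineVec (ω γ u v w : K) : Fin 6 → K :=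
  baerFun (F := F) ω γ (u, v, Algebra.trace F K (w / ω), 1)

omit h in
lemma vecS_eq (h : IsBaerDatum F ω γ) : vecS F ω γ = affineVec (F := F) ω γ γ 1 0 := by
  have := h.charP
  have htwo : (2 : K) = 0 := CharTwo.two_eq_zero
  have hω := h.isAdmissible.omega_ne_zero
  have h1 : 1 + (ω + 1) = ω := by linear_combination htwo
  have hs : ω + 1 + 1 = ω := by linear_combination htwo
  ext i
  fin_cases i
  · rfl
  · simp [vecS, affineVec, baerFun, pow_card_eq_bar]
  · simp [vecS, affineVec, baerFun, pow_card_eq_bar, h.algebraMap_trace, h.frob_omega, hs]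
  · simp [vecS, affineVec, baerFun, h1, hω]
  · simp [vecS, affineVec, baerFun, h1, hω]
  · simp [vecS, affineVec, baerFun]

/-- The generators act by affine maps on the lifted coordinates (u, v, w), although only a trace of
w/ω is visible in six coordinates. This makes the orbit of S_γ computable on the quadric uv + w² + w
+ γ = 0. -/
lemma matM_mulVec {a b c d : K} (hdet : a * d + b * c = 1) (u v w : K) :
    matM F ω a b c d *ᵥ affineVec (F := F) ω γ u v w = affineVec (F := F) ω γ
      (a ^ 2 * u + a * c + c ^ 2 * v) (b ^ 2 * u + b * d + d ^ 2 * v)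
      (w + a * b * u + c * d * v + b * c) := by
  have := h.charP
  have htwo : (2 : K) = 0 := CharTwo.two_eq_zero
  have hω := h.isAdmissible.omega_ne_zero
  have hω1 : ω + 1 ≠ 0 := fun h0 => h.isAdmissible.omega_notMem
    ⟨1, by rw [map_one]; exact (eq_of_add_eq_zero_char_two h0).symm⟩
  have hs : ω + 1 + 1 = ω := by linear_combination htwo
  have hdet' : bar F a * bar F d + bar F b * bar F c = 1 := by
    rw [← map_mul, ← map_mul, ← map_add, hdet, map_one]
  ext i
  fin_cases i <;> simp [matM, affineVec, baerFun, Matrix.mulVec, dotProduct, Fin.sum_univ_six,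
    pow_card_eq_bar, h.frob_omega, h.algebraMap_trace, pow_add, mul_comm 2, pow_mul, hs]
  · linear_combination (norm := (field_simp; ring)) (c ^ 2 * (ω + 1) / ω) * htwo
  · linear_combination (norm := (field_simp; ring)) (bar F c ^ 2 * ω / (ω + 1)) * htwo
  · linear_combination (norm := (field_simp; ring)) (c * d * (ω + 1) / ω +
      bar F c * bar F d * ω / (ω + 1) - b * c / ω - bar F b * bar F c / (ω + 1) + 1 / ω) * htwo +
      1 / ω * hdet + 1 / (ω + 1) * hdet'
  · linear_combination (norm := (field_simp; ring)) (bar F d ^ 2 * ω / (ω + 1)) * htwo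
  · linear_combination (norm := (field_simp; ring)) (d ^ 2 * (ω + 1) / ω) * htwo

/-- The vectors of the affine points of `O`. -/
def affineZeros (F : Type u) [Field F] [Fintype F] {K : Type w} [Field K] [Algebra F K] (ω γ : K) :
    Set (Fin 6 → K) :=
  {x | ∃ u v w : K, u * v + w ^ 2 + w + γ = 0 ∧ x = affineVec (F := F) ω γ u v w}

lemma mapsTo_matM {a b c d : K} (hdet : a * d + b * c = 1) {x : Fin 6 → K}
    (hx : x ∈ affineZeros F ω γ) : matM F ω a b c d *ᵥ x ∈ affineZeros F ω γ := by
  have := h.charP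
  have htwo : (2 : K) = 0 := CharTwo.two_eq_zero
  obtain ⟨u, v, w, h1, rfl⟩ := hx
  refine ⟨_, _, _, ?_, h.matM_mulVec hdet u v w⟩
  linear_combination h1 + (u * v * (a * d + b * c + 1) + a * b * u + c * d * v + b * c) * hdet +
    (a ^ 2 * b ^ 2 * u ^ 2 + c ^ 2 * d ^ 2 * v ^ 2 - u * v * a * b * c * d + a * b * u + c * d * v +
      b * c + w * (a * b * u + c * d * v + b * c) + a * b * u * (c * d * v) + a * b * u * (b * c) +
      c * d * v * (b * c)) * htwo

lemma mapsTo_groupG {g : GL (Fin 6) K} (hg : g ∈ groupG F ω) :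
    ∀ x ∈ affineZeros F ω γ, (g : Matrix (Fin 6) (Fin 6) K) *ᵥ x ∈ affineZeros F ω γ := by
  have := h.finite
  induction hg using Subgroup.closure_induction with
  | mem g hg =>
    obtain ⟨a, b, c, d, hdet, hg⟩ := hg
    intro x hx
    rw [hg]
    exact h.mapsTo_matM hdet hx
  | one => intro x hx; simpa using hx
  | mul g g' _ _ h1 h2 =>
    intro x hx
    rw [Units.val_mul, ← Matrix.mulVec_mulVec]
    exact h1 _ (h2 x hx)
  | inv g _ h1 =>
    intro x hx
    have hcan : ∀ y, (g⁻¹ : GL (Fin 6) K).1 *ᵥ (g.1 *ᵥ y) = y := fun y => by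
      rw [Matrix.mulVec_mulVec, ← Units.val_mul, inv_mul_cancel]; simp
    -- An injective self-map of a finite set is surjective, so the inverse also preserves the set.
    let f : affineZeros F ω γ → affineZeros F ω γ := fun y => ⟨g.1 *ᵥ y.1, h1 y y.2⟩
    have hf : Function.Injective f := fun y z hyz => by
      apply Subtype.ext
      rw [← hcan y, ← hcan z]
      exact congrArg _ (congrArg Subtype.val hyz)
    obtain ⟨y, hy⟩ := Finite.surjective_of_injective hf ⟨x, hx⟩
    have hy' : g.1 *ᵥ y.1 = x := congrArg Subtype.val hy
    rw [← hy', hcan]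
    exact y.2

/-- One generator suffices: with a = 0 the vector with lifted coordinates (γ, 1, 0) goes to u = c²
and w = cd + bc, which dictates c, d and b = 1/c. The quadric equation then gives v. -/
lemma exists_mem_groupG {u v w : K} (hw : u * v + w ^ 2 + w + γ = 0) :
    ∃ g ∈ groupG F ω, (g : Matrix (Fin 6) (Fin 6) K) *ᵥ vecS F ω γ =
      affineVec (F := F) ω γ u v w := by
  have := h.charP
  have := h.finite
  have htwo : (2 : K) = 0 := CharTwo.two_eq_zero
  -- For u = 0 the element w would be a root of X² + X + γ.
  have hu : u ≠ 0 := by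
    rintro rfl
    exact h.ne_zero w (by linear_combination hw)
  obtain ⟨c, rfl⟩ := exists_sq_eq u
  have hc : c ≠ 0 := by simpa using hu
  set d := (w + 1) / c with hd
  have hdet : 0 * d + c⁻¹ * c = 1 := by rw [inv_mul_cancel₀ hc]; ring
  have hdet0 : (matM F ω 0 c⁻¹ c d).det ≠ 0 := by
    intro h0
    obtain ⟨x, hx0, hx⟩ := Matrix.exists_mulVec_eq_zero_iff.2 h0
    have e : ∀ i, (matM F ω 0 c⁻¹ c d *ᵥ x) i = 0 := fun i => congrFun hx i
    have e0 := e 0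
    have e1 := e 1
    have e2 := e 2
    have e3 := e 3
    have e4 := e 4
    have e5 := e 5
    simp [matM, Matrix.mulVec, dotProduct, Fin.sum_univ_six, pow_card_eq_bar, pow_mul, mul_comm 2]
      at e0 e1 e2 e3 e4 e5
    simp [e5, hc] at e0 e1 e2 e3 e4
    simp [e0, e1, hc] at e2 e3 e4
    exact hx0 (by ext i; fin_cases i <;> simp [*])
  refine ⟨Matrix.GeneralLinearGroup.mkOfDetNeZero _ hdet0,
    Subgroup.subset_closure ⟨0, c⁻¹, c, d, hdet, rfl⟩, ?_⟩
  change matM F ω 0 c⁻¹ c d *ᵥ vecS F ω γ = _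
  rw [vecS_eq h, h.matM_mulVec hdet]
  congr 1
  · ring
  · rw [hd]; field_simp
    linear_combination - hw + (w ^ 2 + 2 * w + 1 + γ) * htwo
  · rw [hd]; field_simp
    linear_combination c * htwo

/-! ### The set `O` in coordinates -/

/-- For Z = 0 only the parabolic quadric contributes, because orbit vectors have last coordinate 1;
the lift is the square root of uv. For Z ≠ 0 scaling to Z = 1 gives the affine zeros of phi, on
which G is transitive. -/
lemma mem_cone_ovoidSecond (x : K × K × F × F) :
    h.baerEquiv x ∈ cone (ovoidSecond F ω γ) ↔ x ∈ zerosSecond ω γ := by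
  have := h.charP
  have := h.finite
  have hω := h.isAdmissible.omega_ne_zero
  have htwo : (2 : K) = 0 := CharTwo.two_eq_zero
  have hω1 : ω + 1 ≠ 0 := fun h0 => h.isAdmissible.omega_notMem
    ⟨1, by rw [map_one]; exact (eq_of_add_eq_zero_char_two h0).symm⟩
  by_cases hx0 : x = 0
  · subst hx0
    rw [map_zero]
    simp only [zero_mem_cone, true_iff]
    exact ⟨0, by simp, by simp [phi, liftVec]⟩
  have hx0' : h.baerEquiv x ≠ 0 := by simpa using hx0
  rw [mem_cone_of_ne hx0', ovoidSecond, Set.mem_union]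
  have hsub : ∀ y, y ∈ (Projectivization.mk F (h.baerEquiv x) hx0').submodule ↔ 
      ∃ c : F, y = c • h.baerEquiv x := fun y => by
    rw [submodule_mk, Submodule.mem_span_singleton]
    exact exists_congr fun c => eq_comm
  have hself : h.baerEquiv x ∈ (Projectivization.mk F (h.baerEquiv x) hx0').submodule :=
    (hsub _).2 ⟨1, (one_smul _ _).symm⟩
  obtain ⟨u, v, a, z⟩ := x
  by_cases hz : z = 0
  · subst hz
    have hnot : Projectivization.mk F (h.baerEquiv (u, v, a, 0)) hx0' ∉ orbitS F ω γ := by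
      rintro ⟨g, hg, hP⟩
      obtain ⟨c, hc⟩ := hP _ hself
      obtain ⟨u', v', w', -, hS⟩ := h.mapsTo_groupG hg (vecS F ω γ) 
        (by rw [vecS_eq h]; exact ⟨γ, 1, 0, by linear_combination γ * htwo, rfl⟩)
      rw [hS, h.coe_baerEquiv] at hc
      have h5 := congrFun hc 5
      simp [baerFun, affineVec] at h5
      rw [← h5, zero_smul] at hc
      exact hx0' (Subtype.ext hc)
    rw [or_iff_left hnot]
    have hmem : Projectivization.mk F (h.baerEquiv (u, v, a, 0)) hx0' ∈ quadricQ F (K := K) ↔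
        (algebraMap F K a) ^ 2 + u / ω * (v / ω) + bar F u / (ω + 1) * (bar F v / (ω + 1)) = 0 := by
      have he : ∀ c : F, (((c • h.baerEquiv (u, v, a, 0) : baerSpace F K)) : Fin 6 → K) = 
          c • baerFun (F := F) ω γ (u, v, a, 0) := fun c => rfl
      constructor
      · intro hP
        have := (hP _ hself).2
        rw [h.coe_baerEquiv] at this
        simpa [baerFun, h.frob_omega] using this
      · intro h0 y hy
        obtain ⟨c, rfl⟩ := (hsub y).1 hy
        rw [he]
        simp [baerFun, h.frob_omega, Algebra.smul_def]
        linear_combination algebraMap F K c ^ 2 * h0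
    rw [hmem]
    have hsq : algebraMap F K (Algebra.trace F K (u / ω * (v / ω))) =
        u / ω * (v / ω) + bar F u / (ω + 1) * (bar F v / (ω + 1)) := by
      rw [h.algebraMap_trace]; simp [h.frob_omega]
    have hiff : (algebraMap F K a) ^ 2 + u / ω * (v / ω) + bar F u / (ω + 1) * (bar F v / (ω + 1)) = 0
        ↔ Algebra.trace F K (u / ω * (v / ω)) = a ^ 2 := by
      rw [← (algebraMap F K).injective.eq_iff, hsq, map_pow]
      constructor
      · intro h0; linear_combination h0 - algebraMap F K a ^ 2 * htwo
      · intro h0; linear_combination h0 + algebraMap F K a ^ 2 * htwo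
    rw [hiff]
    constructor
    · intro h0
      -- The trace commutes with squaring, so Tr(uv/ω²) = A² says Tr(w/ω) = A for w² = uv.
      obtain ⟨w, hw⟩ := exists_sq_eq (u * v)
      refine ⟨w, ?_, ?_⟩
      · apply sq_injective_char_two
        rw [← h.isAdmissible.trace_sq, div_pow, hw]
        change _ = a ^ 2
        rw [← h0]
        congr 1; field_simp
      · simp [phi, liftVec, hw]; exact add_self_char_two _
    · rintro ⟨w, hw, hφ⟩
      simp [phi, liftVec] at hφ hw
      have e := eq_of_add_eq_zero_char_two hφ
      rw [← hw, ← h.isAdmissible.trace_sq]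
      congr 1; field_simp; exact e
  · have hz' : algebraMap F K z ≠ 0 := by simpa using hz
    have hnot : Projectivization.mk F (h.baerEquiv (u, v, a, z)) hx0' ∉ quadricQ F (K := K) := by
      intro hP
      have := (hP _ hself).1
      rw [h.coe_baerEquiv] at this
      exact hz' (by simpa [baerFun] using this)
    rw [or_iff_right hnot]
    constructor
    · rintro ⟨g, hg, hP⟩
      obtain ⟨c, hc⟩ := hP _ hself
      obtain ⟨u', v', w', hw', hS⟩ := h.mapsTo_groupG hg (vecS F ω γ)
        (by rw [vecS_eq h]; exact ⟨γ, 1, 0, by linear_combination γ * htwo, rfl⟩)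
      rw [hS, h.coe_baerEquiv] at hc
      have h5 := congrFun hc 5
      have hcz : algebraMap F K z = c := by simpa [baerFun, affineVec] using h5
      have hc' : h.baerEquiv (u, v, a, z) = z • h.baerEquiv (u', v', Algebra.trace F K (w' / ω), 1) := by
        apply Subtype.ext
        change baerFun ω γ _ = z • baerFun ω γ _
        rw [hc, ← hcz]
        ext i
        simp [affineVec, Algebra.smul_def]
      rw [← map_smul] at hc'
      rw [h.baerEquiv.injective hc']
      refine ⟨algebraMap F K z * w', ?_, ?_⟩
      · rw [mul_div_assoc, h.isAdmissible.trace_algebraMap_mul]; rfl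
      · simp [phi, liftVec, Algebra.smul_def]
        linear_combination algebraMap F K z ^ 2 * hw'
    · rintro ⟨w, hw, hφ⟩
      simp only [phi, liftVec] at hφ hw
      simp at hφ
      set ζ := algebraMap F K z with hζ
      obtain ⟨g, hg, hgS⟩ := h.exists_mem_groupG (u := u / ζ) (v := v / ζ) (w := w / ζ) (by
        field_simp; linear_combination hφ)
      refine ⟨g, hg, fun y hy => ?_⟩
      obtain ⟨c, rfl⟩ := (hsub y).1 hy
      refine ⟨algebraMap F K (c * z), ?_⟩
      have hvec : (u, v, a, z) = z • (u / ζ, v / ζ, Algebra.trace F K (w / ζ / ω), (1 : F)) := by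
        have : a = z * Algebra.trace F K (w / ζ / ω) := by
          rw [← h.isAdmissible.trace_algebraMap_mul, ← hw]
          congr 1; field_simp; rfl
        ext
        · simp [Algebra.smul_def]; field_simp; rfl
        · simp [Algebra.smul_def]; field_simp; rfl
        · simpa using this
        · simp
      rw [hgS, affineVec, hvec, map_smul, smul_smul]
      ext i
      exact Algebra.smul_def (c * z) (baerFun (F := F) ω γ _ i)

theorem isOvoidW5_ovoidSecond :
    IsOvoidW5 (perpBaer F ω) (Nat.card F + 1) (ovoidSecond F ω γ) := by
  have := h.charP
  have := h.finite
  have : Finite (baerSpace F K) := Finite.of_equiv _ h.baerEquiv.toEquiv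
  refine h.isW5_perpBaer.isOvoidW5 fun U hU hp => ncard_of_cone_sq ?_
  let U' := U.comap h.baerEquiv.toLinearMap
  have hUU : cone (ovoidSecond F ω γ ∩ pointsOf U) = 
      h.baerEquiv '' (zerosSecond ω γ ∩ (U' : Set (K × K × F × F))) := by
    ext y
    obtain ⟨x, rfl⟩ := h.baerEquiv.surjective y
    rw [cone_inter, cone_pointsOf, h.baerEquiv.injective.mem_set_image]
    exact and_congr_left fun _ => h.mem_cone_ovoidSecond x
  rw [hUU, Set.ncard_image_of_injective _ h.baerEquiv.injective]
  apply h.isAdmissible.ncard_zeros_inter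
  · rw [← hU]
    exact (h.baerEquiv.submoduleMap U').finrank_eq.trans (by
      rw [Submodule.map_comap_eq_of_surjective h.baerEquiv.surjective])
  · intro x hx y hy
    rw [← h.perpBaer_iff]
    exact hp _ hx _ hy

lemma map_mem_lineSpacesSecond_iff (U : Submodule F (K × K × F × F)) :
    (finrank F (U.map h.baerEquiv.toLinearMap) = 2 ∧ 
      TotIsotropic (perpBaer F ω) (U.map h.baerEquiv.toLinearMap) ∧ 
      pointsOf (U.map h.baerEquiv.toLinearMap) ⊆ ovoidSecond F ω γ) ↔
      U ∈ lineSpacesSecond F ω γ := by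
  refine and_congr ?_ (and_congr ?_ ?_)
  · rw [← (h.baerEquiv.submoduleMap U).finrank_eq]
  · constructor
    · intro hU x hx y hy
      rw [← h.perpBaer_iff]
      exact hU _ (Submodule.mem_map_of_mem hx) _ (Submodule.mem_map_of_mem hy)
    · rintro hU _ ⟨x, hx, rfl⟩ _ ⟨y, hy, rfl⟩
      exact (h.perpBaer_iff x y).2 (hU x hx y hy)
  · rw [pointsOf_subset_iff]
    constructor
    · intro hU x hx
      exact (h.mem_cone_ovoidSecond x).1 (hU (Submodule.mem_map_of_mem hx))
    · rintro hU _ ⟨x, hx, rfl⟩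
      exact (h.mem_cone_ovoidSecond x).2 (hU hx)

theorem ncard_linesIn_ovoidSecond :
    (linesIn (perpBaer F ω) (ovoidSecond F ω γ)).ncard = Nat.card F ^ 2 + 1 := by
  have := h.charP
  rw [ncard_linesIn, ← h.isAdmissible.ncard_lineSpacesSecond,
    ← Set.ncard_image_of_injective _ (Submodule.map_injective_of_injective h.baerEquiv.injective)]
  congr 1
  ext W
  constructor
  · intro hW
    have hm : (W.comap h.baerEquiv.toLinearMap).map h.baerEquiv.toLinearMap = W :=
      Submodule.map_comap_eq_of_surjective h.baerEquiv.surjective W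
    exact ⟨_, (h.map_mem_lineSpacesSecond_iff _).1 (by rw [hm]; exact hW), hm⟩
  · rintro ⟨U, hU, rfl⟩
    exact (h.map_mem_lineSpacesSecond_iff U).2 hU

/-- The point S_γ has Z = 1, whereas all contained lines lie in Z = 0; so it lies on no contained
line. -/
theorem not_isPartitioned_ovoidSecond :
    ¬ IsPartitioned (perpBaer F ω) (ovoidSecond F ω γ) := by
  have := h.charP
  rintro ⟨S, hS, -, hX⟩
  have h0 : ((γ, 1, 0, 1) : K × K × F × F) ≠ 0 := by simp
  have h0' : h.baerEquiv (γ, 1, 0, 1) ≠ 0 := by simp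
  have hm : h.baerEquiv (γ, 1, 0, 1) ∈ cone (ovoidSecond F ω γ) := by
    rw [h.mem_cone_ovoidSecond]
    refine ⟨0, by simp, ?_⟩
    simp [phi, liftVec]
    exact add_self_char_two γ
  rw [mem_cone_of_ne h0', hX] at hm
  obtain ⟨U, hU, hxU⟩ := Set.mem_iUnion₂.1 hm
  rw [mk_mem_pointsOf] at hxU
  obtain ⟨y, hy, -, hdim, hle⟩ := exists_finrank_two (hS U hU).2 hxU h0'
  have hW : (Submodule.span F {h.baerEquiv (γ, 1, 0, 1), y}).comap h.baerEquiv.toLinearMap ∈ 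
      lineSpacesSecond F ω γ := by
    rw [← h.map_mem_lineSpacesSecond_iff, 
      Submodule.map_comap_eq_of_surjective h.baerEquiv.surjective]
    refine ⟨hdim, fun a ha b hb => (hS U hU).1 a (hle ha) b (hle hb), ?_⟩
    rw [hX]
    exact fun P hP => Set.mem_iUnion₂.2 ⟨U, hU, le_trans hP hle⟩
  have := h.isAdmissible.last_eq_zero hW (x := (γ, 1, 0, 1)) (Submodule.subset_span (by simp))
  exact one_ne_zero this

end IsBaerDatum

end Baer

/-! ### Pencils of quadrics -/

section Pencil

variable {F : Type u} [Field F] [CharP F 2]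

lemma polar_self_char_two (Q : QuadraticForm F (Fin 6 → F)) (x : Fin 6 → F) :
    QuadraticMap.polar Q x x = 0 := by
  rw [QuadraticMap.polar_self, two_smul]
  exact add_self_char_two _

lemma map_add_smul (E : QuadraticForm F (Fin 6 → F)) (x y : Fin 6 → F) (c : F) :
    E (x + c • y) = E x + c ^ 2 * E y + c * QuadraticMap.polar E x y := by
  rw [QuadraticMap.map_add E, QuadraticMap.map_smul, QuadraticMap.polar_smul_right]
  simp only [smul_eq_mul]; ring

lemma isW5_perpOf {Q : QuadraticForm F (Fin 6 → F)}
    (hQ : ∀ x, (∀ y, QuadraticMap.polar Q x y = 0) → x = 0) : IsW5 F (perpOf Q) := by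
  have halt : LinearMap.BilinForm.IsAlt (Q.polarBilin) := fun x => polar_self_char_two Q x
  exact ⟨by simp, Q.polarBilin, halt, nondegenerate_of_isAlt halt hQ, fun x y => Iff.rfl⟩

lemma member_apply (Q : QuadraticForm F (Fin 6 → F)) (v x : Fin 6 → F) (t : F) :
    member Q v t x = Q x + t * QuadraticMap.polar Q v x ^ 2 := by
  simp [member, sq]

/-- The square of a linear form is additive in characteristic 2, so all members of the pencil define
the same polarity. -/
lemma polar_member (Q : QuadraticForm F (Fin 6 → F)) (v : Fin 6 → F) (t : F) (x y : Fin 6 → F) :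
    QuadraticMap.polar (member Q v t) x y = QuadraticMap.polar Q x y := by
  rw [QuadraticMap.polar, member_apply, member_apply, member_apply, QuadraticMap.polar_add_right]
  change _ = Q (x + y) - Q x - Q y
  linear_combination (t * QuadraticMap.polar Q v x * QuadraticMap.polar Q v y) *
    CharTwo.two_eq_zero (R := F)

lemma form_smul (E : QuadraticForm F (Fin 6 → F)) (c : F) (x : Fin 6 → F) : 
    E (c • x) = c ^ 2 * E x := by
  rw [QuadraticMap.map_smul, smul_eq_mul, sq]

lemma mk_mem_zeroLocus_form (E : QuadraticForm F (Fin 6 → F)) {x : Fin 6 → F} (hx : x ≠ 0) :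
    mk F x hx ∈ zeroLocus E ↔ E x = 0 := mk_mem_zeroLocus (form_smul E) hx

lemma mk_mem_base (Q : QuadraticForm F (Fin 6 → F)) (v : Fin 6 → F) {x : Fin 6 → F} (hx : x ≠ 0) :
    mk F x hx ∈ base Q v ↔ Q x = 0 ∧ QuadraticMap.polar Q v x = 0 := by
  rw [base, Set.mem_inter_iff, mk_mem_zeroLocus_form]
  refine and_congr_right fun _ => ?_
  constructor
  · intro h
    exact h x (by rw [submodule_mk]; exact Submodule.mem_span_singleton_self x)
  · intro h y hy
    rw [submodule_mk, Submodule.mem_span_singleton] at hy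
    obtain ⟨c, rfl⟩ := hy
    rw [QuadraticMap.polar_smul_right, h, smul_zero]

lemma mem_cone_base {Q : QuadraticForm F (Fin 6 → F)} {v x : Fin 6 → F} :
    x ∈ cone (base Q v) ↔ Q x = 0 ∧ QuadraticMap.polar Q v x = 0 := by
  by_cases hx : x = 0
  · subst hx; simp [zero_mem_cone]
  · rw [mem_cone_of_ne hx, mk_mem_base Q v hx]

/-- The singular vectors of an elliptic quadric in a plane of the polar space form a line. -/
lemma exists_singular_line [Finite F] {E : QuadraticForm F (Fin 6 → F)} (hE : IsElliptic E)
    {U : Submodule F (Fin 6 → F)} (h3 : finrank F U = 3)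
    (hU : ∀ x ∈ U, ∀ y ∈ U, QuadraticMap.polar E x y = 0) :
    ∃ L ≤ U, finrank F L = 2 ∧ ∀ x ∈ U, x ∈ L ↔ E x = 0 := by
  let L : Submodule F (Fin 6 → F) :=
    { carrier := {x | x ∈ U ∧ E x = 0}
      zero_mem' := ⟨U.zero_mem, QuadraticMap.map_zero E⟩
      add_mem' := by
        rintro x y ⟨hx, hx'⟩ ⟨hy, hy'⟩
        exact ⟨U.add_mem hx hy, by rw [QuadraticMap.map_add E, hx', hy', hU x hx y hy]; simp⟩
      smul_mem' := by
        rintro c x ⟨hx, hx'⟩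
        exact ⟨U.smul_mem c hx, by rw [form_smul, hx', mul_zero]⟩ }
  have hL : ∀ x, x ∈ L ↔ x ∈ U ∧ E x = 0 := fun x => Iff.rfl
  refine ⟨L, fun x hx => hx.1, ?_, fun x hx => by rw [hL]; simp [hx]⟩
  -- Here ellipticity enters: a plane is never totally singular. All of U is radical, so r cuts the
  -- dimension of the zeros by one.
  obtain ⟨r, hr, hr0⟩ : ∃ r ∈ U, E r ≠ 0 := by
    by_contra! hcon
    have := hE.2.2 U hcon
    omega
  have h1 := ncard_mul_of_existsUnique (Z := L) (fun x hx => hx.1) hr fun x hx => by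
    have hiff : ∀ c : F, x + c • r ∈ (L : Set (Fin 6 → F)) ↔ E x + c ^ 2 * E r = 0 := by
      intro c
      rw [SetLike.mem_coe, hL, and_iff_right (U.add_mem hx (U.smul_mem c hr)), map_add_smul,
        hU x hx r hr, mul_zero, add_zero]
    simp only [hiff]
    exact existsUnique_add_sq_mul _ hr0
  apply finrank_eq_of_ncard
  rw [natCard_submodule, h3, pow_succ] at h1
  exact (Nat.eq_of_mul_eq_mul_right Nat.card_pos h1).symm

/-- A line of an elliptic quadric tangent to the base at a single point. -/
structure IsTangentLine (E Q : QuadraticForm F (Fin 6 → F)) (v : Fin 6 → F) (P : ℙ F (Fin 6 → F))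
    (L : Submodule F (Fin 6 → F)) : Prop where
  finrank_eq : finrank F L = 2
  singular : ∀ x ∈ L, E x = 0
  inter_eq : base Q v ∩ pointsOf L = {P}

lemma finrank_inf_ker {L : Submodule F (Fin 6 → F)} (h2 : finrank F L = 2)
    {f : (Fin 6 → F) →ₗ[F] F} {x : Fin 6 → F} (hx : x ∈ L) (hfx : f x ≠ 0) :
    ∃ y ∈ L, y ≠ 0 ∧ f y = 0 ∧ Submodule.span F {y, x} = L ∧ 
      ∀ z ∈ L, f z = 0 → ∃ c : F, z = c • y := by
  obtain ⟨y, hy, hy0, hfy⟩ := exists_mem_of_functional h2 f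
  have hli : LinearIndependent F ![y, x] := by
    rw [LinearIndependent.pair_iff' hy0]
    rintro a rfl
    exact hfx (by rw [map_smul, hfy, smul_zero])
  have hspan := eq_span_pair h2 hy hx hli
  refine ⟨y, hy, hy0, hfy, hspan, fun z hz hfz => ?_⟩
  rw [← hspan, mem_pair_iff] at hz
  obtain ⟨a, b, rfl⟩ := hz
  rw [map_add, map_smul, map_smul, hfy, smul_zero, zero_add, smul_eq_mul] at hfz
  have hb : b = 0 := (mul_eq_zero.1 hfz).resolve_right hfx
  exact ⟨a, by rw [hb, zero_smul, add_zero]⟩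

/-- On a singular line not inside v^⊥ the functional B(v, ·) vanishes at one point, and there the
member agrees with Q. -/
lemma isTangentLine_of_mem {Q : QuadraticForm F (Fin 6 → F)} {v : Fin 6 → F} {t : F} 
    {L : Submodule F (Fin 6 → F)} (h2 : finrank F L = 2)
    (hL : ∀ x ∈ L, member Q v t x = 0) {x : Fin 6 → F} (hx : x ∈ L) 
    (hvx : QuadraticMap.polar Q v x ≠ 0) : ∃ P, IsTangentLine (member Q v t) Q v P L := by
  obtain ⟨y, hy, hy0, hvy, -, hy'⟩ := finrank_inf_ker h2 (f := Q.polarBilin v) hx hvx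
  refine ⟨mk F y hy0, h2, hL, ?_⟩
  ext P
  induction P using Projectivization.ind with
  | h z hz =>
    rw [Set.mem_inter_iff, mk_mem_base, mk_mem_pointsOf, Set.mem_singleton_iff, mk_eq_mk_iff']
    constructor
    · rintro ⟨⟨-, hvz⟩, hzL⟩
      obtain ⟨c, hc⟩ := hy' z hzL hvz
      exact ⟨c, hc.symm⟩
    · rintro ⟨c, rfl⟩
      have hcy := L.smul_mem c hy
      have h0 : QuadraticMap.polar Q v (c • y) = 0 := by
        have : QuadraticMap.polar Q v y = 0 := hvy
        rw [QuadraticMap.polar_smul_right, this, smul_zero]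
      have := hL _ hcy
      rw [member_apply, h0] at this
      exact ⟨⟨by simpa using this, h0⟩, hcy⟩

/-- The sets of points for which the numbers of points on tangent lines add up to `q`. -/
structure IsBalanced [Finite F] (Q : QuadraticForm F (Fin 6 → F)) (v : Fin 6 → F) (j k : F)
    (A C : Set (ℙ F (Fin 6 → F))) : Prop where
  pencil : IsPencil Q v
  ne : j ≠ k
  elliptic_left : IsElliptic (member Q v j)
  elliptic_right : IsElliptic (member Q v k)
  subset_left : A ⊆ zeroLocus (member Q v j) \ base Q v
  subset_right : C ⊆ zeroLocus (member Q v k) \ base Q v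
  add_eq : ∀ P L M, IsTangentLine (member Q v j) Q v P L → IsTangentLine (member Q v k) Q v P M →
    (A ∩ pointsOf L).ncard + (C ∩ pointsOf M).ncard = Nat.card F
  lt_left : ∀ P L, IsTangentLine (member Q v j) Q v P L → (A ∩ pointsOf L).ncard < Nat.card F
  lt_right : ∀ P L, IsTangentLine (member Q v k) Q v P L → (C ∩ pointsOf L).ncard < Nat.card F

lemma mk_mem_zeroLocus_diff {Q : QuadraticForm F (Fin 6 → F)} {v : Fin 6 → F} {t : F}
    {x : Fin 6 → F} (hx : x ≠ 0) : mk F x hx ∈ zeroLocus (member Q v t) \ base Q v ↔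
      member Q v t x = 0 ∧ QuadraticMap.polar Q v x ≠ 0 := by
  rw [Set.mem_sdiff, mk_mem_zeroLocus_form, mk_mem_base]
  constructor
  · rintro ⟨h1, h2⟩
    refine ⟨h1, fun h0 => h2 ⟨?_, h0⟩⟩
    rw [member_apply, h0] at h1
    simpa using h1
  · rintro ⟨h1, h2⟩
    exact ⟨h1, fun h0 => h2 h0.2⟩

namespace IsBalanced

variable [Finite F] {Q : QuadraticForm F (Fin 6 → F)} {v : Fin 6 → F} {j k : F}
    {A C : Set (ℙ F (Fin 6 → F))} (h : IsBalanced Q v j k A C)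
include h

lemma symm : IsBalanced Q v k j C A :=
  ⟨h.pencil, h.ne.symm, h.elliptic_right, h.elliptic_left, h.subset_right, h.subset_left,
    fun P L M hL hM => by rw [add_comm]; exact h.add_eq P M L hM hL, h.lt_right, h.lt_left⟩

lemma isW5 : IsW5 F (perpOf Q) := isW5_perpOf h.pencil.1

lemma left_mem {x : Fin 6 → F} {hx : x ≠ 0} (hA : Projectivization.mk F x hx ∈ A) :
    member Q v j x = 0 ∧ QuadraticMap.polar Q v x ≠ 0 :=
  (mk_mem_zeroLocus_diff hx).1 (h.subset_left hA)

lemma right_mem {x : Fin 6 → F} {hx : x ≠ 0} (hC : Projectivization.mk F x hx ∈ C) :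
    member Q v k x = 0 ∧ QuadraticMap.polar Q v x ≠ 0 := h.symm.left_mem hC

/-- Two members differ by a nonzero multiple of B(v, ·)², so they meet only inside v^⊥. -/
lemma polar_eq_zero {x : Fin 6 → F} (h1 : member Q v j x = 0) (h2 : member Q v k x = 0) :
    QuadraticMap.polar Q v x = 0 := by
  rw [member_apply] at h1 h2
  have : (j - k) * QuadraticMap.polar Q v x ^ 2 = 0 := by linear_combination h1 - h2
  simpa [sub_ne_zero.2 h.ne] using this

lemma disjoint : Disjoint A C := by
  rw [Set.disjoint_left]
  intro P
  induction P using Projectivization.ind with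
  | h x hx =>
    intro hA hC
    exact (h.left_mem hA).2 (h.polar_eq_zero (h.left_mem hA).1 (h.right_mem hC).1)

lemma disjoint_base : Disjoint (A ∪ C) (base Q v) := by
  rw [Set.disjoint_left]
  rintro P (hP | hP)
  · exact (h.subset_left hP).2
  · exact (h.subset_right hP).2

/-- The plane U meets the two quadrics in lines L and M having the same points in common with the
base. If one of them lies in the base, then L = M and the base alone gives q + 1 points. Otherwise
both are tangent at the same point, which adds 1 to the q points of the balance condition. -/
theorem isOvoidW5 : IsOvoidW5 (perpOf Q) (Nat.card F + 1) (A ∪ C ∪ base Q v) := by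
  refine h.isW5.isOvoidW5 fun U hU hp => ?_
  have hpol : ∀ t : F, ∀ x ∈ U, ∀ y ∈ U, QuadraticMap.polar (member Q v t) x y = 0 :=
    fun t x hx y hy => by rw [polar_member]; exact hp x hx y hy
  obtain ⟨L, hLU, hL2, hL⟩ := exists_singular_line h.elliptic_left hU (hpol j)
  obtain ⟨M, hMU, hM2, hM⟩ := exists_singular_line h.elliptic_right hU (hpol k)
  have hLs : ∀ x ∈ L, member Q v j x = 0 := fun x hx => (hL x (hLU hx)).1 hx
  have hMs : ∀ x ∈ M, member Q v k x = 0 := fun x hx => (hM x (hMU hx)).1 hx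
  have hbL : base Q v ∩ pointsOf U = base Q v ∩ pointsOf L := by
    ext P
    induction P using Projectivization.ind with
    | h x hx =>
      simp only [Set.mem_inter_iff, mk_mem_base, mk_mem_pointsOf]
      refine and_congr_right fun h1 => ⟨fun h2 => (hL x h2).2 ?_, fun h2 => hLU h2⟩
      rw [member_apply, h1.1, h1.2]; simp
  have hbM : base Q v ∩ pointsOf U = base Q v ∩ pointsOf M := by
    ext P
    induction P using Projectivization.ind with
    | h x hx =>
      simp only [Set.mem_inter_iff, mk_mem_base, mk_mem_pointsOf]
      refine and_congr_right fun h1 => ⟨fun h2 => (hM x h2).2 ?_, fun h2 => hMU h2⟩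
      rw [member_apply, h1.1, h1.2]; simp
  have hA : A ∩ pointsOf U = A ∩ pointsOf L := by
    ext P
    induction P using Projectivization.ind with
    | h x hx =>
      simp only [Set.mem_inter_iff, mk_mem_pointsOf]
      exact and_congr_right fun h1 => ⟨fun h2 => (hL x h2).2 (h.left_mem h1).1, fun h2 => hLU h2⟩
  have hC : C ∩ pointsOf U = C ∩ pointsOf M := by
    ext P
    induction P using Projectivization.ind with
    | h x hx =>
      simp only [Set.mem_inter_iff, mk_mem_pointsOf]
      exact and_congr_right fun h1 => ⟨fun h2 => (hM x h2).2 (h.right_mem h1).1, fun h2 => hMU h2⟩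
  have hsplit : ((A ∪ C ∪ base Q v) ∩ pointsOf U).ncard = (A ∩ pointsOf U).ncard +
      (C ∩ pointsOf U).ncard + (base Q v ∩ pointsOf U).ncard := by
    rw [Set.union_inter_distrib_right, Set.ncard_union_eq, Set.union_inter_distrib_right,
      Set.ncard_union_eq]
    · exact h.disjoint.mono Set.inter_subset_left Set.inter_subset_left
    · exact h.disjoint_base.mono Set.inter_subset_left Set.inter_subset_left
  rw [hsplit, hA, hC]
  have hcase : ∀ t : F, ∀ N : Submodule F (Fin 6 → F), (∀ x ∈ N, member Q v t x = 0) →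
      (∀ x ∈ N, QuadraticMap.polar Q v x = 0) → pointsOf N ⊆ base Q v := by
    intro t N h1 h2 P
    induction P using Projectivization.ind with
    | h x hx =>
      rw [mk_mem_pointsOf, mk_mem_base]
      intro hxN
      have := h1 x hxN
      rw [member_apply, h2 x hxN] at this
      exact ⟨by simpa using this, h2 x hxN⟩
  -- If one of the two lines lies in the base, the other contains it, hence equals it.
  have hdeg : ∀ N : Submodule F (Fin 6 → F), pointsOf N ⊆ base Q v → finrank F N = 2 →
      base Q v ∩ pointsOf U = base Q v ∩ pointsOf N → ∀ N' : Submodule F (Fin 6 → F), 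
      finrank F N' = 2 → base Q v ∩ pointsOf U = base Q v ∩ pointsOf N' → 
      pointsOf N' ⊆ base Q v := by
    intro N h1 h2 h3 N' h4 h5
    rw [h3, Set.inter_eq_right.2 h1] at h5
    have : N = N' := by
      apply Submodule.eq_of_le_of_finrank_eq
      · have h6 : pointsOf N ⊆ pointsOf N' := by rw [h5]; exact Set.inter_subset_right
        rw [pointsOf_subset_iff, cone_pointsOf] at h6
        exact h6
      · rw [h2, h4]
    rw [← this]; exact h1
  by_cases hall : pointsOf L ⊆ base Q v
  · have hall' := hdeg L hall hL2 hbL M hM2 hbM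
    have e1 : A ∩ pointsOf L = ∅ := by
      rw [← Set.disjoint_iff_inter_eq_empty]
      exact h.disjoint_base.mono Set.subset_union_left hall
    have e2 : C ∩ pointsOf M = ∅ := by
      rw [← Set.disjoint_iff_inter_eq_empty]
      exact h.disjoint_base.mono Set.subset_union_right hall'
    rw [e1, e2, hbL, Set.inter_eq_right.2 hall, ncard_pointsOf_of_finrank_two hL2]
    simp
  · have hall' : ¬ pointsOf M ⊆ base Q v := fun hM' => hall (hdeg M hM' hM2 hbM L hL2 hbL)
    obtain ⟨x, hx, hvx⟩ : ∃ x ∈ L, QuadraticMap.polar Q v x ≠ 0 := by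
      by_contra! hcon; exact hall (hcase j L hLs hcon)
    obtain ⟨y, hy, hvy⟩ : ∃ x ∈ M, QuadraticMap.polar Q v x ≠ 0 := by
      by_contra! hcon; exact hall' (hcase k M hMs hcon)
    obtain ⟨P, hP⟩ := isTangentLine_of_mem hL2 hLs hx hvx
    obtain ⟨P', hP'⟩ := isTangentLine_of_mem hM2 hMs hy hvy
    have : P = P' := by
      have := hP.inter_eq.symm.trans (hbL.symm.trans (hbM.trans hP'.inter_eq))
      exact Set.singleton_injective this
    subst this
    rw [h.add_eq P L M hP hP', hbL, hP.inter_eq, Set.ncard_singleton]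

/-- A line of the quadric `member Q v j` that is not in the base has points off `A ∪ C`. -/
lemma not_subset_of_left {L : Submodule F (Fin 6 → F)} (h2 : finrank F L = 2)
    (hL : ∀ x ∈ L, member Q v j x = 0) {x : Fin 6 → F} (hx : x ∈ L)
    (hvx : QuadraticMap.polar Q v x ≠ 0) : ¬ pointsOf L ⊆ A ∪ C ∪ base Q v := by
  intro hsub
  obtain ⟨P, hP⟩ := isTangentLine_of_mem h2 hL hx hvx
  have h3 : pointsOf L = (A ∩ pointsOf L) ∪ (base Q v ∩ pointsOf L) := by
    rw [← Set.union_inter_distrib_right]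
    symm
    rw [Set.inter_eq_right]
    intro R hR
    rcases hsub hR with (hA | hC) | hb
    · exact Or.inl hA
    · exfalso
      induction R using Projectivization.ind with
      | h y hy =>
        exact (h.right_mem hC).2 (h.polar_eq_zero (hL y ((mk_mem_pointsOf hy).1 hR)) (h.right_mem hC).1)
    · exact Or.inr hb
  have h4 := ncard_pointsOf_of_finrank_two h2
  rw [h3, hP.inter_eq] at h4
  have h5 := Set.ncard_union_le (A ∩ pointsOf L) {P}
  rw [Set.ncard_singleton] at h5
  have := h.lt_left P L hP
  omega

/-- A contained line always has a point of v^⊥, and this lies in the base. If it also has a point of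
A or C, it is a singular line of that quadric, and a tangent line is never filled by one half. -/
lemma pointsOf_subset_base {L : Submodule F (Fin 6 → F)} (h2 : finrank F L = 2)
    (hp : TotIsotropic (perpOf Q) L) (hsub : pointsOf L ⊆ A ∪ C ∪ base Q v) :
    pointsOf L ⊆ base Q v := by
  have hpol : ∀ t : F, ∀ x ∈ L, ∀ y ∈ L, QuadraticMap.polar (member Q v t) x y = 0 :=
    fun t x hx y hy => by rw [polar_member]; exact hp x hx y hy
  by_cases hall : ∀ x ∈ L, QuadraticMap.polar Q v x = 0
  · intro P hP
    rcases hsub hP with (hA | hC) | hb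
    · exfalso
      induction P using Projectivization.ind with
      | h x hx => exact (h.left_mem hA).2 (hall x ((mk_mem_pointsOf hx).1 hP))
    · exfalso
      induction P using Projectivization.ind with
      | h x hx => exact (h.right_mem hC).2 (hall x ((mk_mem_pointsOf hx).1 hP))
    · exact hb
  · push Not at hall
    obtain ⟨x, hx, hvx⟩ := hall
    have hx0 : x ≠ 0 := by
      rintro rfl; exact hvx (by simp)
    obtain ⟨y, hy, hy0, hvy, hspan, -⟩ := finrank_inf_ker h2 (f := Q.polarBilin v) hx hvx
    have hvy : QuadraticMap.polar Q v y = 0 := hvy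
    have hQy : Q y = 0 := by
      rcases hsub ((mk_mem_pointsOf hy0).2 hy) with (hA | hC) | hb
      · exact absurd hvy (h.left_mem hA).2
      · exact absurd hvy (h.right_mem hC).2
      · exact ((mk_mem_base Q v hy0).1 hb).1
    have hsing : ∀ t : F, member Q v t x = 0 → ∀ z ∈ L, member Q v t z = 0 := by
      intro t ht z hz
      rw [← hspan, mem_pair_iff] at hz
      obtain ⟨a, b, rfl⟩ := hz
      rw [map_add_smul, form_smul, ht, QuadraticMap.polar_smul_left, hpol t y hy x hx, member_apply,
        hQy, hvy]
      simp
    rcases hsub ((mk_mem_pointsOf hx0).2 hx) with (hA | hC) | hb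
    · exact (h.not_subset_of_left h2 (hsing j (h.left_mem hA).1) hx hvx hsub).elim
    · refine (h.symm.not_subset_of_left h2 (hsing k (h.right_mem hC).1) hx hvx ?_).elim
      rwa [Set.union_comm C A]
    · exact absurd ((mk_mem_base Q v hx0).1 hb).2 hvx

lemma lineSpaces_eq : {U : Submodule F (Fin 6 → F) | finrank F U = 2 ∧ TotIsotropic (perpOf Q) U ∧
    pointsOf U ⊆ A ∪ C ∪ base Q v} =
    {U : Submodule F (Fin 6 → F) | finrank F U = 2 ∧ pointsOf U ⊆ base Q v} := by
  ext U
  constructor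
  · rintro ⟨h1, h2, h3⟩
    exact ⟨h1, h.pointsOf_subset_base h1 h2 h3⟩
  · rintro ⟨h1, h2⟩
    refine ⟨h1, fun x hx y hy => ?_, h2.trans Set.subset_union_right⟩
    change QuadraticMap.polar Q x y = 0
    have h3 : ∀ z ∈ U, Q z = 0 := fun z hz => (mem_cone_base.1 (pointsOf_subset_iff.1 h2 hz)).1
    have := QuadraticMap.map_add Q x y
    rw [h3 x hx, h3 y hy, h3 _ (U.add_mem hx hy)] at this
    simpa using this.symm

end IsBalanced

end Pencil

/-! ### Double counting -/

section DoubleCounting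

variable {α β : Type*} [Finite α] [Finite β]

lemma ncard_setOf_pairs {X : Set α} {Y : α → Set β} {n : ℕ} (h : ∀ x ∈ X, (Y x).ncard = n) :
    {p : α × β | p.1 ∈ X ∧ p.2 ∈ Y p.1}.ncard = X.ncard * n := by
  have := Fintype.ofFinite X
  let e : {p : α × β | p.1 ∈ X ∧ p.2 ∈ Y p.1} ≃ Σ x : X, Y x :=
    { toFun := fun p => ⟨⟨p.1.1, p.2.1⟩, ⟨p.1.2, p.2.2⟩⟩
      invFun := fun s => ⟨(s.1, s.2), s.1.2, s.2.2⟩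
      left_inv := fun p => rfl
      right_inv := fun s => rfl }
  rw [← Nat.card_coe_set_eq, Nat.card_congr e, Nat.card_sigma, 
    Finset.sum_congr rfl fun (x : X) _ => (Nat.card_coe_set_eq (Y x)).trans (h x x.2), Finset.sum_const,
    smul_eq_mul, Finset.card_univ, ← Nat.card_eq_fintype_card, Nat.card_coe_set_eq]

lemma ncard_of_fibers {X : Set α} {Y : Set β} {f : α → β} {n : ℕ} (hf : ∀ x ∈ X, f x ∈ Y)
    (h : ∀ y ∈ Y, {x ∈ X | f x = y}.ncard = n) : X.ncard = Y.ncard * n := by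
  rw [← ncard_setOf_pairs h, 
    ← Set.ncard_image_of_injective X (f := fun x => (f x, x)) fun x y hxy => (Prod.ext_iff.1 hxy).2]
  congr 1
  ext ⟨y, x⟩
  constructor
  · rintro ⟨x', hx', he⟩
    obtain ⟨rfl, rfl⟩ := Prod.ext_iff.1 he
    exact ⟨hf _ hx', hx', rfl⟩
  · rintro ⟨-, hx, he⟩
    exact ⟨x, hx, Prod.ext he rfl⟩

end DoubleCounting

/-! ### Number of lines of the parabolic quadric -/

section Lines

variable {F : Type u} [Field F] [Finite F]

lemma ncard_span_singleton {V : Type w} [AddCommGroup V] [Module F V] [Finite V] {x : V}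
    (hx : x ≠ 0) : ((F ∙ x : Submodule F V) : Set V).ncard = Nat.card F := by
  have : FiniteDimensional F V := Module.Finite.of_finite
  rw [natCard_submodule, finrank_span_singleton hx, pow_one]

/-- Each 2-space has (q² - 1)(q² - q) ordered bases. -/
lemma ncard_mul_pairs {V : Type w} [AddCommGroup V] [Module F V] [Finite V] 
    {S : Set (Submodule F V)} (hS : ∀ U ∈ S, finrank F U = 2) :
    {p : V × V | LinearIndependent F ![p.1, p.2] ∧ Submodule.span F {p.1, p.2} ∈ S}.ncard =
      S.ncard * ((Nat.card F ^ 2 - 1) * (Nat.card F ^ 2 - Nat.card F)) := by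
  have : Finite (Submodule F V) := Finite.of_injective _ SetLike.coe_injective
  have hfd : FiniteDimensional F V := Module.Finite.of_finite
  refine ncard_of_fibers (f := fun p : V × V => Submodule.span F {p.1, p.2}) (fun p hp => hp.2) ?_
  intro U hU
  have h1 : ((U : Set V) \ {0}).ncard = Nat.card F ^ 2 - 1 := by
    rw [Set.ncard_sdiff_singleton_of_mem U.zero_mem, natCard_submodule, hS U hU]
  rw [← h1, ← ncard_setOf_pairs (X := (U : Set V) \ {0}) 
    (Y := fun x => (U : Set V) \ (F ∙ x : Submodule F V))]
  · congr 1
    ext ⟨x, y⟩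
    constructor
    · rintro ⟨⟨hli, -⟩, rfl⟩
      have hx0 : x ≠ 0 := hli.ne_zero 0
      rw [LinearIndependent.pair_iff' hx0] at hli
      refine ⟨⟨Submodule.subset_span (by simp), hx0⟩, Submodule.subset_span (by simp), ?_⟩
      intro hy
      obtain ⟨a, ha⟩ := Submodule.mem_span_singleton.1 hy
      exact hli a ha
    · rintro ⟨⟨hx, hx0⟩, hy, hyx⟩
      have hli : LinearIndependent F ![x, y] := by
        rw [LinearIndependent.pair_iff' hx0]
        exact fun a ha => hyx (Submodule.mem_span_singleton.2 ⟨a, ha⟩)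
      have := eq_span_pair (hS U hU) hx hy hli
      exact ⟨⟨hli, by simpa only [this] using hU⟩, this⟩
  · rintro x ⟨hx, hx0⟩
    rw [Set.ncard_sdiff (by simpa using hx), natCard_submodule, hS U hU, ncard_span_singleton hx0]

variable [CharP F 2]

/-- The number of lines of a parabolic quadric of `PG(4, q)`. -/
lemma ncard_lines_base {Q : QuadraticForm F (Fin 6 → F)} {v : Fin 6 → F} (h : IsPencil Q v) :
    {U : Submodule F (Fin 6 → F) | finrank F U = 2 ∧ pointsOf U ⊆ base Q v}.ncard =
      (Nat.card F + 1) * (Nat.card F ^ 2 + 1) := by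
  obtain ⟨-, B, halt, hnd, hB⟩ := isW5_perpOf h.1
  have hB : ∀ x y, B x y = 0 ↔ QuadraticMap.polar Q x y = 0 := fun x y => (hB x y).symm
  have hv0 : v ≠ 0 := by rintro rfl; exact h.2 (QuadraticMap.map_zero Q)
  have hcard : 1 < Nat.card F := Finite.one_lt_card
  -- The vector v is nonsingular and radical in U, so each coset of Fv contains one zero of Q.
  have hcount : ∀ U : Submodule F (Fin 6 → F), v ∈ U → (∀ x ∈ U, QuadraticMap.polar Q v x = 0) →
      ∀ n, finrank F U = n + 1 → {x ∈ (U : Set (Fin 6 → F)) | Q x = 0}.ncard = Nat.card F ^ n := by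
    intro U hvU hU n hn
    have h1 := ncard_mul_of_existsUnique (Z := {x ∈ (U : Set (Fin 6 → F)) | Q x = 0})
      (fun x hx => hx.1) hvU fun x hx => by
        have hiff : ∀ c : F, x + c • v ∈ {x ∈ (U : Set (Fin 6 → F)) | Q x = 0} ↔
            Q x + c ^ 2 * Q v = 0 := by
          intro c
          rw [Set.mem_sep_iff, SetLike.mem_coe, and_iff_right (U.add_mem hx (U.smul_mem c hvU)),
            map_add_smul, QuadraticMap.polar_comm, hU x hx, mul_zero, add_zero]
        simp only [hiff]
        exact existsUnique_add_sq_mul _ h.2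
    rw [natCard_submodule, hn, pow_succ] at h1
    exact (Nat.eq_of_mul_eq_mul_right Nat.card_pos h1).symm
  have horth : ∀ x y, y ∈ B.orthogonal (F ∙ x) ↔ QuadraticMap.polar Q x y = 0 := by
    intro x y
    rw [LinearMap.BilinForm.mem_orthogonal_iff]
    constructor
    · intro hy
      exact (hB _ _).1 (hy x (Submodule.mem_span_singleton_self x))
    · intro hy n hn
      obtain ⟨c, rfl⟩ := Submodule.mem_span_singleton.1 hn
      change B _ y = 0
      rw [map_smul, LinearMap.smul_apply, (hB _ _).2 hy, smul_zero]
  have horth2 : ∀ x y z, z ∈ B.orthogonal (Submodule.span F {x, y}) ↔ 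
      QuadraticMap.polar Q x z = 0 ∧ QuadraticMap.polar Q y z = 0 := by
    intro x y z
    rw [LinearMap.BilinForm.mem_orthogonal_iff]
    constructor
    · intro hz
      exact ⟨(hB _ _).1 (hz x (Submodule.subset_span (by simp))), 
        (hB _ _).1 (hz y (Submodule.subset_span (by simp)))⟩
    · rintro ⟨h1, h2⟩ n hn
      obtain ⟨a, b, rfl⟩ := mem_pair_iff.1 hn
      change B _ z = 0
      rw [map_add, map_smul, map_smul, LinearMap.add_apply,
        LinearMap.smul_apply, LinearMap.smul_apply, (hB _ _).2 h1, (hB _ _).2 h2]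
      simp
  have h5 : finrank F (B.orthogonal (F ∙ v)) = 4 + 1 := by
    rw [LinearMap.BilinForm.finrank_orthogonal hnd, finrank_span_singleton hv0]; simp
  have hX := hcount (B.orthogonal (F ∙ v)) ((horth v v).2 (polar_self_char_two Q v))
    (fun x hx => (horth v x).1 hx) 4 h5
  set X : Set (Fin 6 → F) := {x ∈ (B.orthogonal (F ∙ v) : Set (Fin 6 → F)) | Q x = 0} with hXdef
  have hmemX : ∀ x, x ∈ X ↔ x ∈ cone (base Q v) := fun x => by
    rw [mem_cone_base, hXdef, Set.mem_sep_iff, SetLike.mem_coe, horth, and_comm]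
  have h1 : (X \ {0}).ncard = Nat.card F ^ 4 - 1 := by
    rw [Set.ncard_sdiff_singleton_of_mem ((hmemX 0).2 (zero_mem_cone _)), hX]
  -- Ordered bases of lines of the base: q⁴ - 1 choices for x, then q³ singular vectors orthogonal
  -- to v and x, minus the q multiples of x.
  have hpairs := ncard_setOf_pairs (X := X \ {0}) (n := Nat.card F ^ 3 - Nat.card F)
    (Y := fun x => {y ∈ X | QuadraticMap.polar Q x y = 0} \ ((F ∙ x : Submodule F (Fin 6 → F)))) (by
      rintro x ⟨hx, hx0⟩
      have hx0 : x ≠ 0 := hx0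
      have hxb := mem_cone_base.1 ((hmemX x).1 hx)
      have hli : LinearIndependent F ![v, x] := by
        rw [LinearIndependent.pair_iff' hv0]
        rintro a rfl
        rw [form_smul] at hxb
        have ha : a = 0 := by simpa [h.2] using hxb.1
        exact hx0 (by rw [ha, zero_smul])
      have h4 : finrank F (B.orthogonal (Submodule.span F {v, x})) = 3 + 1 := by
        rw [LinearMap.BilinForm.finrank_orthogonal hnd, finrank_span_pair_eq_two hli]; simp
      have h3 := hcount (B.orthogonal (Submodule.span F {v, x})) ((horth2 v x v).2 
        ⟨polar_self_char_two Q v, by rw [QuadraticMap.polar_comm]; exact hxb.2⟩)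
        (fun y hy => ((horth2 v x y).1 hy).1) 3 h4
      have hYeq : {y ∈ X | QuadraticMap.polar Q x y = 0} = 
          {y ∈ (B.orthogonal (Submodule.span F {v, x}) : Set (Fin 6 → F)) | Q y = 0} := by
        ext y
        have := hmemX y
        rw [mem_cone_base] at this
        simp only [Set.mem_ofPred_eq, SetLike.mem_coe, horth2]
        tauto
      rw [Set.ncard_sdiff, ncard_span_singleton hx0, hYeq, h3]
      intro y hy
      obtain ⟨c, rfl⟩ := Submodule.mem_span_singleton.1 hy
      rw [Set.mem_sep_iff, hmemX, mem_cone_base, form_smul, hxb.1, QuadraticMap.polar_smul_right,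
        QuadraticMap.polar_smul_right, hxb.2, polar_self_char_two]
      simp)
  have hpairs' := ncard_mul_pairs (S := {U : Submodule F (Fin 6 → F) | 
    finrank F U = 2 ∧ pointsOf U ⊆ base Q v}) fun U hU => hU.1
  have hset : {p : (Fin 6 → F) × (Fin 6 → F) | LinearIndependent F ![p.1, p.2] ∧ 
      Submodule.span F {p.1, p.2} ∈ {U : Submodule F (Fin 6 → F) | 
        finrank F U = 2 ∧ pointsOf U ⊆ base Q v}} = {p | p.1 ∈ X \ {0} ∧ p.2 ∈ 
          {y ∈ X | QuadraticMap.polar Q p.1 y = 0} \ ((F ∙ p.1 : Submodule F (Fin 6 → F)))} := by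
    ext ⟨x, y⟩
    constructor
    · rintro ⟨hli, -, hsub⟩
      have hx0 : x ≠ 0 := hli.ne_zero 0
      rw [LinearIndependent.pair_iff' hx0] at hli
      rw [pointsOf_subset_iff] at hsub
      have hx := hsub (Submodule.subset_span (by simp : x ∈ {x, y}))
      have hy := hsub (Submodule.subset_span (by simp : y ∈ {x, y}))
      have hxy := hsub (Submodule.add_mem _ (Submodule.subset_span (by simp : x ∈ {x, y}))
        (Submodule.subset_span (by simp : y ∈ {x, y})))
      have hpol : QuadraticMap.polar Q x y = 0 := by
        have h0 := QuadraticMap.map_add Q x y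
        rw [(mem_cone_base.1 hx).1, (mem_cone_base.1 hy).1, (mem_cone_base.1 hxy).1] at h0
        simpa using h0.symm
      refine ⟨⟨(hmemX x).2 hx, hx0⟩, ⟨(hmemX y).2 hy, hpol⟩, ?_⟩
      intro hmem
      obtain ⟨a, ha⟩ := Submodule.mem_span_singleton.1 hmem
      exact hli a ha
    · rintro ⟨⟨hx, hx0⟩, ⟨hy, hpol⟩, hyx⟩
      have hx0 : x ≠ 0 := hx0
      have hli : LinearIndependent F ![x, y] := by
        rw [LinearIndependent.pair_iff' hx0]
        exact fun a ha => hyx (Submodule.mem_span_singleton.2 ⟨a, ha⟩)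
      refine ⟨hli, finrank_span_pair_eq_two hli, ?_⟩
      rw [pointsOf_subset_iff]
      intro z hz
      obtain ⟨a, b, rfl⟩ := mem_pair_iff.1 hz
      have hx' := mem_cone_base.1 ((hmemX x).1 hx)
      have hy' := mem_cone_base.1 ((hmemX y).1 hy)
      have hpol : QuadraticMap.polar Q x y = 0 := hpol
      rw [mem_cone_base, map_add_smul, form_smul, QuadraticMap.polar_smul_left, hx'.1, hy'.1, hpol,
        QuadraticMap.polar_add_right, QuadraticMap.polar_smul_right, QuadraticMap.polar_smul_right,
        hx'.2, hy'.2]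
      simp
  rw [hset, hpairs, h1] at hpairs'
  obtain ⟨k, hk⟩ : ∃ k, Nat.card F = k + 2 := ⟨Nat.card F - 2, by omega⟩
  rw [hk] at hpairs' ⊢
  have e1 : (k + 2) ^ 4 - 1 = ((k + 2) ^ 2 + 1) * ((k + 2) ^ 2 - 1) := by
    have : 1 ≤ (k + 2) ^ 2 := Nat.one_le_pow _ _ (by omega)
    have : 1 ≤ (k + 2) ^ 4 := Nat.one_le_pow _ _ (by omega)
    zify [*]; ring
  have e2 : (k + 2) ^ 3 - (k + 2) = (k + 3) * ((k + 2) ^ 2 - (k + 2)) := by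
    have : k + 2 ≤ (k + 2) ^ 2 := Nat.le_self_pow (by norm_num) _
    have : k + 2 ≤ (k + 2) ^ 3 := Nat.le_self_pow (by norm_num) _
    zify [*]; ring
  have e3 : 0 < ((k + 2) ^ 2 - 1) * ((k + 2) ^ 2 - (k + 2)) := by
    apply Nat.mul_pos
    · have : 1 < (k + 2) ^ 2 := Nat.one_lt_pow (by norm_num) (by omega)
      omega
    · have : k + 2 < (k + 2) ^ 2 := by nlinarith
      omega
  apply Nat.eq_of_mul_eq_mul_right e3
  rw [← hpairs', e1, e2]
  ring

namespace IsBalanced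

variable {Q : QuadraticForm F (Fin 6 → F)} {v : Fin 6 → F} {j k : F}
    {A C : Set (ℙ F (Fin 6 → F))} (h : IsBalanced Q v j k A C)
include h

theorem ncard_linesIn : (linesIn (perpOf Q) (A ∪ C ∪ base Q v)).ncard =
    (Nat.card F + 1) * (Nat.card F ^ 2 + 1) := by
  rw [OvoidW5.ncard_linesIn, h.lineSpaces_eq, ncard_lines_base h.pencil]

end IsBalanced

end Lines

/-! ### Relative hemisystems -/

section Hemisystem

variable {F : Type u} [Field F] [Fintype F] [CharP F 2]

/-- Each half has q/2 points on every tangent line, and q/2 + q/2 = q while q/2 < q. -/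
lemma IsHemisystemOvoid.exists_isBalanced {Q : QuadraticForm F (Fin 6 → F)} {v : Fin 6 → F} 
    {X : Set (ℙ F (Fin 6 → F))} (h : IsHemisystemOvoid Q v X) : ∃ j k A C, IsBalanced Q v j k A C ∧
      X = A ∪ C ∪ base Q v ∧ 
      (∀ P L, IsTangentLine (member Q v j) Q v P L → 2 * (A ∩ pointsOf L).ncard = Nat.card F) ∧
      (∀ P L, IsTangentLine (member Q v k) Q v P L → 2 * (C ∩ pointsOf L).ncard = Nat.card F) := by
  obtain ⟨hp, j, k, A, C, hne, hj, hk, hA, hC, rfl⟩ := h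
  have hA' : ∀ P L, IsTangentLine (member Q v j) Q v P L → 
      2 * (A ∩ pointsOf L).ncard = Nat.card F := fun P L hL => by
    rw [Nat.card_eq_fintype_card]
    exact hA.2.2 L hL.finrank_eq hL.singular (by rw [hL.inter_eq, Set.ncard_singleton])
  have hC' : ∀ P L, IsTangentLine (member Q v k) Q v P L → 
      2 * (C ∩ pointsOf L).ncard = Nat.card F := fun P L hL => by
    rw [Nat.card_eq_fintype_card]
    exact hC.2.2 L hL.finrank_eq hL.singular (by rw [hL.inter_eq, Set.ncard_singleton])
  have hpos : 0 < Nat.card F := Nat.card_pos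
  refine ⟨j, k, A, C, ⟨hp, hne, hj, hk, hA.1, hC.1, ?_, ?_, ?_⟩, rfl, hA', hC'⟩
  · intro P L M hL hM
    have := hA' P L hL
    have := hC' P M hM
    omega
  · intro P L hL
    have := hA' P L hL
    omega
  · intro P L hL
    have := hC' P L hL
    omega

end Hemisystem

/-! ### A quadratic character sum

`ρ` is an automorphism of the field `F` of characteristic two whose square is the inverse of the
Frobenius automorphism. -/

section CharacterSum

variable {F : Type u} [Field F] [CharP F 2] {ρ : F →+* F}

lemma rho_ne_zero {a : F} (ha : a ≠ 0) : ρ a ≠ 0 := (map_ne_zero ρ).2 ha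

lemma eq_zero_or_one_of_sq {a : F} (h : a ^ 2 = a) : a = 0 ∨ a = 1 := by
  have : a * (a - 1) = 0 := by linear_combination h
  rcases mul_eq_zero.1 this with h | h
  · exact Or.inl h
  · exact Or.inr (sub_eq_zero.1 h)

variable (ρ) in
/-- The additive map `b ↦ b + ρ b`. -/
def addRho : F →+ F := AddMonoidHom.id F + (ρ : F →+ F)

lemma addRho_apply (b : F) : addRho ρ b = b + ρ b := rfl

open scoped Classical in
variable (ρ) in
/-- The additive character of `F` with values `1` and `-1` and kernel the range of `addRho ρ`. -/
noncomputable def chi (a : F) : ℤ := if a ∈ (addRho ρ).range then 1 else -1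

lemma chi_eq_one_iff {a : F} : chi ρ a = 1 ↔ a ∈ (addRho ρ).range := by
  by_cases h : a ∈ (addRho ρ).range <;> simp [chi, h]

lemma chi_eq_or (a : F) : chi ρ a = 1 ∨ chi ρ a = -1 := by
  by_cases h : a ∈ (addRho ρ).range <;> simp [chi, h]

lemma chi_mul_self (a : F) : chi ρ a * chi ρ a = 1 := by
  rcases chi_eq_or (ρ := ρ) a with h | h <;> simp [h]

lemma chi_zero : chi ρ 0 = 1 := chi_eq_one_iff.2 (zero_mem _)

variable (hρ : ∀ a, ρ (ρ a) ^ 2 = a)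
include hρ

lemma rho_fixed {a : F} (h : ρ a = a) : a = 0 ∨ a = 1 := by
  apply eq_zero_or_one_of_sq
  have := hρ a
  rwa [h, h] at this

lemma rho_rho_sq (a : F) : ρ (ρ (a ^ 2)) = a := by
  rw [map_pow, map_pow, hρ]

lemma rho_ne_add_one (a : F) : ρ a ≠ a + 1 := by
  intro h
  have h2 := hρ a
  rw [h, map_add, h, map_one, add_assoc, add_self_char_two, add_zero] at h2
  rcases eq_zero_or_one_of_sq h2 with rfl | rfl
  · simp at h
  · simp at h

lemma chi_one : chi ρ 1 = -1 := by
  rcases chi_eq_or (ρ := ρ) 1 with h | h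
  · obtain ⟨b, hb⟩ := chi_eq_one_iff.1 h
    rw [addRho_apply] at hb
    exact (rho_ne_add_one hρ b (by linear_combination hb - b * CharTwo.two_eq_zero (R := F))).elim
  · exact h

variable [Fintype F]

lemma rho_bijective : Function.Bijective ρ := Finite.injective_iff_bijective.1 ρ.injective

lemma chi_add (a b : F) : chi ρ (a + b) = chi ρ a * chi ρ b := by
  have := add_mem_range_iff (addRho ρ) (by rw [addRho_apply, map_one, add_self_char_two])
    (fun x hx => rho_fixed hρ ((eq_of_add_eq_zero_char_two hx).symm)) a b
  by_cases ha : a ∈ (addRho ρ).range <;> by_cases hb : b ∈ (addRho ρ).range <;>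
    simp [chi, this, ha, hb]

lemma chi_rho (a : F) : chi ρ (ρ a) = chi ρ a := by
  have h : chi ρ (a + ρ a) = 1 := chi_eq_one_iff.2 ⟨a, rfl⟩
  rw [chi_add hρ] at h
  rcases chi_eq_or (ρ := ρ) a with h1 | h1 <;> rcases chi_eq_or (ρ := ρ) (ρ a) with h2 | h2 <;>
    simp [h1, h2] at h ⊢

/-- Since a is the image of a² under ρ twice and chi is invariant under ρ, it takes equal values at
a and a². -/
lemma chi_sq_add (a : F) : chi ρ (a ^ 2 + a) = 1 := by
  have h := (chi_rho hρ (ρ (a ^ 2))).trans (chi_rho hρ (a ^ 2))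
  rw [rho_rho_sq hρ] at h
  rw [chi_add hρ, ← h, chi_mul_self]

/-- Neither κ nor 1 is of the form x² + x, and such elements form a subgroup of index 2; so κ + 1 is
of this form and chi is 1 there. -/
lemma chi_of_anisotropic {κ : F} (hκ : ∀ x, x ^ 2 + x + κ ≠ 0) : chi ρ κ = -1 := by
  let f : F →+ F := AddMonoidHom.id F + (frobenius F 2 : F →+ F)
  have hf : ∀ x, f x = x ^ 2 + x := fun x => by rw [add_comm]; rfl
  have h1 := add_mem_range_iff f (by rw [hf, one_pow, add_self_char_two])
    (fun x hx => by
      rw [hf] at hx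
      exact eq_zero_or_one_of_sq (eq_of_add_eq_zero_char_two hx)) κ 1
  have h2 : κ ∉ f.range := by
    rintro ⟨x, hx⟩
    rw [hf] at hx
    exact hκ x (by rw [hx, add_self_char_two])
  have h3 : (1 : F) ∉ f.range := by
    rintro ⟨x, hx⟩
    have := chi_sq_add hρ x
    rw [← hf, hx, chi_one hρ] at this
    omega
  obtain ⟨x, hx⟩ := h1.2 ⟨fun h => (h2 h).elim, fun h => (h3 h).elim⟩
  have h4 := chi_sq_add hρ x
  rw [← hf, hx, chi_add hρ, chi_one hρ] at h4
  omega

/-- Translation by c⁻¹ multiplies the sum by chi(1) = -1. -/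
lemma sum_chi_mul {c : F} (hc : c ≠ 0) : ∑ a, chi ρ (a * c) = 0 := by
  have h1 : ∑ a, chi ρ ((a + c⁻¹) * c) = ∑ a, chi ρ (a * c) :=
    Equiv.sum_comp (Equiv.addRight c⁻¹) fun a => chi ρ (a * c)
  simp only [add_mul, inv_mul_cancel₀ hc, chi_add hρ _ 1, chi_one hρ, mul_neg, mul_one,
    Finset.sum_neg_distrib] at h1
  omega

variable (ρ) in
omit hρ [CharP F 2] in
/-- A quadratic Gauss sum. -/
noncomputable def gaussSum (κ : F) : ℤ := ∑ a, chi ρ (a * κ + a * ρ a)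

-- Squaring the sum and substituting a + d for the second variable leaves inner sums over a that
-- vanish unless d is 0 or 1. These two terms contribute q and q·chi(κ + 1) = q.
open scoped Classical in
lemma gaussSum_sq {κ : F} (hκ : ∀ x, x ^ 2 + x + κ ≠ 0) :
    gaussSum ρ κ ^ 2 = 2 * Fintype.card F := by
  have key : ∀ d, ∑ a, chi ρ (a * ρ d + d * ρ a) = if d = 0 ∨ d = 1 then (Fintype.card F : ℤ) else 0 := by
    intro d
    obtain ⟨d', rfl⟩ := (rho_bijective hρ).2 d
    -- By invariance under ρ the second term may be replaced by d'·a, so the argument becomes linear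
    -- in a.
    have h1 : ∀ a, chi ρ (a * ρ (ρ d') + ρ d' * ρ a) = chi ρ (a * (ρ (ρ d') + d')) := fun a => by
      rw [chi_add hρ, ← map_mul, chi_rho hρ, ← chi_add hρ]; ring_nf
    simp only [h1]
    have h2 : ρ (ρ d') + d' = 0 ↔ ρ d' = 0 ∨ ρ d' = 1 := by
      rw [map_eq_zero, map_eq_one_iff ρ ρ.injective]
      constructor
      · intro h
        apply eq_zero_or_one_of_sq
        have := hρ d'
        rwa [eq_of_add_eq_zero_char_two h] at this
      · rintro (rfl | rfl)
        · simp
        · simp [add_self_char_two]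
    by_cases h3 : ρ (ρ d') + d' = 0
    · rw [if_pos (h2.1 h3), h3]
      simp [chi_zero]
    · rw [if_neg (fun h => h3 (h2.2 h)), sum_chi_mul hρ h3]
  have h1 : ∀ a d, chi ρ (a * κ + a * ρ a) * chi ρ ((a + d) * κ + (a + d) * ρ (a + d)) =
      chi ρ (d * κ + d * ρ d) * chi ρ (a * ρ d + d * ρ a) := by
    intro a d
    rw [← chi_add hρ, ← chi_add hρ]
    congr 1
    rw [map_add]
    linear_combination (a * κ + a * ρ a) * CharTwo.two_eq_zero (R := F)
  have hκ1 : chi ρ (κ + 1) = 1 := by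
    rw [chi_add hρ, chi_of_anisotropic hρ hκ, chi_one hρ]; rfl
  calc gaussSum ρ κ ^ 2 = ∑ a, ∑ d, chi ρ (a * κ + a * ρ a) *
        chi ρ ((a + d) * κ + (a + d) * ρ (a + d)) := by
        rw [sq, gaussSum, Finset.sum_mul]
        refine Finset.sum_congr rfl fun a _ => ?_
        rw [Finset.mul_sum]
        exact (Equiv.sum_comp (Equiv.addLeft a) fun b => chi ρ (a * κ + a * ρ a) *
          chi ρ (b * κ + b * ρ b)).symm
    _ = ∑ d, chi ρ (d * κ + d * ρ d) * ∑ a, chi ρ (a * ρ d + d * ρ a) := by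
        rw [Finset.sum_comm]
        refine Finset.sum_congr rfl fun d _ => ?_
        rw [Finset.mul_sum]
        exact Finset.sum_congr rfl fun a _ => h1 a d
    _ = ∑ d ∈ ({0, 1} : Finset F), (Fintype.card F : ℤ) := by
        rw [← Finset.sum_subset (Finset.subset_univ ({0, 1} : Finset F))]
        · refine Finset.sum_congr rfl fun d hd => ?_
          rw [Finset.mem_insert, Finset.mem_singleton] at hd
          rw [key, if_pos hd]
          rcases hd with rfl | rfl
          · simp [chi_zero]
          · simp [hκ1]
        · intro d _ hd
          rw [Finset.mem_insert, Finset.mem_singleton] at hd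
          rw [key, if_neg hd, mul_zero]
    _ = 2 * Fintype.card F := by
        rw [Finset.sum_const, Finset.card_pair zero_ne_one]; simp

lemma ncard_addRho_eq (c : F) : ({b : F | addRho ρ b = c}.ncard : ℤ) = 1 + chi ρ c := by
  rcases chi_eq_or (ρ := ρ) c with h | h
  · obtain ⟨b, rfl⟩ := chi_eq_one_iff.1 h
    have : {x : F | addRho ρ x = addRho ρ b} = {b, b + 1} := by
      ext x
      rw [Set.mem_ofPred_eq, Set.mem_insert_iff, Set.mem_singleton_iff, ← sub_eq_zero, ← map_sub]
      constructor
      · intro hx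
        rcases rho_fixed hρ (eq_of_add_eq_zero_char_two hx).symm with h0 | h0
        · exact Or.inl (sub_eq_zero.1 h0)
        · exact Or.inr (by linear_combination h0)
      · rintro (rfl | rfl)
        · simp
        · rw [add_sub_cancel_left, addRho_apply, map_one, add_self_char_two]
    rw [this, Set.ncard_pair (by simp), h]; rfl
  · have : {x : F | addRho ρ x = c} = ∅ := by
      ext x
      rw [Set.mem_ofPred_eq]
      simp only [Set.mem_empty_iff_false, iff_false]
      intro hx
      have := chi_eq_one_iff.2 ⟨x, hx⟩
      omega
    rw [this, h]; simp

/-- For fixed a the equation prescribes b + ρ b, which has 1 + chi solutions; the sum over a is the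
Gauss sum. This counts the affine ovoid points orthogonal to an orbit representative. -/
lemma ncard_solutions (κ u : F) :
    ({p : F × F | u + p.1 * κ + p.2 + (p.1 * ρ p.1 + ρ p.2) = 0}.ncard : ℤ) =
      Fintype.card F + chi ρ u * gaussSum ρ κ := by
  have h1 : ∀ a, {b : F | u + a * κ + b + (a * ρ a + ρ b) = 0} =
      {b : F | addRho ρ b = u + (a * κ + a * ρ a)} := by
    intro a
    ext b
    rw [Set.mem_ofPred_eq, Set.mem_ofPred_eq, addRho_apply]
    constructor
    · intro h
      apply eq_of_add_eq_zero_char_two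
      linear_combination h
    · intro h
      linear_combination h + (u + a * κ + a * ρ a) * CharTwo.two_eq_zero (R := F)
  have h2 : ({p : F × F | u + p.1 * κ + p.2 + (p.1 * ρ p.1 + ρ p.2) = 0}.ncard : ℤ) =
      ∑ a, ({b : F | u + a * κ + b + (a * ρ a + ρ b) = 0}.ncard : ℤ) := by
    let e : {p : F × F | u + p.1 * κ + p.2 + (p.1 * ρ p.1 + ρ p.2) = 0} ≃
        Σ a : F, {b : F | u + a * κ + b + (a * ρ a + ρ b) = 0} :=
      { toFun := fun p => ⟨p.1.1, p.1.2, p.2⟩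
        invFun := fun s => ⟨(s.1, s.2), s.2.2⟩
        left_inv := fun p => rfl
        right_inv := fun s => rfl }
    rw [← Nat.card_coe_set_eq, Nat.card_congr e, Nat.card_sigma]
    push_cast
    exact Finset.sum_congr rfl fun a _ => by rw [Nat.card_coe_set_eq]
  rw [h2]
  simp only [h1, ncard_addRho_eq hρ, chi_add hρ u]
  rw [Finset.sum_add_distrib, ← Finset.mul_sum, gaussSum]
  simp

end CharacterSum

/-! ### Suzuki groups in coordinates -/

section Coordinates

open scoped commutatorElement

variable {F : Type u} [Field F]

/-- A quadratic form such that `X₆ = 0` cuts the quadric in a parabolic quadric. -/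
def pencilForm (κ : F) (y : Fin 6 → F) : F :=
  y 0 * y 4 + y 1 * y 3 + y 2 ^ 2 + y 2 * y 5 + κ * y 5 ^ 2

/-- The polar form of `pencilForm κ`. -/
def pencilPolar (y y' : Fin 6 → F) : F :=
  y 0 * y' 4 + y 4 * y' 0 + y 1 * y' 3 + y 3 * y' 1 + y 2 * y' 5 + y 5 * y' 2

lemma pencilPolar_comm (y y' : Fin 6 → F) : pencilPolar y y' = pencilPolar y' y := by
  simp only [pencilPolar]; ring

lemma pencilPolar_smul_left (c : F) (y y' : Fin 6 → F) :
    pencilPolar (c • y) y' = c * pencilPolar y y' := by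
  simp only [pencilPolar, Pi.smul_apply, smul_eq_mul]; ring

lemma pencilPolar_add_smul (y y' y'' : Fin 6 → F) (c : F) :
    pencilPolar y (y' + c • y'') = pencilPolar y y' + c * pencilPolar y y'' := by
  simp only [pencilPolar, Pi.smul_apply, smul_eq_mul, Pi.add_apply]; ring

variable (ρ : F →+* F)

/-- Representatives of the points of the Suzuki-Tits ovoid. -/
def titsVec : Option (F × F) → Fin 6 → F
  | none => ![0, 0, 0, 0, 1, 0]
  | some p => ![1, p.1, p.1 * ρ p.1 + ρ p.2, p.2, p.1 * p.2 + (p.1 * ρ p.1 + ρ p.2) ^ 2, 0]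

lemma titsVec_ne_zero (s : Option (F × F)) : titsVec ρ s ≠ 0 := by
  intro h
  cases s with
  | none => simpa [titsVec] using congrFun h 4
  | some p => simpa [titsVec] using congrFun h 0

lemma titsVec_five (s : Option (F × F)) : titsVec ρ s 5 = 0 := by
  cases s <;> simp [titsVec]

lemma eq_of_titsVec_eq_smul {s s' : Option (F × F)} {c : F} 
    (h : titsVec ρ s = c • titsVec ρ s') : s = s' := by
  have h0 := congrFun h 0
  have h1 := congrFun h 1
  have h3 := congrFun h 3
  have h4 := congrFun h 4
  cases s with
  | none =>
    cases s' with
    | none => rfl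
    | some p' => 
      simp [titsVec] at h0 h4
      simp [← h0] at h4
  | some p =>
    cases s' with
    | none => simp [titsVec] at h0
    | some p' =>
      simp [titsVec] at h0 h1 h3
      rw [← h0] at h1 h3
      simp only [one_mul] at h1 h3
      rw [Prod.ext h1 h3]

/-- A unipotent element. -/
def tauMap (a b : F) : (Fin 6 → F) →ₗ[F] (Fin 6 → F) where
  toFun y := ![y 0, y 1 + a * y 0, y 2 + ρ a * y 1 + (a * ρ a + ρ b) * y 0,
    y 3 + ρ a ^ 2 * y 1 + b * y 0 + ρ a * y 5,
    y 4 + a * y 3 + (b + a * ρ a ^ 2) * y 1 + (a * b + a ^ 2 * ρ a ^ 2 + ρ b ^ 2) * y 0 + ρ b * y 5,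
    y 5]
  map_add' y y' := by ext i; fin_cases i <;> simp <;> ring
  map_smul' c y := by ext i; fin_cases i <;> simp <;> ring

/-- An element of the torus. -/
def torMap (l : F) : (Fin 6 → F) →ₗ[F] (Fin 6 → F) where
  toFun y := ![y 0 * (l * ρ l ^ 2)⁻¹, y 1 * l⁻¹, y 2, y 3 * l, y 4 * (l * ρ l ^ 2), y 5]
  map_add' y y' := by ext i; fin_cases i <;> simp <;> ring
  map_smul' c y := by ext i; fin_cases i <;> simp <;> ring

/-- An involution interchanging two points of the ovoid. -/
def revMap : (Fin 6 → F) →ₗ[F] (Fin 6 → F) where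
  toFun y := ![y 4, y 3, y 2, y 1, y 0, y 5]
  map_add' y y' := by ext i; fin_cases i <;> simp
  map_smul' c y := by ext i; fin_cases i <;> simp

variable {ρ}

/-- The element `torMap` as a linear equivalence. -/
def tor {l : F} (hl : l ≠ 0) : (Fin 6 → F) ≃ₗ[F] (Fin 6 → F) :=
  LinearEquiv.ofLinearMap (torMap ρ l) (torMap ρ l⁻¹)
    (by
      refine LinearMap.ext fun y => ?_
      have := (map_ne_zero ρ).2 hl
      ext i
      fin_cases i <;> simp [torMap] <;> field_simp)
    (by
      refine LinearMap.ext fun y => ?_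
      have := (map_ne_zero ρ).2 hl
      ext i
      fin_cases i <;> simp [torMap] <;> field_simp)

/-- The element `revMap` as a linear equivalence. -/
def rev : (Fin 6 → F) ≃ₗ[F] (Fin 6 → F) :=
  LinearEquiv.ofLinearMap revMap revMap
    (by
      refine LinearMap.ext fun y => ?_
      ext i
      fin_cases i <;> simp [revMap])
    (by
      refine LinearMap.ext fun y => ?_
      ext i
      fin_cases i <;> simp [revMap])

lemma tor_apply {l : F} (hl : l ≠ 0) (y : Fin 6 → F) : tor (ρ := ρ) hl y = 
    ![y 0 * (l * ρ l ^ 2)⁻¹, y 1 * l⁻¹, y 2, y 3 * l, y 4 * (l * ρ l ^ 2), y 5] := rfl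

lemma rev_apply (y : Fin 6 → F) : rev y = ![y 4, y 3, y 2, y 1, y 0, y 5] := rfl

lemma rev_inv : (rev : (Fin 6 → F) ≃ₗ[F] (Fin 6 → F))⁻¹ = rev := rfl

lemma rev_rev (y : Fin 6 → F) : rev (rev y) = y := rev.apply_symm_apply y

lemma tor_inv {l : F} (hl : l ≠ 0) : 
    (tor (ρ := ρ) hl)⁻¹ = tor (ρ := ρ) (inv_ne_zero hl) := by
  refine LinearEquiv.ext fun y => ?_
  rfl

/-- With N the fifth coordinate of the vector, the reversal sends the parameters (x, y) to (y/N,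
x/N) and the vector to N times the new one. The zero pair and the point at infinity are exchanged.
-/
lemma rev_titsVec (h0 : ∀ p : F × F, p ≠ 0 → p.1 * p.2 + (p.1 * ρ p.1 + ρ p.2) ^ 2 ≠ 0)
    (hmul : ∀ x y : F, (x * ρ x + ρ y) * ρ (x * y + (x * ρ x + ρ y) ^ 2) =
      y * ρ y + ρ x * (x * y + (x * ρ x + ρ y) ^ 2)) (s : Option (F × F)) :
    ∃ s', ∃ c : F, c ≠ 0 ∧ rev (titsVec ρ s) = c • titsVec ρ s' := by
  have hnone : rev (titsVec ρ none) = titsVec ρ (some 0) := by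
    rw [rev_apply]
    ext i
    fin_cases i <;> simp [titsVec]
  cases s with
  | none => exact ⟨some 0, 1, one_ne_zero, by rw [hnone, one_smul]⟩
  | some p =>
    by_cases hp : p = 0
    · exact ⟨none, 1, one_ne_zero, by rw [hp, ← hnone, rev_rev, one_smul]⟩
    · have hN := h0 p hp
      have hm := hmul p.1 p.2
      set N := p.1 * p.2 + (p.1 * ρ p.1 + ρ p.2) ^ 2 with hNdef
      have hN' := (map_ne_zero ρ).2 hN
      have hz : p.2 / N * ρ (p.2 / N) + ρ (p.1 / N) = (p.1 * ρ p.1 + ρ p.2) / N := by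
        rw [map_div₀, map_div₀]
        field_simp
        linear_combination -hm
      refine ⟨some (p.2 / N, p.1 / N), N, hN, ?_⟩
      rw [rev_apply]
      simp only [titsVec, hz]
      ext i
      fin_cases i <;> simp [← hNdef]
      · field_simp
      · field_simp
      · field_simp
      · field_simp
        linear_combination -hNdef

lemma pencilForm_tor (κ : F) {l : F} (hl : l ≠ 0) (y : Fin 6 → F) :
    pencilForm κ (tor (ρ := ρ) hl y) = pencilForm κ y := by
  have := (map_ne_zero ρ).2 hl
  simp [tor_apply, pencilForm]
  field_simp

lemma pencilForm_rev (κ : F) (y : Fin 6 → F) : pencilForm κ (rev y) = pencilForm κ y := by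
  simp [rev_apply, pencilForm]; ring

variable [CharP F 2]

lemma pencilForm_add (κ : F) (y y' : Fin 6 → F) :
    pencilForm κ (y + y') = pencilForm κ y + pencilForm κ y' + pencilPolar y y' := by
  simp only [pencilForm, pencilPolar, Pi.add_apply]
  linear_combination (y 2 * y' 2 + κ * y 5 * y' 5) * CharTwo.two_eq_zero (R := F)

lemma pencilForm_smul (κ c : F) (y : Fin 6 → F) :
    pencilForm κ (c • y) = c ^ 2 * pencilForm κ y := by
  simp only [pencilForm, Pi.smul_apply, smul_eq_mul]; ring

/-- Substituting y = t x ρ(x)² turns the left side into x²ρ(x)²(t + 1 + ρ(t)²). From ρ(t)² = t + 1,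
a second application gives t² = t, and neither t = 0 nor t = 1 is a solution. -/
lemma mul_add_sq_eq_zero_iff (hρ : ∀ a, ρ (ρ a) ^ 2 = a) {p : F × F} : 
    p.1 * p.2 + (p.1 * ρ p.1 + ρ p.2) ^ 2 = 0 ↔ p = 0 := by
  obtain ⟨x, y⟩ := p
  constructor
  swap
  · intro h; simp [Prod.ext_iff] at h; simp [h]
  simp only
  intro h
  by_cases hx : x = 0
  · subst hx
    have : y = 0 := by simpa using h
    simp [this]
  · exfalso
    have hx1 := rho_ne_zero (ρ := ρ) hx
    obtain ⟨t, rfl⟩ : ∃ t, y = t * (x * ρ x ^ 2) := 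
      ⟨y / (x * ρ x ^ 2), by field_simp⟩
    have h1 := hρ x
    have h2 : x ^ 2 * ρ x ^ 2 * (t + 1 + ρ t ^ 2) = 0 := by
      rw [map_mul, map_mul, map_pow] at h
      grind
    have h3 : ρ t ^ 2 = t + 1 := by
      have : t + 1 + ρ t ^ 2 = 0 := by
        rcases mul_eq_zero.1 h2 with h3 | h3
        · exact absurd h3 (mul_ne_zero (pow_ne_zero _ hx) (pow_ne_zero _ hx1))
        · exact h3
      exact (eq_of_add_eq_zero_char_two this).symm
    have h4 : t ^ 2 = t := by
      have h5 := congrArg (fun a => ρ a ^ 2) h3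
      simp only [map_pow, map_add, map_one] at h5
      rw [hρ] at h5
      grind
    rcases eq_zero_or_one_of_sq h4 with rfl | rfl
    · simp at h3
    · rw [map_one, add_self_char_two] at h3; simp at h3

variable (hρ : ∀ a, ρ (ρ a) ^ 2 = a)

include hρ in
lemma rev_titsVec_identity (x y : F) : (x * ρ x + ρ y) * ρ (x * y + (x * ρ x + ρ y) ^ 2) =
      y * ρ y + ρ x * (x * y + (x * ρ x + ρ y) ^ 2) := by
  have h1 := hρ x
  have h2 := hρ y
  simp only [map_add, map_mul, map_pow]
  grind

include hρ in
lemma tauMap_tauMap (a b a' b' : F) (y : Fin 6 → F) :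
    tauMap ρ a b (tauMap ρ a' b' y) = tauMap ρ (a + a') (b + b' + ρ a ^ 2 * a') y := by
  have h1 := hρ a
  ext i
  fin_cases i <;> simp [tauMap, h1] <;> grind

/-- The element `tauMap` as a linear equivalence. -/
def tau (a b : F) : (Fin 6 → F) ≃ₗ[F] (Fin 6 → F) :=
  LinearEquiv.ofLinearMap (tauMap ρ a b) (tauMap ρ a (b + a * ρ a ^ 2))
    (by
      refine LinearMap.ext fun y => ?_
      rw [LinearMap.comp_apply, tauMap_tauMap hρ, LinearMap.id_apply]
      have h1 : a + a = 0 := add_self_char_two a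
      have h2 : b + (b + a * ρ a ^ 2) + ρ a ^ 2 * a = 0 := by grind
      rw [h1, h2]
      ext i
      fin_cases i <;> simp [tauMap])
    (by
      refine LinearMap.ext fun y => ?_
      rw [LinearMap.comp_apply, tauMap_tauMap hρ, LinearMap.id_apply]
      have h1 : a + a = 0 := add_self_char_two a
      have h2 : b + a * ρ a ^ 2 + b + ρ a ^ 2 * a = 0 := by grind
      rw [h1, h2]
      ext i
      fin_cases i <;> simp [tauMap])

lemma tau_apply (a b : F) (y : Fin 6 → F) : tau hρ a b y = 
  ![y 0, y 1 + a * y 0, y 2 + ρ a * y 1 + (a * ρ a + ρ b) * y 0,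
    y 3 + ρ a ^ 2 * y 1 + b * y 0 + ρ a * y 5,
    y 4 + a * y 3 + (b + a * ρ a ^ 2) * y 1 + (a * b + a ^ 2 * ρ a ^ 2 + ρ b ^ 2) * y 0 + ρ b * y 5,
    y 5] := rfl

lemma tau_mul (a b a' b' : F) : tau hρ a b * tau hρ a' b' = 
    tau hρ (a + a') (b + b' + ρ a ^ 2 * a') :=
  LinearEquiv.ext fun y => tauMap_tauMap hρ a b a' b' y

lemma tau_inv (a b : F) : (tau hρ a b)⁻¹ = tau hρ a (b + a * ρ a ^ 2) :=
  LinearEquiv.ext fun _ => rfl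

lemma tau_titsVec_some (a b : F) (p : F × F) : tau hρ a b (titsVec ρ (some p)) =
    titsVec ρ (some (a + p.1, b + p.2 + ρ a ^ 2 * p.1)) := by
  have h1 := hρ a
  rw [tau_apply]
  ext i
  fin_cases i <;> simp [titsVec, h1] <;> grind

lemma tau_titsVec_none (a b : F) : tau hρ a b (titsVec ρ none) = titsVec ρ none := by
  rw [tau_apply]
  ext i
  fin_cases i <;> simp [titsVec]

lemma pencilForm_tau (κ a b : F) (y : Fin 6 → F) :
    pencilForm κ (tau hρ a b y) = pencilForm κ y := by
  simp [tau_apply, pencilForm]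
  grind

include hρ in
lemma tor_titsVec {l : F} (hl : l ≠ 0) (s : Option (F × F)) :
    ∃ s', ∃ c : F, c ≠ 0 ∧ tor (ρ := ρ) hl (titsVec ρ s) = c • titsVec ρ s' := by
  have hl' := rho_ne_zero (ρ := ρ) hl
  have h1 := hρ l
  cases s with
  | none => 
    refine ⟨none, l * ρ l ^ 2, mul_ne_zero hl (pow_ne_zero _ hl'), ?_⟩
    rw [tor_apply]
    ext i
    fin_cases i <;> simp [titsVec]
  | some p =>
    refine ⟨some (ρ l ^ 2 * p.1, l ^ 2 * ρ l ^ 2 * p.2), (l * ρ l ^ 2)⁻¹, 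
      inv_ne_zero (mul_ne_zero hl (pow_ne_zero _ hl')), ?_⟩
    rw [tor_apply]
    ext i
    fin_cases i <;> simp [titsVec, h1] <;> field_simp

lemma tor_conj_tau {l : F} (hl : l ≠ 0) (a b : F) : 
    tor (ρ := ρ) hl * tau hρ a b * (tor (ρ := ρ) hl)⁻¹ = 
      tau hρ (ρ l ^ 2 * a) (l ^ 2 * ρ l ^ 2 * b) := by
  rw [mul_inv_eq_iff_eq_mul]
  refine LinearEquiv.ext fun y => ?_
  rw [LinearEquiv.mul_apply, LinearEquiv.mul_apply, tau_apply, tau_apply, tor_apply, tor_apply]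
  have hl' := rho_ne_zero (ρ := ρ) hl
  have h1 := hρ l
  ext i
  fin_cases i <;> simp [h1] <;> field_simp

/-- The torus scales the parameters a and b by ρ(l)² and l²ρ(l)², neither of which is 1; so the
commutator equations can be solved first for a', then for b'. -/
lemma tau_eq_commutator {l : F} (hl : l ≠ 0) (hl1 : l ≠ 1) (a b : F) : ∃ a' b' : F,
    ⁅tor (ρ := ρ) hl, tau hρ a' b'⁆ = tau hρ a b := by
  have h1 : ρ l ^ 2 + 1 ≠ 0 := by
    intro h
    have : ρ l = 1 := by
      apply sq_injective_char_two
      rw [one_pow]; exact eq_of_add_eq_zero_char_two h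
    exact hl1 ((map_eq_one_iff ρ ρ.injective).1 this)
  have h2 : l ^ 2 * ρ l ^ 2 + 1 ≠ 0 := by
    intro h
    have h3 : l * ρ l = 1 := by
      apply sq_injective_char_two
      rw [one_pow, mul_pow]; exact eq_of_add_eq_zero_char_two h
    have h4 := congrArg ρ h3
    rw [map_mul, map_one] at h4
    have h5 : ρ (ρ l) = l := by
      have := rho_ne_zero (ρ := ρ) hl
      apply mul_left_cancel₀ this
      rw [h4, mul_comm]; exact h3.symm
    have h6 := hρ l
    rw [h5] at h6
    rcases eq_zero_or_one_of_sq h6 with h | h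
    · exact hl h
    · exact hl1 h
  let a' := a / (ρ l ^ 2 + 1)
  have ha' : ρ l ^ 2 * a' + a' = a := by simp only [a']; field_simp
  let b' := (b + a' * ρ a' ^ 2 + ρ (ρ l ^ 2 * a') ^ 2 * a') / (l ^ 2 * ρ l ^ 2 + 1)
  have hb' : l ^ 2 * ρ l ^ 2 * b' + b' = b + a' * ρ a' ^ 2 + ρ (ρ l ^ 2 * a') ^ 2 * a' := by
    simp only [b']; field_simp
  refine ⟨a', b', ?_⟩
  rw [commutatorElement_def, tor_conj_tau, tau_inv, tau_mul, ha']
  congr 1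
  grind

-- The reversal inverts the torus, so the commutator is the element with parameter m⁻², and every
-- nonzero l has this form.
include hρ in
lemma tor_eq_commutator {l : F} (hl : l ≠ 0) : ∃ (m : F) (hm : m ≠ 0), 
    ⁅(rev : (Fin 6 → F) ≃ₗ[F] (Fin 6 → F)), tor (ρ := ρ) hm⁆ = tor (ρ := ρ) hl := by
  obtain ⟨m, hm⟩ : ∃ m : F, m ^ 2 = l⁻¹ := ⟨ρ (ρ l⁻¹), hρ _⟩
  have hm0 : m ≠ 0 := by
    rintro rfl
    simp at hm
    exact hl hm.symm
  have hl' : l = (m ^ 2)⁻¹ := by rw [hm, inv_inv]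
  subst hl'
  refine ⟨m, hm0, ?_⟩
  have := rho_ne_zero (ρ := ρ) hm0
  rw [commutatorElement_def, rev_inv, tor_inv]
  refine LinearEquiv.ext fun y => ?_
  simp only [LinearEquiv.mul_apply, tor_apply, rev_apply]
  ext i
  fin_cases i <;> simp <;> field_simp

end Coordinates

/-! ### Incidence counts -/

section Counting

variable {α β : Type*}

lemma sum_incidence [Fintype α] [Fintype β] (X : Set α) (R : α → β → Prop) :
    ∑ x ∈ (Set.toFinite X).toFinset, {b | R x b}.ncard = ∑ b, {x ∈ X | R x b}.ncard := by
  classical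
  have h := Finset.sum_card_bipartiteAbove_eq_sum_card_bipartiteBelow
    (s := (Set.toFinite X).toFinset) (t := Finset.univ) R
  convert h using 2 with x hx b hb
  · rw [Set.ncard_eq_toFinset_card']
    congr 1
    ext b
    simp [Finset.bipartiteAbove]
  · rw [Set.ncard_eq_toFinset_card']
    congr 1
    ext x
    simp [Finset.bipartiteBelow]

lemma ncard_mul_eq_of_incidence [Finite α] [Finite β] {X : Set α} {Y : Set β} (R : α → β → Prop) 
    {m n : ℕ} (hX : ∀ x ∈ X, {y ∈ Y | R x y}.ncard = m) (hY : ∀ y ∈ Y, {x ∈ X | R x y}.ncard = n) :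
    X.ncard * m = Y.ncard * n := by
  rw [← ncard_setOf_pairs hX, ← ncard_setOf_pairs hY, 
    ← Set.ncard_image_of_injective _ Prod.swap_injective]
  congr 1
  ext ⟨y, x⟩
  constructor
  · rintro ⟨⟨x', y'⟩, ⟨h1, h2, h3⟩, h4⟩
    obtain ⟨rfl, rfl⟩ := Prod.ext_iff.1 h4
    exact ⟨h2, h1, h3⟩
  · rintro ⟨h1, h2, h3⟩
    exact ⟨(x, y), ⟨h2, h1, h3⟩, rfl⟩

lemma sum_two_values [Fintype α] (X : Set α) (f : α → ℕ) {c d : ℤ} (hcd : c ≠ d)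
    (h : ∀ x ∈ X, (f x : ℤ) = c ∨ (f x : ℤ) = d) :
    (X.ncard : ℤ) = {x ∈ X | (f x : ℤ) = c}.ncard + {x ∈ X | (f x : ℤ) = d}.ncard ∧
    ((∑ x ∈ (Set.toFinite X).toFinset, f x : ℕ) : ℤ) =
      {x ∈ X | (f x : ℤ) = c}.ncard * c + {x ∈ X | (f x : ℤ) = d}.ncard * d := by
  classical
  have hX : (Set.toFinite X).toFinset = (Set.toFinite {x ∈ X | (f x : ℤ) = c}).toFinset ∪ 
      (Set.toFinite {x ∈ X | (f x : ℤ) = d}).toFinset := by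
    ext x
    simp only [Set.Finite.mem_toFinset, Finset.mem_union]
    constructor
    · intro hx
      rcases h x hx with h1 | h1
      · exact Or.inl ⟨hx, h1⟩
      · exact Or.inr ⟨hx, h1⟩
    · rintro (h1 | h1) <;> exact h1.1
  have hdis : Disjoint (Set.toFinite {x ∈ X | (f x : ℤ) = c}).toFinset
      (Set.toFinite {x ∈ X | (f x : ℤ) = d}).toFinset := by
    rw [Finset.disjoint_left]
    intro x h1 h2
    rw [Set.Finite.mem_toFinset] at h1 h2
    exact hcd (h1.2.symm.trans h2.2)
  constructor
  · rw [Set.ncard_eq_toFinset_card X, Set.ncard_eq_toFinset_card {x ∈ X | (f x : ℤ) = c}, 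
      Set.ncard_eq_toFinset_card {x ∈ X | (f x : ℤ) = d}, hX, Finset.card_union_of_disjoint hdis]
    push_cast; rfl
  · push_cast
    rw [hX, Finset.sum_union hdis, Finset.sum_congr rfl (g := fun _ => c), 
      Finset.sum_congr (s₁ := (Set.toFinite {x ∈ X | (f x : ℤ) = d}).toFinset) rfl 
        (g := fun _ => d), 
      Finset.sum_const, Finset.sum_const, Set.ncard_eq_toFinset_card {x ∈ X | (f x : ℤ) = c}, 
      Set.ncard_eq_toFinset_card {x ∈ X | (f x : ℤ) = d}, nsmul_eq_mul, nsmul_eq_mul]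
    · intro x hx
      rw [Set.Finite.mem_toFinset] at hx
      exact hx.2
    · intro x hx
      rw [Set.Finite.mem_toFinset] at hx
      exact hx.2

open scoped Classical in
lemma ncard_option [Finite α] (P : Option α → Prop) :
    {s | P s}.ncard = (if P none then 1 else 0) + {a | P (some a)}.ncard := by
  rw [← Set.ncard_image_of_injective {a | P (some a)} (Option.some_injective α)]
  split_ifs with h
  · rw [add_comm, ← Set.ncard_insert_of_notMem (a := none) (by simp) (Set.toFinite _)]
    congr 1
    ext s
    cases s <;> simp [h]
  · rw [zero_add]
    congr 1
    ext s
    cases s <;> simp [h]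

lemma ncard_eq_of_param {γ : Type*} [Finite γ] {Z : Set α} (f : γ → α) (hf : Function.Injective f) 
    (hZ : ∀ z, z ∈ Z ↔ ∃ c, f c = z) : Z.ncard = Nat.card γ := by
  rw [← Set.ncard_univ, ← Set.ncard_image_of_injective _ hf, Set.image_univ]
  congr 1
  ext z
  rw [hZ]; rfl

end Counting

/-! ### Transitivity of the Suzuki group and the intersection numbers -/

section Coordinates

variable {F : Type u} [Field F]

/-- The number of points of the Suzuki-Tits ovoid orthogonal to a vector. -/
noncomputable def titsCount (ρ : F →+* F) (y : Fin 6 → F) : ℕ :=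
  {s | pencilPolar (titsVec ρ s) y = 0}.ncard

/-- The points of a quadric off its hyperplane section, normalized. -/
def affineQuadric (κ : F) : Set (Fin 6 → F) := {y | pencilForm κ y = 0 ∧ y 5 = 1}

variable [CharP F 2] {ρ : F →+* F} 

/-- A group of isometries permuting the points of the Suzuki-Tits ovoid and containing the
standard generators of the Suzuki group. -/
structure ActsAsSuzuki (hρ : ∀ a, ρ (ρ a) ^ 2 = a) 
    (S : Subgroup ((Fin 6 → F) ≃ₗ[F] (Fin 6 → F))) : Prop where
  tau_mem : ∀ a b, tau hρ a b ∈ S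
  tor_mem : ∀ (l : F) (hl : l ≠ 0), tor (ρ := ρ) hl ∈ S
  rev_mem : ∀ a b, rev * tau hρ a b * rev ∈ S
  form_eq : ∀ g ∈ S, ∀ κ y, pencilForm κ (g y) = pencilForm κ y
  five_eq : ∀ g ∈ S, ∀ y, g y 5 = y 5
  count_eq : ∀ g ∈ S, ∀ y, titsCount ρ (g y) = titsCount ρ y

/-- Representatives of the orbits of the stabilizer of a point of the ovoid. -/
def orbitRep (κ u : F) : Fin 6 → F := ![0, 1, 0, κ, u, 1]

lemma pencilPolar_titsVec_none (y : Fin 6 → F) : pencilPolar (titsVec ρ none) y = y 0 := by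
  simp [pencilPolar, titsVec]

lemma pencilPolar_titsVec_some (p : F × F) (y : Fin 6 → F) : 
    pencilPolar (titsVec ρ (some p)) y = y 4 + (p.1 * p.2 + (p.1 * ρ p.1 + ρ p.2) ^ 2) * y 0 + 
      p.1 * y 3 + p.2 * y 1 + (p.1 * ρ p.1 + ρ p.2) * y 5 := by
  simp [pencilPolar, titsVec]

namespace ActsAsSuzuki

variable {hρ : ∀ a, ρ (ρ a) ^ 2 = a} {S : Subgroup ((Fin 6 → F) ≃ₗ[F] (Fin 6 → F))}
  (hS : ActsAsSuzuki hρ S)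

include hS

lemma polar_eq {g : (Fin 6 → F) ≃ₗ[F] (Fin 6 → F)} (hg : g ∈ S) (y y' : Fin 6 → F) :
    pencilPolar (g y) (g y') = pencilPolar y y' := by
  have h := pencilForm_add 0 (g y) (g y')
  rw [← map_add, hS.form_eq g hg, hS.form_eq g hg, hS.form_eq g hg, pencilForm_add] at h
  exact (add_left_cancel h).symm

lemma apply_mem {g : (Fin 6 → F) ≃ₗ[F] (Fin 6 → F)} (hg : g ∈ S) {κ : F} {y : Fin 6 → F} 
    (hy : y ∈ affineQuadric κ) : g y ∈ affineQuadric κ :=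
  ⟨by rw [hS.form_eq g hg, hy.1], by rw [hS.five_eq g hg, hy.2]⟩

/-- The unipotent elements are transitive on the affine ovoid points, and a conjugate of one under
the reversal moves the point at infinity. The reversal itself is not among the elements assumed to
be in S. -/
lemma exists_map_none (s : Option (F × F)) : 
    ∃ g ∈ S, ∃ c : F, c ≠ 0 ∧ g (titsVec ρ s) = c • titsVec ρ none := by
  have h0 : ∀ p : F × F, (tau hρ p.1 p.2)⁻¹ (titsVec ρ (some p)) = titsVec ρ (some 0) := by
    intro p
    have : tau hρ p.1 p.2 (titsVec ρ (some 0)) = titsVec ρ (some p) := by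
      rw [tau_titsVec_some]; simp
    rw [← this]
    exact (tau hρ p.1 p.2).symm_apply_apply _
  have h1 : rev (titsVec ρ none) = titsVec ρ (some 0) := by
    rw [rev_apply]
    ext i
    fin_cases i <;> simp [titsVec]
  have h2 : ∃ g ∈ S, ∃ c : F, c ≠ 0 ∧ g (titsVec ρ none) = c • titsVec ρ (some 0) := by
    have hk : (rev * tau hρ 0 1 * rev : (Fin 6 → F) ≃ₗ[F] (Fin 6 → F)) (titsVec ρ none) = rev (titsVec ρ (some (0, 1))) := by
      rw [LinearEquiv.mul_apply, LinearEquiv.mul_apply, h1, tau_titsVec_some]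
      simp
    obtain ⟨s', c, hc, hs'⟩ := rev_titsVec (fun p hp h => hp ((mul_add_sq_eq_zero_iff hρ).1 h)) 
      (rev_titsVec_identity hρ) (some ((0 : F), (1 : F)))
    cases s' with
    | none =>
      have := congrFun hs' 0
      simp [rev_apply, titsVec] at this
    | some p =>
      refine ⟨(tau hρ p.1 p.2)⁻¹ * (rev * tau hρ 0 1 * rev), 
        S.mul_mem (S.inv_mem (hS.tau_mem _ _)) (hS.rev_mem 0 1), c, hc, ?_⟩
      rw [LinearEquiv.mul_apply, hk, hs', map_smul, h0]
  cases s with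
  | none => exact ⟨1, S.one_mem, 1, one_ne_zero, by rw [one_smul]; rfl⟩
  | some p =>
    obtain ⟨g, hg, c, hc, hgc⟩ := h2
    refine ⟨g⁻¹ * (tau hρ p.1 p.2)⁻¹, S.mul_mem (S.inv_mem hg) (S.inv_mem (hS.tau_mem _ _)),
      c⁻¹, inv_ne_zero hc, ?_⟩
    rw [LinearEquiv.mul_apply, h0]
    have : titsVec ρ (some 0) = g (c⁻¹ • titsVec ρ none) := by
      rw [map_smul, hgc, smul_smul, inv_mul_cancel₀ hc, one_smul]
    rw [this]
    exact g.symm_apply_apply _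

/-- The torus scales coordinate 1 to 1, a unipotent element then removes coordinate 2, and the
quadric equation forces coordinate 3 to be κ. Coordinate 1 is nonzero by anisotropy. -/
lemma exists_orbitRep {κ : F} (hκ : ∀ x, x ^ 2 + x + κ ≠ 0) {y : Fin 6 → F} 
    (hy : y ∈ affineQuadric κ) (h0 : y 0 = 0) : ∃ g ∈ S, ∃ u, g y = orbitRep κ u := by
  have h1 : y 1 ≠ 0 := by
    intro h1
    apply hκ (y 2)
    have := hy.1
    rw [pencilForm, h0, h1, hy.2] at this
    linear_combination this
  obtain ⟨a, ha⟩ : ∃ a, ρ a = y 2 := 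
    ⟨ρ (y 2 ^ 2), rho_rho_sq hρ _⟩
  have hg : tau hρ a 0 * tor (ρ := ρ) h1 ∈ S := S.mul_mem (hS.tau_mem _ _) (hS.tor_mem _ _)
  refine ⟨_, hg, (tau hρ a 0 * tor (ρ := ρ) h1) y 4, ?_⟩
  have hy' := hS.apply_mem hg hy
  set z := (tau hρ a 0 * tor (ρ := ρ) h1) y with hz
  have z0 : z 0 = 0 := by
    rw [hz, LinearEquiv.mul_apply, tau_apply, tor_apply]; simp [h0]
  have z1 : z 1 = 1 := by
    rw [hz, LinearEquiv.mul_apply, tau_apply, tor_apply]; simp [h0, h1]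
  have z2 : z 2 = 0 := by
    rw [hz, LinearEquiv.mul_apply, tau_apply, tor_apply]; simp [h0, h1, ha]
    exact add_self_char_two _
  have z5 : z 5 = 1 := hy'.2
  have z3 : z 3 = κ := by
    have := hy'.1
    rw [pencilForm, z0, z1, z2, z5] at this
    exact eq_of_add_eq_zero_char_two (by linear_combination this)
  ext i
  fin_cases i
  exacts [z0, z1, z2, z3, rfl, z5]

variable [Fintype F]

omit hS in
lemma titsCount_orbitRep (hρ : ∀ a, ρ (ρ a) ^ 2 = a) (κ u : F) : (titsCount ρ (orbitRep κ u) : ℤ) = 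
    Fintype.card F + 1 + chi ρ u * gaussSum ρ κ := by
  rw [titsCount, ncard_option, pencilPolar_titsVec_none, if_pos (show orbitRep κ u 0 = 0 from rfl)]
  simp only [pencilPolar_titsVec_some]
  have h := ncard_solutions hρ κ u
  have h2 : {p : F × F | orbitRep κ u 4 + (p.1 * p.2 + (p.1 * ρ p.1 + ρ p.2) ^ 2) * orbitRep κ u 0 + 
      p.1 * orbitRep κ u 3 + p.2 * orbitRep κ u 1 + (p.1 * ρ p.1 + ρ p.2) * orbitRep κ u 5 = 0} =
      {p : F × F | u + p.1 * κ + p.2 + (p.1 * ρ p.1 + ρ p.2) = 0} := by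
    ext p
    simp [orbitRep]
  rw [h2]
  push_cast
  rw [h]; ring

lemma titsCount_eq_or_of_zero {r : ℤ} (hr : r ^ 2 = 2 * Fintype.card F)
    {κ : F} (hκ : ∀ x, x ^ 2 + x + κ ≠ 0) {y : Fin 6 → F}
    (hy : y ∈ affineQuadric κ) (h0 : y 0 = 0) : (titsCount ρ y : ℤ) = Fintype.card F + 1 + r ∨ 
      (titsCount ρ y : ℤ) = Fintype.card F + 1 - r := by
  obtain ⟨g, hg, u, hu⟩ := hS.exists_orbitRep hκ hy h0
  rw [← hS.count_eq g hg, hu, titsCount_orbitRep hρ]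
  have h1 := gaussSum_sq hρ hκ
  rw [← hr, sq_eq_sq_iff_eq_or_eq_neg] at h1
  rcases h1 with h1 | h1 <;> rcases chi_eq_or (ρ := ρ) u with h2 | h2 <;> rw [h1, h2]
  · exact Or.inl (by ring)
  · exact Or.inr (by ring)
  · exact Or.inr (by ring)
  · exact Or.inl (by ring)

omit [Fintype F] in
lemma exists_apply_zero {y : Fin 6 → F} (hy : titsCount ρ y ≠ 0) : ∃ g ∈ S, g y 0 = 0 := by
  obtain ⟨s, hs⟩ := Set.nonempty_of_ncard_ne_zero hy
  obtain ⟨g, hg, c, hc, hgc⟩ := hS.exists_map_none s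
  refine ⟨g, hg, ?_⟩
  have h1 := hS.polar_eq hg (titsVec ρ s) y
  rw [hgc, pencilPolar_smul_left, pencilPolar_titsVec_none, show pencilPolar (titsVec ρ s) y = 0 from hs]
    at h1
  exact (mul_eq_zero.1 h1).resolve_left hc

/-- The group is transitive on the points of a quadric with given positive `titsCount`. -/
lemma exists_apply_eq {κ : F} (hκ : ∀ x, x ^ 2 + x + κ ≠ 0) {y y' : Fin 6 → F}
    (hy : y ∈ affineQuadric κ) (hy' : y' ∈ affineQuadric κ) (h0 : titsCount ρ y ≠ 0)
    (h : titsCount ρ y = titsCount ρ y') : ∃ g ∈ S, g y = y' := by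
  have key : ∀ z ∈ affineQuadric κ, titsCount ρ z ≠ 0 → ∃ g ∈ S, ∃ u, g z = orbitRep κ u := by
    intro z hz hz0
    obtain ⟨g, hg, hg0⟩ := hS.exists_apply_zero hz0
    obtain ⟨k, hk, u, hu⟩ := hS.exists_orbitRep hκ (hS.apply_mem hg hz) hg0
    exact ⟨k * g, S.mul_mem hk hg, u, hu⟩
  obtain ⟨g, hg, u, hu⟩ := key y hy h0
  obtain ⟨g', hg', u', hu'⟩ := key y' hy' (h ▸ h0)
  have hG := gaussSum_sq hρ hκ
  have hG0 : gaussSum ρ κ ≠ 0 := by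
    intro hG0
    rw [hG0] at hG
    have : 0 < Fintype.card F := Fintype.card_pos
    omega
  -- Equal counts give equal characters because the Gauss sum is nonzero.
  have h1 : chi ρ u = chi ρ u' := by
    have h2 : (titsCount ρ (g y) : ℤ) = titsCount ρ (g' y') := by
      rw [hS.count_eq g hg, hS.count_eq g' hg', h]
    rw [hu, hu', titsCount_orbitRep hρ, titsCount_orbitRep hρ] at h2
    exact mul_right_cancel₀ hG0 (add_left_cancel h2)
  have h3 : chi ρ (u + u') = 1 := by rw [chi_add hρ, h1, chi_mul_self]
  obtain ⟨b, hb⟩ := chi_eq_one_iff.1 h3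
  rw [addRho_apply] at hb
  -- This unipotent element adds b + ρ b to u, so representatives with the same character are in one
  -- orbit.
  have h4 : tau hρ 0 b (orbitRep κ u) = orbitRep κ u' := by
    rw [tau_apply]
    ext i
    fin_cases i <;> simp [orbitRep]
    grind
  refine ⟨g'⁻¹ * (tau hρ 0 b * g), S.mul_mem (S.inv_mem hg') (S.mul_mem (hS.tau_mem _ _) hg), ?_⟩
  rw [LinearEquiv.mul_apply, LinearEquiv.mul_apply, hu, h4, ← hu']
  exact g'.symm_apply_apply y'

end ActsAsSuzuki

end Coordinates

/-! ### Sizes of the two classes on an elliptic quadric -/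

section Coordinates

variable {F : Type u} [Field F] [CharP F 2] {ρ : F →+* F} 

section Param

variable [Finite F] {κ : F}

lemma ncard_affineQuadric_zero (hκ : ∀ x, x ^ 2 + x + κ ≠ 0) :
    {y ∈ affineQuadric κ | y 0 = 0}.ncard = (Nat.card F - 1) * Nat.card F ^ 2 := by
  rw [ncard_eq_of_param (γ := Fˣ × F × F) (fun c => ![(0 : F), (c.1 : F), c.2.1, 
    (c.2.1 ^ 2 + c.2.1 + κ) / c.1, c.2.2, (1 : F)])]
  · rw [Nat.card_prod, Nat.card_prod, Nat.card_units, sq]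
  · rintro ⟨c, d, e⟩ ⟨c', d', e'⟩ h
    have h1 := congrFun h 1
    have h2 := congrFun h 2
    have h4 := congrFun h 4
    simp at h1 h2 h4
    simp [Units.ext h1, h2, h4]
  · intro y
    constructor
    · rintro ⟨⟨h1, h5⟩, h0⟩
      rw [pencilForm, h0, h5] at h1
      have hy1 : y 1 ≠ 0 := by
        intro hy1
        exact hκ (y 2) (by rw [hy1] at h1; linear_combination h1)
      refine ⟨⟨Units.mk0 (y 1) hy1, y 2, y 4⟩, ?_⟩
      ext i
      fin_cases i <;> simp [h0, h5]
      field_simp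
      grind
    · rintro ⟨⟨c, d, e⟩, rfl⟩
      have hc := c.ne_zero
      refine ⟨⟨?_, rfl⟩, rfl⟩
      simp [pencilForm]
      grind

lemma ncard_affineQuadric_zero_inter (hκ : ∀ x, x ^ 2 + x + κ ≠ 0) (p : F × F) :
    {y ∈ {y ∈ affineQuadric κ | y 0 = 0} | pencilPolar (titsVec ρ (some p)) y = 0}.ncard = 
      (Nat.card F - 1) * Nat.card F := by
  rw [ncard_eq_of_param (γ := Fˣ × F) (fun c => ![(0 : F), (c.1 : F), c.2, (c.2 ^ 2 + c.2 + κ) / c.1,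
    p.1 * ((c.2 ^ 2 + c.2 + κ) / c.1) + p.2 * c.1 + (p.1 * ρ p.1 + ρ p.2), 1])]
  · rw [Nat.card_prod, Nat.card_units]
  · rintro ⟨c, d⟩ ⟨c', d'⟩ h
    have h1 := congrFun h 1
    have h2 := congrFun h 2
    simp at h1 h2
    simp [Units.ext h1, h2]
  · intro y
    constructor
    · rintro ⟨⟨⟨h1, h5⟩, h0⟩, hp⟩
      rw [pencilPolar_titsVec_some, h0, h5] at hp
      rw [pencilForm, h0, h5] at h1
      have hy1 : y 1 ≠ 0 := by
        intro hy1
        exact hκ (y 2) (by rw [hy1] at h1; linear_combination h1)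
      have h3 : (y 2 ^ 2 + y 2 + κ) / y 1 = y 3 := by
        field_simp
        grind
      refine ⟨⟨Units.mk0 (y 1) hy1, y 2⟩, ?_⟩
      ext i
      fin_cases i <;> simp [h0, h5, h3]
      grind
    · rintro ⟨⟨c, d⟩, rfl⟩
      have hc := c.ne_zero
      refine ⟨⟨⟨?_, rfl⟩, rfl⟩, ?_⟩
      · simp [pencilForm]
        grind
      · rw [pencilPolar_titsVec_some]
        simp
        grind

/-- By anisotropy the first two coordinates are not both zero, and over each such pair there are q²
points: solve for coordinate 4 or 3. -/
lemma ncard_affineQuadric (hκ : ∀ x, x ^ 2 + x + κ ≠ 0) : 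
    (affineQuadric κ).ncard = (Nat.card F ^ 2 - 1) * Nat.card F ^ 2 := by
  have h1 : ({0}ᶜ : Set (F × F)).ncard = Nat.card F ^ 2 - 1 := by
    rw [Set.ncard_compl, Set.ncard_singleton, Nat.card_prod, sq]
  rw [← h1]
  refine ncard_of_fibers (f := fun y => (y 0, y 1)) ?_ ?_
  · rintro y ⟨h1, h5⟩ h
    obtain ⟨h2, h3⟩ := Prod.ext_iff.1 h
    simp only [Prod.fst_zero, Prod.snd_zero] at h2 h3
    rw [pencilForm, h2, h3, h5] at h1
    exact hκ (y 2) (by linear_combination h1)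
  · rintro ⟨c, d⟩ hcd
    by_cases hc : c = 0
    · subst hc
      have hd : d ≠ 0 := by rintro rfl; exact hcd rfl
      rw [ncard_eq_of_param (γ := F × F) (fun c => ![0, d, c.1, (c.1 ^ 2 + c.1 + κ) / d, c.2, 1])]
      · rw [Nat.card_prod, sq]
      · rintro ⟨e, e'⟩ ⟨f, f'⟩ h
        have h2 := congrFun h 2
        have h4 := congrFun h 4
        simp at h2 h4
        rw [h2, h4]
      · intro y
        constructor
        · rintro ⟨⟨h1, h5⟩, h⟩
          obtain ⟨h2, h3⟩ := Prod.ext_iff.1 h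
          simp only at h2 h3
          rw [pencilForm, h2, h3, h5] at h1
          refine ⟨⟨y 2, y 4⟩, ?_⟩
          ext i
          fin_cases i <;> simp [h2, h3, h5]
          field_simp
          grind
        · rintro ⟨⟨e, e'⟩, rfl⟩
          refine ⟨⟨?_, rfl⟩, rfl⟩
          simp [pencilForm]
          grind
    · rw [ncard_eq_of_param (γ := F × F) 
        (fun e => ![c, d, e.1, e.2, (d * e.2 + e.1 ^ 2 + e.1 + κ) / c, 1])]
      · rw [Nat.card_prod, sq]
      · rintro ⟨e, e'⟩ ⟨f, f'⟩ h
        have h2 := congrFun h 2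
        have h4 := congrFun h 3
        simp at h2 h4
        rw [h2, h4]
      · intro y
        constructor
        · rintro ⟨⟨h1, h5⟩, h⟩
          obtain ⟨h2, h3⟩ := Prod.ext_iff.1 h
          simp only at h2 h3
          rw [pencilForm, h2, h3, h5] at h1
          refine ⟨⟨y 2, y 3⟩, ?_⟩
          ext i
          fin_cases i <;> simp [h2, h3, h5]
          field_simp
          grind
        · rintro ⟨⟨e, e'⟩, rfl⟩
          refine ⟨⟨?_, rfl⟩, rfl⟩
          simp [pencilForm]
          grind

end Param

namespace ActsAsSuzuki

variable {hρ : ∀ a, ρ (ρ a) ^ 2 = a} {S : Subgroup ((Fin 6 → F) ≃ₗ[F] (Fin 6 → F))}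
  (hS : ActsAsSuzuki hρ S) [Fintype F]

include hS

/-- In the tangent hyperplane at the point at infinity the average of `titsCount` is q + 1, the mean
of the two possible values; so both occur equally often. -/
lemma two_mul_ncard_zero {κ : F} (hκ : ∀ x, x ^ 2 + x + κ ≠ 0) {r : ℤ}
    (hr : r ^ 2 = 2 * Fintype.card F) :
    2 * ({y ∈ {y ∈ affineQuadric κ | y 0 = 0} | (titsCount ρ y : ℤ) = 
      Fintype.card F + 1 + r}.ncard : ℤ) = (Fintype.card F : ℤ) ^ 3 - Fintype.card F ^ 2 := by
  have hq : 0 < Fintype.card F := Fintype.card_pos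
  have hr0 : r ≠ 0 := by rintro rfl; omega
  obtain ⟨h1, h2⟩ := sum_two_values {y ∈ affineQuadric κ | y 0 = 0} (titsCount ρ)
    (c := Fintype.card F + 1 + r) (d := Fintype.card F + 1 - r) (by omega)
    fun y hy => hS.titsCount_eq_or_of_zero hr hκ hy.1 hy.2
  have h3 := sum_incidence {y ∈ affineQuadric κ | y 0 = 0}
    (fun y s => pencilPolar (titsVec ρ s) y = 0)
  have h4 : {y ∈ {y ∈ affineQuadric κ | y 0 = 0} | pencilPolar (titsVec ρ none) y = 0} =
      {y ∈ affineQuadric κ | y 0 = 0} := by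
    ext y
    simp only [pencilPolar_titsVec_none, Set.mem_ofPred_eq]
    tauto
  rw [Fintype.sum_option, h4, Finset.sum_congr rfl fun p _ => ncard_affineQuadric_zero_inter hκ p,
    ncard_affineQuadric_zero hκ, Finset.sum_const, Finset.card_univ, Fintype.card_prod, smul_eq_mul] at h3
  rw [show (∑ y ∈ (Set.toFinite {y ∈ affineQuadric κ | y 0 = 0}).toFinset, titsCount ρ y) = _ 
    from h3] at h2
  rw [ncard_affineQuadric_zero hκ] at h1
  rw [Nat.card_eq_fintype_card] at h1 h2
  push_cast [Nat.cast_sub hq] at h1 h2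
  set a : ℤ := ({y ∈ {y ∈ affineQuadric κ | y 0 = 0} | (titsCount ρ y : ℤ) = 
    Fintype.card F + 1 + r}.ncard : ℤ)
  set b : ℤ := ({y ∈ {y ∈ affineQuadric κ | y 0 = 0} | (titsCount ρ y : ℤ) = 
    Fintype.card F + 1 - r}.ncard : ℤ)
  have h5 : a - b = 0 := by
    have : r * (a - b) = 0 := by linear_combination -h2 + (Fintype.card F + 1) * h1
    exact (mul_eq_zero.1 this).resolve_left hr0
  linear_combination h5 - h1

lemma ncard_inter_eq (κ : F) (m : ℕ) (s : Option (F × F)) :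
    {y ∈ {y ∈ affineQuadric κ | titsCount ρ y = m} | pencilPolar (titsVec ρ s) y = 0}.ncard =
      {y ∈ {y ∈ affineQuadric κ | y 0 = 0} | titsCount ρ y = m}.ncard := by
  obtain ⟨g, hg, c, hc, hgc⟩ := hS.exists_map_none s
  rw [← Set.ncard_image_of_injective _ g.injective]
  congr 1
  have hpol : ∀ y, pencilPolar (titsVec ρ s) y = c * g y 0 := fun y => by
    rw [← hS.polar_eq hg, hgc, pencilPolar_smul_left, pencilPolar_titsVec_none]
  ext y
  constructor
  · rintro ⟨z, ⟨⟨h1, h2⟩, h3⟩, rfl⟩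
    have h3 : pencilPolar (titsVec ρ s) z = 0 := h3
    rw [hpol] at h3
    exact ⟨⟨hS.apply_mem hg h1, (mul_eq_zero.1 h3).resolve_left hc⟩, by rw [hS.count_eq g hg, h2]⟩
  · rintro ⟨⟨h1, h2⟩, h3⟩
    have hy : g (g⁻¹ y) = y := g.apply_symm_apply y
    refine ⟨g⁻¹ y, ⟨⟨hS.apply_mem (S.inv_mem hg) h1, ?_⟩, ?_⟩, hy⟩
    · rw [hS.count_eq _ (S.inv_mem hg), h3]
    · rw [hpol, hy, h2, mul_zero]

/-- Double count the pairs of a point of the class and an ovoid point orthogonal to it. Every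
tangent hyperplane contains equally many points of the class, and (q + 1 + r)(q + 1 - r) = q² + 1 is
the size of the ovoid. -/
lemma two_mul_ncard {κ : F} (hκ : ∀ x, x ^ 2 + x + κ ≠ 0) {r : ℤ}
    (hr : r ^ 2 = 2 * Fintype.card F) :
    2 * ({y ∈ affineQuadric κ | (titsCount ρ y : ℤ) = Fintype.card F + 1 + r}.ncard : ℤ) =
      ((Fintype.card F : ℤ) ^ 3 - Fintype.card F ^ 2) * (Fintype.card F + 1 - r) := by
  have hq : 0 < Fintype.card F := Fintype.card_pos
  have hprod : ((Fintype.card F : ℤ) + 1 + r) * (Fintype.card F + 1 - r) = Fintype.card F ^ 2 + 1 := by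
    linear_combination -hr
  have hpos : 0 < (Fintype.card F : ℤ) + 1 + r := by
    have : 0 < (Fintype.card F : ℤ) := by exact_mod_cast hq
    nlinarith [sq_nonneg ((Fintype.card F : ℤ))]
  obtain ⟨m, hm⟩ := Int.eq_ofNat_of_zero_le hpos.le
  have h1 := ncard_mul_eq_of_incidence (X := {y ∈ affineQuadric κ | titsCount ρ y = m})
    (Y := (Set.univ : Set (Option (F × F)))) (fun y s => pencilPolar (titsVec ρ s) y = 0)
    (m := m) (n := {y ∈ {y ∈ affineQuadric κ | y 0 = 0} | titsCount ρ y = m}.ncard)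
    (fun y hy => by
      simp only [Set.mem_univ, true_and]
      exact hy.2)
    (fun s _ => hS.ncard_inter_eq κ m s)
  have h2 := hS.two_mul_ncard_zero hκ hr
  rw [Set.ncard_univ, Nat.card_eq_fintype_card, Fintype.card_option, Fintype.card_prod] at h1
  rw [hm] at h2 ⊢
  simp only [Nat.cast_inj] at h2 ⊢
  have h3 := congrArg (Nat.cast : ℕ → ℤ) h1
  push_cast at h3
  rw [← hm] at h3
  apply mul_right_cancel₀ hpos.ne'
  linear_combination 2 * h3 + (Fintype.card F ^ 2 + 1 : ℤ) * h2 - 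
    ((Fintype.card F : ℤ) ^ 3 - Fintype.card F ^ 2) * hprod

/-- The two classes already have q²(q² - 1) points together, which is the whole affine part of the
quadric. So no point is orthogonal to no ovoid point. -/
lemma titsCount_eq_or {κ : F} (hκ : ∀ x, x ^ 2 + x + κ ≠ 0) {r : ℤ}
    (hr : r ^ 2 = 2 * Fintype.card F) {y : Fin 6 → F} (hy : y ∈ affineQuadric κ) : 
    (titsCount ρ y : ℤ) = Fintype.card F + 1 + r ∨ (titsCount ρ y : ℤ) = Fintype.card F + 1 - r := by
  have hq : 0 < Fintype.card F := Fintype.card_pos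
  have hr0 : r ≠ 0 := by rintro rfl; omega
  have h1 := hS.two_mul_ncard hκ hr
  have h2 := hS.two_mul_ncard hκ (r := -r) (by rw [neg_sq]; exact hr)
  have h3 := ncard_affineQuadric hκ
  rw [Nat.card_eq_fintype_card] at h3
  have h4 : {y ∈ affineQuadric κ | (titsCount ρ y : ℤ) = Fintype.card F + 1 + r} ∪
      {y ∈ affineQuadric κ | (titsCount ρ y : ℤ) = Fintype.card F + 1 + -r} = affineQuadric κ := by
    apply Set.eq_of_subset_of_ncard_le
    · rintro y (h | h) <;> exact h.1
    · rw [Set.ncard_union_eq]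
      · have : 1 ≤ Fintype.card F ^ 2 := Nat.one_le_pow _ _ hq
        zify
        rw [h3]
        push_cast [Nat.cast_sub this]
        linarith
      · rw [Set.disjoint_left]
        rintro z ⟨-, hz⟩ ⟨-, hz'⟩
        omega
    · exact Set.toFinite _
  rw [← h4] at hy
  rcases hy with hy | hy
  · exact Or.inl hy.2
  · exact Or.inr hy.2

end ActsAsSuzuki

end Coordinates

/-! ### Tangent lines and the two classes -/

section Coordinates

variable {F : Type u} [Field F] [CharP F 2] {ρ : F →+* F} 

lemma pencilPolar_titsVec_eq_zero_iff (hρ : ∀ a, ρ (ρ a) ^ 2 = a) (s s' : Option (F × F)) :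
    pencilPolar (titsVec ρ s) (titsVec ρ s') = 0 ↔ s = s' := by
  cases s with
  | none =>
    rw [pencilPolar_titsVec_none]
    cases s' <;> simp [titsVec]
  | some p =>
    cases s' with
    | none => rw [pencilPolar_comm, pencilPolar_titsVec_none]; simp [titsVec]
    | some p' =>
      have hN := mul_add_sq_eq_zero_iff hρ (p := (p.1 + p'.1, p.2 + p'.2 + ρ p.1 ^ 2 * p.1 + ρ p.1 ^ 2 * p'.1))
      have h1 := hρ p.1
      have h2 : pencilPolar (titsVec ρ (some p)) (titsVec ρ (some p')) = 
          (p.1 + p'.1) * (p.2 + p'.2 + ρ p.1 ^ 2 * p.1 + ρ p.1 ^ 2 * p'.1) + 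
          ((p.1 + p'.1) * ρ (p.1 + p'.1) + 
            ρ (p.2 + p'.2 + ρ p.1 ^ 2 * p.1 + ρ p.1 ^ 2 * p'.1)) ^ 2 := by
        simp only [pencilPolar_titsVec_some, map_add, map_mul, map_pow, h1]
        simp [titsVec]
        grind
      rw [h2, hN, Prod.ext_iff]
      simp only [Prod.fst_zero, Prod.snd_zero, Option.some.injEq, Prod.ext_iff]
      constructor
      · rintro ⟨h3, h4⟩
        have h3 := eq_of_add_eq_zero_char_two h3
        refine ⟨h3, ?_⟩
        rw [h3] at h4
        grind
      · rintro ⟨h3, h4⟩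
        rw [h3, h4]
        constructor <;> grind

variable (ρ) in
/-- The vector `p` represents a point of the Suzuki-Tits ovoid. -/
def IsTitsVec (p : Fin 6 → F) : Prop := ∃ s, ∃ c : F, c ≠ 0 ∧ p = c • titsVec ρ s

lemma setOf_perp_titsVec (hρ : ∀ a, ρ (ρ a) ^ 2 = a) (s' : Option (F × F)) {c : F} (hc : c ≠ 0) : 
    {s | pencilPolar (titsVec ρ s) (c • titsVec ρ s') = 0} = {s'} := by
  ext s
  rw [Set.mem_ofPred_eq, pencilPolar_comm, pencilPolar_smul_left, pencilPolar_comm, mul_eq_zero,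
    or_iff_right hc, pencilPolar_titsVec_eq_zero_iff hρ, Set.mem_singleton_iff]

lemma titsCount_of_isTitsVec (hρ : ∀ a, ρ (ρ a) ^ 2 = a) {p : Fin 6 → F} (hp : IsTitsVec ρ p) :
    titsCount ρ p = 1 := by
  obtain ⟨s, c, hc, rfl⟩ := hp
  rw [titsCount, setOf_perp_titsVec hρ s hc, Set.ncard_singleton]

namespace ActsAsSuzuki

variable {hρ : ∀ a, ρ (ρ a) ^ 2 = a} {S : Subgroup ((Fin 6 → F) ≃ₗ[F] (Fin 6 → F))}
  (hS : ActsAsSuzuki hρ S)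

include hS

/-- A vector orthogonal to a vector of the ovoid can be moved to a standard position. -/
lemma exists_apply_zero_and {s : Option (F × F)} {p : Fin 6 → F} 
    (hs : pencilPolar (titsVec ρ s) p = 0) : ∃ g ∈ S, g p 0 = 0 ∧ 
      (∀ x, pencilPolar (titsVec ρ s) x = 0 → g x 0 = 0) ∧ 
      ∀ c : F, c ≠ 0 → g p = c • titsVec ρ none → IsTitsVec ρ p := by
  obtain ⟨g, hg, c, hc, hgc⟩ := hS.exists_map_none s
  have h : ∀ x, pencilPolar (titsVec ρ s) x = 0 → g x 0 = 0 := by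
    intro x hx
    have h1 := hS.polar_eq hg (titsVec ρ s) x
    rw [hgc, pencilPolar_smul_left, pencilPolar_titsVec_none, hx] at h1
    exact (mul_eq_zero.1 h1).resolve_left hc
  refine ⟨g, hg, h p hs, h, fun d hd hgp => ⟨s, d * c⁻¹, mul_ne_zero hd (inv_ne_zero hc), ?_⟩⟩
  apply g.injective
  rw [hgp, map_smul, hgc, smul_smul, mul_assoc, inv_mul_cancel₀ hc, mul_one]

/-- The ovoid vector, x and p are singular and pairwise orthogonal. An elliptic quadric has no
totally singular 3-space, so they are dependent, and p is a multiple of the ovoid vector. -/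
lemma isTitsVec_of_perp {κ : F} (hκ : ∀ x, x ^ 2 + x + κ ≠ 0) {x p : Fin 6 → F} 
    (hx : x ∈ affineQuadric κ) (hp0 : p ≠ 0) (hp5 : p 5 = 0) (hp : pencilForm κ p = 0) 
    (hxp : pencilPolar x p = 0) {s : Option (F × F)} (hsp : pencilPolar (titsVec ρ s) p = 0)
    (hsx : pencilPolar (titsVec ρ s) x = 0) : IsTitsVec ρ p := by
  obtain ⟨g, hg, h0, h1, h2⟩ := hS.exists_apply_zero_and hsp
  have hx' := hS.apply_mem hg hx
  have hx0 := h1 x hsx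
  have hp' := hS.form_eq g hg κ p
  have hp5' := hS.five_eq g hg p
  have hxp' := hS.polar_eq hg x p
  have hp0' : g p ≠ 0 := g.map_ne_zero_iff.2 hp0
  rw [hp] at hp'
  rw [hp5] at hp5'
  rw [hxp] at hxp'
  obtain ⟨hx1, hx5⟩ := hx'
  generalize g x = x' at *
  generalize hpg : g p = p' at *
  simp only [pencilForm, pencilPolar, h0, hx0, hx5, hp5', zero_mul, mul_zero, zero_add, add_zero,
    one_mul, mul_one, one_pow, ne_eq, OfNat.ofNat_ne_zero, not_false_eq_true, zero_pow] at hx1 hp' hxp'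
  have hx'1 : x' 1 ≠ 0 := by
    intro hx'1
    exact hκ (x' 2) (by rw [hx'1] at hx1; linear_combination hx1)
  by_cases hp1 : p' 1 = 0
  · have hp2 : p' 2 = 0 := by simpa [hp1] using hp'
    have hp3 : p' 3 = 0 := by simpa [hp1, hp2, hx'1] using hxp'
    have hp4 : p' 4 ≠ 0 := by
      intro hp4
      apply hp0'
      ext i
      fin_cases i <;> simp [h0, hp1, hp2, hp3, hp4, hp5']
    refine h2 (p' 4) hp4 ?_
    ext i
    fin_cases i <;> simp [titsVec, h0, hp1, hp2, hp3, hp5']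
  · exfalso
    -- Coordinate 2 of the combination of x' and p' with vanishing coordinate 1; its singularity
    -- makes it a root.
    apply hκ (p' 2 / p' 1 * x' 1 + x' 2)
    field_simp
    grind

variable [Fintype F]

/-- If some ovoid point is orthogonal to p, move it to infinity. The remaining condition on the
parameters (a, b) is a single linear equation with q solutions, nontrivial because p is not on the
ovoid. -/
lemma titsCount_of_singular {p : Fin 6 → F} 
    (hp0 : p ≠ 0) (hp5 : p 5 = 0) (hp : pencilForm 0 p = 0) (hT : ¬ IsTitsVec ρ p) :
    titsCount ρ p = 0 ∨ titsCount ρ p = Fintype.card F + 1 := by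
  by_cases h : titsCount ρ p = 0
  · exact Or.inl h
  right
  obtain ⟨s, hs⟩ := Set.nonempty_of_ncard_ne_zero h
  obtain ⟨g, hg, h0, -, h2⟩ := hS.exists_apply_zero_and hs
  rw [← hS.count_eq g hg]
  have hp' := hS.form_eq g hg 0 p
  have hp5' := hS.five_eq g hg p
  have hp0' : g p ≠ 0 := g.map_ne_zero_iff.2 hp0
  rw [hp] at hp'
  rw [hp5] at hp5'
  generalize g p = p' at *
  simp only [pencilForm, h0, hp5', zero_mul, mul_zero, zero_add, add_zero, ne_eq, OfNat.ofNat_ne_zero,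
    not_false_eq_true, zero_pow] at hp'
  rw [titsCount, ncard_option, pencilPolar_titsVec_none, if_pos h0, add_comm]
  congr 1
  simp only [pencilPolar_titsVec_some, h0, hp5', mul_zero, add_zero]
  rw [← Nat.card_eq_fintype_card]
  by_cases hp1 : p' 1 = 0
  · have hp2 : p' 2 = 0 := by simpa [hp1] using hp'
    have hp3 : p' 3 ≠ 0 := by
      intro hp3
      have hp4 : p' 4 ≠ 0 := by
        intro hp4
        apply hp0'
        ext i
        fin_cases i <;> simp [h0, hp1, hp2, hp3, hp4, hp5']
      apply hT
      refine h2 (p' 4) hp4 ?_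
      ext i
      fin_cases i <;> simp [titsVec, h0, hp1, hp2, hp3, hp5']
    refine ncard_eq_of_param (fun b : F => (p' 4 / p' 3, b)) (fun b b' h => (Prod.ext_iff.1 h).2) ?_
    rintro ⟨a, b⟩
    rw [Set.mem_ofPred_eq, hp1, mul_zero, add_zero]
    constructor
    · intro h
      refine ⟨b, Prod.ext ?_ rfl⟩
      simp only
      field_simp
      grind
    · rintro ⟨b', h⟩
      obtain ⟨rfl, -⟩ := Prod.ext_iff.1 h
      simp only
      field_simp
      grind
  · refine ncard_eq_of_param (fun a : F => (a, (p' 4 + a * p' 3) / p' 1)) 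
      (fun b b' h => (Prod.ext_iff.1 h).1) ?_
    rintro ⟨a, b⟩
    rw [Set.mem_ofPred_eq]
    constructor
    · intro h
      refine ⟨a, Prod.ext rfl ?_⟩
      simp only
      field_simp
      grind
    · rintro ⟨b', h⟩
      obtain ⟨rfl, rfl⟩ := Prod.ext_iff.1 h
      simp only
      field_simp
      grind

-- Each ovoid vector is orthogonal to exactly one x + t p if it is not orthogonal to p, to all q of
-- them if it is orthogonal to both x and p, and to none otherwise.
omit hS in
lemma sum_titsCount_line (ρ : F →+* F) (x p : Fin 6 → F) : 
    ((∑ t : F, titsCount ρ (x + t • p) : ℕ) : ℤ) = Fintype.card F ^ 2 + 1 - titsCount ρ p + 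
      Fintype.card F * 
        {s | pencilPolar (titsVec ρ s) p = 0 ∧ pencilPolar (titsVec ρ s) x = 0}.ncard := by
  classical
  have h1 := sum_incidence (Set.univ : Set F) 
    (fun t s => pencilPolar (titsVec ρ s) (x + t • p) = 0)
  have h2 : (∑ t : F, titsCount ρ (x + t • p)) = 
      ∑ s, {t : F | pencilPolar (titsVec ρ s) (x + t • p) = 0}.ncard := by
    simpa [-Fintype.sum_option, titsCount] using h1
  have h3 : ∀ s, ({t : F | pencilPolar (titsVec ρ s) (x + t • p) = 0}.ncard : ℤ) = 
      1 - (if pencilPolar (titsVec ρ s) p = 0 then 1 else 0) + Fintype.card F * 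
        (if pencilPolar (titsVec ρ s) p = 0 ∧ pencilPolar (titsVec ρ s) x = 0 then 1 else 0) := by
    intro s
    simp only [pencilPolar_add_smul]
    by_cases hp : pencilPolar (titsVec ρ s) p = 0
    · by_cases hx : pencilPolar (titsVec ρ s) x = 0
      · simp [hp, hx, Set.ncard_univ]
      · simp [hp, hx]
    · have : {t : F | pencilPolar (titsVec ρ s) x + t * pencilPolar (titsVec ρ s) p = 0} =
          {-pencilPolar (titsVec ρ s) x / pencilPolar (titsVec ρ s) p} := by
        ext t
        rw [Set.mem_ofPred_eq, Set.mem_singleton_iff, eq_div_iff hp]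
        constructor <;> intro h <;> linear_combination h
      simp [hp, this]
  rw [h2]
  push_cast
  simp only [h3]
  rw [Finset.sum_add_distrib, Finset.sum_sub_distrib, ← Finset.mul_sum, Finset.sum_boole,
    Finset.sum_boole, titsCount, Set.ncard_eq_toFinset_card', Set.ncard_eq_toFinset_card']
  simp [Fintype.card_option, sq]

open scoped Classical in
variable (ρ) in
omit hS in
/-- The amount by which `titsCount` deviates from its mean value on a tangent line at `p`. -/
noncomputable def lineDefect (p : Fin 6 → F) : ℤ :=
  if IsTitsVec ρ p then 0 else 1 - titsCount ρ p - Fintype.card F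

/-- The class sizes on the affine part of the line are determined by their total q and by the sum of
`titsCount`. No ovoid point is orthogonal to both x and p unless p is on the ovoid, and then only p
itself; so the sum depends on p alone and not on the quadric. -/
lemma line_counts {κ : F} (hκ : ∀ x, x ^ 2 + x + κ ≠ 0) {r : ℤ}
    (hr : r ^ 2 = 2 * Fintype.card F) {x p : Fin 6 → F} 
    (hx : x ∈ affineQuadric κ) (hp0 : p ≠ 0) (hp5 : p 5 = 0) (hp : pencilForm κ p = 0) 
    (hxp : pencilPolar x p = 0) :
    ({t : F | (titsCount ρ (x + t • p) : ℤ) = Fintype.card F + 1 + r}.ncard : ℤ) + 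
      {t : F | (titsCount ρ (x + t • p) : ℤ) = Fintype.card F + 1 - r}.ncard = Fintype.card F ∧
    r * (({t : F | (titsCount ρ (x + t • p) : ℤ) = Fintype.card F + 1 + r}.ncard : ℤ) - 
      {t : F | (titsCount ρ (x + t • p) : ℤ) = Fintype.card F + 1 - r}.ncard) = lineDefect ρ p := by
  have hq : 0 < Fintype.card F := Fintype.card_pos
  have hr0 : r ≠ 0 := by rintro rfl; omega
  have hmem : ∀ t : F, x + t • p ∈ affineQuadric κ := by
    intro t
    refine ⟨?_, ?_⟩
    · rw [pencilForm_add, pencilForm_smul, hp, hx.1, pencilPolar_comm, pencilPolar_smul_left, 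
        pencilPolar_comm, hxp]
      simp
    · simp [hp5, hx.2]
  obtain ⟨h1, h2⟩ := sum_two_values (Set.univ : Set F) (fun t => titsCount ρ (x + t • p))
    (c := Fintype.card F + 1 + r) (d := Fintype.card F + 1 - r) (by omega)
    fun t _ => hS.titsCount_eq_or hκ hr (hmem t)
  simp only [Set.mem_univ, true_and, Set.ncard_univ, Set.Finite.toFinset_univ, 
    Nat.card_eq_fintype_card] at h1 h2
  rw [sum_titsCount_line] at h2
  refine ⟨h1.symm, ?_⟩
  rw [lineDefect]
  split_ifs with hT
  · have h3 := titsCount_of_isTitsVec hρ hT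
    have h4 : {s | pencilPolar (titsVec ρ s) p = 0 ∧ pencilPolar (titsVec ρ s) x = 0}.ncard = 1 := by
      obtain ⟨s, c, hc, rfl⟩ := hT
      rw [← Set.ncard_singleton s, ← setOf_perp_titsVec hρ s hc]
      congr 1
      ext s'
      constructor
      · exact fun h => h.1
      · intro h
        refine ⟨h, ?_⟩
        have h5 : s' ∈ ({s} : Set (Option (F × F))) := by rw [← setOf_perp_titsVec hρ s hc]; exact h
        obtain rfl : s' = s := h5
        rw [pencilPolar_comm, pencilPolar_smul_left, pencilPolar_comm] at hxp
        rw [pencilPolar_comm]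
        exact (mul_eq_zero.1 hxp).resolve_left hc
    rw [h3, h4] at h2
    push_cast at h2
    linear_combination -h2 + (Fintype.card F + 1 : ℤ) * h1
  · have h4 : {s | pencilPolar (titsVec ρ s) p = 0 ∧ pencilPolar (titsVec ρ s) x = 0} = ∅ := by
      rw [Set.eq_empty_iff_forall_notMem]
      rintro s ⟨h5, h6⟩
      exact hT (hS.isTitsVec_of_perp hκ hx hp0 hp5 hp hxp h5 h6)
    rw [h4, Set.ncard_empty] at h2
    push_cast at h2
    linear_combination -h2 + (Fintype.card F + 1 : ℤ) * h1

/-- Neither class contains all points, off the hyperplane, of a tangent line. -/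
lemma line_count_lt {κ : F} (hκ : ∀ x, x ^ 2 + x + κ ≠ 0) {r : ℤ}
    (hr : r ^ 2 = 2 * Fintype.card F) (hr2 : r < -2 ∨ 0 < r) {x p : Fin 6 → F} 
    (hx : x ∈ affineQuadric κ) (hp0 : p ≠ 0) (hp5 : p 5 = 0) (hp : pencilForm κ p = 0) 
    (hxp : pencilPolar x p = 0) :
    ({t : F | (titsCount ρ (x + t • p) : ℤ) = Fintype.card F + 1 + r}.ncard : ℤ) < 
      Fintype.card F := by
  obtain ⟨h1, h2⟩ := hS.line_counts hκ hr hx hp0 hp5 hp hxp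
  set a : ℤ := ({t : F | (titsCount ρ (x + t • p) : ℤ) = Fintype.card F + 1 + r}.ncard : ℤ)
  set b : ℤ := ({t : F | (titsCount ρ (x + t • p) : ℤ) = Fintype.card F + 1 - r}.ncard : ℤ)
  have hb : 0 ≤ b := Int.natCast_nonneg _
  by_contra! hcon
  have hb0 : b = 0 := by omega
  have hq : 1 < (Fintype.card F : ℤ) := by exact_mod_cast Fintype.one_lt_card
  have ha : a = Fintype.card F := by omega
  rw [hb0, ha, sub_zero, lineDefect] at h2
  split_ifs at h2 with hT
  · rcases mul_eq_zero.1 h2 with h | h <;> omega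
  · have hp' : pencilForm 0 p = 0 := by
      rw [← hp]; simp [pencilForm, hp5]
    -- A full line would give rq = 1 - q or rq = -2q; the second possibility explains the exclusion
    -- of r = -2.
    rcases hS.titsCount_of_singular hp0 hp5 hp' hT with h3 | h3 <;> rw [h3] at h2 <;> 
      push_cast at h2 <;> rcases hr2 with h4 | h4 <;> nlinarith

end ActsAsSuzuki

end Coordinates

/-! ### Tangent lines in terms of isomorphism invariants -/

namespace IsBalanced

variable {F : Type u} [Field F] [CharP F 2] [Finite F]
    {Q : QuadraticForm F (Fin 6 → F)} {v : Fin 6 → F} {j k : F}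
    {A C : Set (ℙ F (Fin 6 → F))} (h : IsBalanced Q v j k A C)
include h

/-- The base is covered by its lines. -/
lemma exists_line {P : ℙ F (Fin 6 → F)} (hP : P ∈ base Q v) :
    ∃ L : Submodule F (Fin 6 → F), finrank F L = 2 ∧ P ∈ pointsOf L ∧ pointsOf L ⊆ base Q v := by
  obtain ⟨-, B, halt, hnd, hB⟩ := h.isW5
  have hB : ∀ x y, B x y = 0 ↔ QuadraticMap.polar Q x y = 0 := fun x y => (hB x y).symm
  induction P using Projectivization.ind with
  | h x hx =>
    have hv : Q v ≠ 0 := h.pencil.2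
    obtain ⟨hQx, hvx⟩ := (mk_mem_base Q v hx).1 hP
    have h2 : finrank F (Submodule.span F {v, x}) ≤ 2 := by
      have h2 := finrank_range_le_card (R := F) (b := ![v, x])
      rwa [Set.finrank, Matrix.range_cons_cons_empty, Fintype.card_fin] at h2
    have h4 : 4 ≤ finrank F (B.orthogonal (Submodule.span F {v, x})) := by
      rw [LinearMap.BilinForm.finrank_orthogonal hnd]
      simp only [finrank_fintype_fun_eq_card, Fintype.card_fin]
      omega
    obtain ⟨y, hy, hyn⟩ : ∃ y ∈ B.orthogonal (Submodule.span F {v, x}), 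
        y ∉ Submodule.span F {v, x} := by
      by_contra! hcon
      have h1 : finrank F (B.orthogonal (Submodule.span F {v, x})) ≤ 
          finrank F (Submodule.span F {v, x}) := Submodule.finrank_mono hcon
      omega
    rw [LinearMap.BilinForm.mem_orthogonal_iff] at hy
    have hvy := (hB _ _).1 (hy v (Submodule.subset_span (by simp)))
    have hxy := (hB _ _).1 (hy x (Submodule.subset_span (by simp)))
    -- A vector orthogonal to v and x becomes singular after adding a multiple of v, which keeps it
    -- orthogonal to both.
    obtain ⟨c, hc, -⟩ := existsUnique_add_sq_mul (Q y) hv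
    have hli : LinearIndependent F ![x, y + c • v] := by
      rw [LinearIndependent.pair_iff' hx]
      intro a ha
      apply hyn
      rw [mem_pair_iff]
      exact ⟨-c, a, by rw [ha]; module⟩
    refine ⟨Submodule.span F {x, y + c • v}, finrank_span_pair_eq_two hli, 
      (mk_mem_pointsOf hx).2 (Submodule.subset_span (by simp)), ?_⟩
    rw [pointsOf_subset_iff]
    intro z hz
    obtain ⟨a, b, rfl⟩ := mem_pair_iff.1 hz
    have hQy : Q (y + c • v) = 0 := by
      rw [map_add_smul, QuadraticMap.polar_comm, hvy, hc]; simp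
    have hxv : QuadraticMap.polar Q x v = 0 := by rw [QuadraticMap.polar_comm, hvx]
    rw [mem_cone_base, map_add_smul, form_smul, hQx, hQy, QuadraticMap.polar_smul_left,
      QuadraticMap.polar_add_right, QuadraticMap.polar_smul_right, hxy, hxv,
      QuadraticMap.polar_add_right, QuadraticMap.polar_smul_right, QuadraticMap.polar_smul_right,
      QuadraticMap.polar_add_right, QuadraticMap.polar_smul_right, hvx, hvy, polar_self_char_two]
    simp

/-- The contained lines are those of Q(4,q), and they cover it. Hence an isomorphism maps base to
base, and tangency to the base is an invariant notion. -/
lemma sUnion_linesIn : ⋃₀ linesIn (perpOf Q) (A ∪ C ∪ base Q v) = base Q v := by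
  apply subset_antisymm
  · apply Set.sUnion_subset
    rintro _ ⟨⟨L, h2, hL, rfl⟩, hsub⟩
    exact h.pointsOf_subset_base h2 hL hsub
  · intro P hP
    obtain ⟨L, h2, hPL, hL⟩ := h.exists_line hP
    have hL' : L ∈ {U : Submodule F (Fin 6 → F) | finrank F U = 2 ∧ pointsOf U ⊆ base Q v} := ⟨h2, hL⟩
    rw [← h.lineSpaces_eq] at hL'
    exact ⟨pointsOf L, ⟨⟨L, h2, hL'.2.1, rfl⟩, hL'.2.2⟩, hPL⟩

lemma ncard_inter_tangent {P : ℙ F (Fin 6 → F)} {L : Submodule F (Fin 6 → F)} 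
    (hL : IsTangentLine (member Q v j) Q v P L) :
    ((A ∪ C ∪ base Q v) ∩ pointsOf L).ncard = (A ∩ pointsOf L).ncard + 1 := by
  have hC : C ∩ pointsOf L = ∅ := by
    rw [Set.eq_empty_iff_forall_notMem]
    rintro R ⟨hR, hRL⟩
    induction R using Projectivization.ind with
    | h x hx =>
      exact (h.right_mem hR).2 (h.polar_eq_zero (hL.singular x ((mk_mem_pointsOf hx).1 hRL)) 
        (h.right_mem hR).1)
  rw [Set.union_inter_distrib_right, Set.union_inter_distrib_right, hC, Set.union_empty, 
    Set.ncard_union_eq, hL.inter_eq, Set.ncard_singleton]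
  exact (h.disjoint_base.mono_left Set.subset_union_left).mono Set.inter_subset_left 
    Set.inter_subset_left

lemma mem_tangentNumbers {P : ℙ F (Fin 6 → F)} {L : Submodule F (Fin 6 → F)} 
    (hL : IsTangentLine (member Q v j) Q v P L) :
    (A ∩ pointsOf L).ncard + 1 ∈ tangentNumbers (perpOf Q) (A ∪ C ∪ base Q v) := by
  refine ⟨pointsOf L, ⟨L, hL.finrank_eq, ?_, rfl⟩, ?_, h.ncard_inter_tangent hL⟩
  · intro x hx y hy
    have := QuadraticMap.map_add (member Q v j) x y
    rw [hL.singular x hx, hL.singular y hy, hL.singular _ (L.add_mem hx hy), polar_member] at this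
    change QuadraticMap.polar Q x y = 0
    simpa using this.symm
  · rw [h.sUnion_linesIn, hL.inter_eq, Set.ncard_singleton]

/-- A line meeting the base in one point and also having a point of A or C is singular for the
corresponding quadric, so it is one of its tangent lines. Otherwise only the base point is counted.
-/
lemma tangentNumbers_cases {n : ℕ} (hn : n ∈ tangentNumbers (perpOf Q) (A ∪ C ∪ base Q v)) :
    n = 1 ∨ (∃ P L, IsTangentLine (member Q v j) Q v P L ∧ n = (A ∩ pointsOf L).ncard + 1) ∨
      ∃ P L, IsTangentLine (member Q v k) Q v P L ∧ n = (C ∩ pointsOf L).ncard + 1 := by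
  obtain ⟨_, ⟨L, h2, hp, rfl⟩, h1, rfl⟩ := hn
  rw [h.sUnion_linesIn] at h1
  by_cases hA : (A ∩ pointsOf L).Nonempty ∨ (C ∩ pointsOf L).Nonempty
  · right
    have key : ∀ t : F, ∀ x ∈ L, x ≠ 0 → member Q v t x = 0 → QuadraticMap.polar Q v x ≠ 0 → 
        ∃ P, IsTangentLine (member Q v t) Q v P L := by
      intro t x hx hx0 htx hvx
      refine isTangentLine_of_mem h2 ?_ hx hvx
      obtain ⟨y, hy, hy0, hvy, hspan, hy'⟩ := finrank_inf_ker h2 (f := Q.polarBilin v) hx hvx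
      have hvy : QuadraticMap.polar Q v y = 0 := hvy
      have hQy : Q y = 0 := by
        obtain ⟨R, hR⟩ := Set.ncard_eq_one.1 h1
        have hRm : R ∈ base Q v ∩ pointsOf L := by rw [hR]; rfl
        induction R using Projectivization.ind with
        | h w hw =>
          have hw' := (mk_mem_base Q v hw).1 hRm.1
          obtain ⟨a, rfl⟩ := hy' w ((mk_mem_pointsOf hw).1 hRm.2) hw'.2
          have ha : a ≠ 0 := by rintro rfl; simp at hw
          rw [form_smul] at hw'
          exact (mul_eq_zero.1 hw'.1).resolve_left (pow_ne_zero _ ha)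
      intro z hz
      rw [← hspan, mem_pair_iff] at hz
      obtain ⟨a, b, rfl⟩ := hz
      have hpol : QuadraticMap.polar Q y x = 0 := hp y hy x hx
      rw [map_add_smul, form_smul, htx, QuadraticMap.polar_smul_left, polar_member, hpol, 
        member_apply, hQy, hvy]
      simp
    rcases hA with ⟨R, hR, hRL⟩ | ⟨R, hR, hRL⟩
    · left
      induction R using Projectivization.ind with
      | h x hx =>
        obtain ⟨P, hP⟩ := key j x ((mk_mem_pointsOf hx).1 hRL) hx (h.left_mem hR).1 (h.left_mem hR).2
        exact ⟨P, L, hP, h.ncard_inter_tangent hP⟩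
    · right
      induction R using Projectivization.ind with
      | h x hx =>
        obtain ⟨P, hP⟩ := key k x ((mk_mem_pointsOf hx).1 hRL) hx (h.right_mem hR).1 (h.right_mem hR).2
        exact ⟨P, L, hP, by rw [Set.union_comm A C, h.symm.ncard_inter_tangent hP]⟩
  · left
    push Not at hA
    rw [Set.union_inter_distrib_right, Set.union_inter_distrib_right, hA.1, hA.2,
      Set.empty_union, Set.empty_union, h1]

end IsBalanced

/-! ### Suzuki-Tits ovoids -/

section Suzuki

variable {F : Type u} [Field F] [CharP F 2]

/-- Coordinates in which a pencil and a Suzuki-Tits ovoid of its base have standard form. -/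
structure IsSuzukiFrame (Q : QuadraticForm F (Fin 6 → F)) (v : Fin 6 → F) 
    (T : Set (ℙ F (Fin 6 → F))) (ρ : F →+* F) (ψ : (Fin 6 → F) ≃ₗ[F] (Fin 6 → F)) (κ c : F) : 
    Prop where
  rho_rho : ∀ a, ρ (ρ a) ^ 2 = a
  ne_zero : c ≠ 0
  form_eq : ∀ y, Q (ψ y) = pencilForm κ y
  vertex_eq : v = ψ ![0, 0, c, 0, 0, 0]
  ovoid_eq : T = {P | ∃ s, P.submodule = F ∙ ψ (titsVec ρ s)}

/-- Take ρ(a) = a^(2^h): applied twice and squared it is the q-th power map, and its square is the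
map σ of the Tits ovoid. -/
lemma exists_rho [Fintype F] {h : ℕ} (hF : Fintype.card F = 2 ^ (2 * h + 1)) : 
    ∃ ρ : F →+* F, (∀ a, ρ (ρ a) ^ 2 = a) ∧ ∀ a, ρ a ^ 2 = a ^ (2 ^ (h + 1)) := by
  refine ⟨iterateFrobenius F 2 h, fun a => ?_, fun a => ?_⟩
  · rw [iterateFrobenius_def, iterateFrobenius_def, ← pow_mul, ← pow_mul,
      show 2 ^ h * (2 ^ h * 2) = 2 ^ (2 * h + 1) by ring, ← hF, FiniteField.pow_card]
  · rw [iterateFrobenius_def, ← pow_mul, pow_succ]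

/-- The coordinates of v^⊥ are completed by a vector z dual to the third basis vector, on which v
lies. Then κ is the value of Q at z and c is the coordinate of v. -/
lemma exists_isSuzukiFrame [Fintype F] {Q : QuadraticForm F (Fin 6 → F)} {v : Fin 6 → F}
    {T : Set (ℙ F (Fin 6 → F))} {h : ℕ} (hF : Fintype.card F = 2 ^ (2 * h + 1)) 
    (hp : IsPencil Q v) (hT : IsSuzukiTits h Q v T) : 
    ∃ ρ ψ κ c, IsSuzukiFrame Q v T ρ ψ κ c := by
  obtain ⟨e, he, hrange, hQe, hT⟩ := hT
  obtain ⟨ρ, hρ, hρ'⟩ := exists_rho hF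
  have hpol : ∀ x y, QuadraticMap.polar Q (e x) (e y) = 
      x 0 * y 4 + x 4 * y 0 + x 1 * y 3 + x 3 * y 1 := by
    intro x y
    rw [QuadraticMap.polar, ← map_add, hQe, hQe, hQe]
    simp only [Pi.add_apply]
    linear_combination (x 2 * y 2) * CharTwo.two_eq_zero (R := F)
  have hve : ∀ x, QuadraticMap.polar Q v (e x) = 0 := by
    intro x
    have : e x ∈ LinearMap.ker (Q.polarBilin v) := by rw [← hrange]; exact ⟨x, rfl⟩
    exact this
  obtain ⟨w, hw⟩ : ∃ w, e w = v := by
    have : v ∈ LinearMap.ker (Q.polarBilin v) := polar_self_char_two Q v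
    rwa [← hrange] at this
  have hwi : w 0 = 0 ∧ w 1 = 0 ∧ w 3 = 0 ∧ w 4 = 0 := by
    simp only [← hw, hpol] at hve
    refine ⟨?_, ?_, ?_, ?_⟩
    · simpa using hve ![0, 0, 0, 0, 1]
    · simpa using hve ![0, 0, 0, 1, 0]
    · simpa using hve ![0, 1, 0, 0, 0]
    · simpa using hve ![1, 0, 0, 0, 0]
  obtain ⟨hw0, hw1, hw3, hw4⟩ := hwi
  have hc : w 2 ≠ 0 := by
    intro hw2
    apply hp.2
    rw [← hw, hQe, hw0, hw1, hw2]; simp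
  have hv0 : v ≠ 0 := by rintro rfl; exact hp.2 (QuadraticMap.map_zero Q)
  obtain ⟨z', hz'⟩ : ∃ z, QuadraticMap.polar Q v z ≠ 0 := by
    by_contra! hcon; exact hv0 (hp.1 v hcon)
  let z0 := (w 2 / QuadraticMap.polar Q v z') • z'
  have hvz0 : QuadraticMap.polar Q v z0 = w 2 := by
    rw [QuadraticMap.polar_smul_right, smul_eq_mul, div_mul_cancel₀ _ hz']
  -- The correction that makes z orthogonal to the two hyperbolic pairs of v^⊥ without changing its
  -- product with v.
  let d : Fin 5 → F := ![QuadraticMap.polar Q (e ![0, 0, 0, 0, 1]) z0, 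
    QuadraticMap.polar Q (e ![0, 0, 0, 1, 0]) z0, 0, QuadraticMap.polar Q (e ![0, 1, 0, 0, 0]) z0,
    QuadraticMap.polar Q (e ![1, 0, 0, 0, 0]) z0]
  let z := z0 + e d
  have hvz : QuadraticMap.polar Q v z = w 2 := by
    rw [QuadraticMap.polar_add_right, hve, hvz0, add_zero]
  have hbasis : ∀ y : Fin 5 → F, y = y 0 • ![1, 0, 0, 0, 0] + y 1 • ![0, 1, 0, 0, 0] + 
      y 2 • ![0, 0, 1, 0, 0] + y 3 • ![0, 0, 0, 1, 0] + y 4 • ![0, 0, 0, 0, 1] := by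
    intro y
    ext i
    fin_cases i <;> simp
  have he2 : v = w 2 • e ![0, 0, 1, 0, 0] := by
    rw [← hw, ← map_smul]
    congr 1
    ext i
    fin_cases i <;> simp [hw0, hw1, hw3, hw4]
  have hez : ∀ y, QuadraticMap.polar Q (e y) z = y 2 := by
    intro y
    have h0 : QuadraticMap.polar Q (e ![1, 0, 0, 0, 0]) z = 0 := by
      rw [QuadraticMap.polar_add_right, hpol]; simp [d, add_self_char_two]
    have h1 : QuadraticMap.polar Q (e ![0, 1, 0, 0, 0]) z = 0 := by
      rw [QuadraticMap.polar_add_right, hpol]; simp [d, add_self_char_two]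
    have h3 : QuadraticMap.polar Q (e ![0, 0, 0, 1, 0]) z = 0 := by
      rw [QuadraticMap.polar_add_right, hpol]; simp [d, add_self_char_two]
    have h4 : QuadraticMap.polar Q (e ![0, 0, 0, 0, 1]) z = 0 := by
      rw [QuadraticMap.polar_add_right, hpol]; simp [d, add_self_char_two]
    have h2 : QuadraticMap.polar Q (e ![0, 0, 1, 0, 0]) z = 1 := by
      rw [he2, QuadraticMap.polar_smul_left, smul_eq_mul] at hvz
      exact mul_left_cancel₀ hc (hvz.trans (mul_one _).symm)
    conv_lhs => rw [hbasis y]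
    simp only [map_add, map_smul, QuadraticMap.polar_add_left, QuadraticMap.polar_smul_left, h0, h1,
      h2, h3, h4]
    simp
  let ψ₀ : (Fin 6 → F) →ₗ[F] (Fin 6 → F) := 
    e ∘ₗ LinearMap.funLeft F F Fin.castSucc + (LinearMap.proj 5).smulRight z
  have hψ₀ : ∀ y, ψ₀ y = e (fun i => y i.castSucc) + y 5 • z := fun y => rfl
  have hinj : Function.Injective ψ₀ := by
    rw [injective_iff_map_eq_zero]
    intro y hy
    have h5 : y 5 = 0 := by
      have h1 := congrArg (QuadraticMap.polar Q v) hy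
      rw [hψ₀, QuadraticMap.polar_add_right, hve, QuadraticMap.polar_smul_right, hvz] at h1
      simpa [hc] using h1
    rw [hψ₀, h5, zero_smul, add_zero, map_eq_zero_iff e he] at hy
    ext i
    refine Fin.lastCases h5 (fun i => congrFun hy i) i
  let ψ := LinearEquiv.ofInjectiveEndo ψ₀ hinj
  have hψ : ∀ y, ψ y = e (fun i => y i.castSucc) + y 5 • z := fun y => rfl
  have htits : ∀ s, ψ (titsVec ρ s) = e (fun i => titsVec ρ s i.castSucc) := by
    intro s
    rw [hψ, titsVec_five, zero_smul, add_zero]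
  have hnone : (fun i : Fin 5 => titsVec ρ none i.castSucc) = ![0, 0, 0, 0, 1] := by
    ext i; fin_cases i <;> rfl
  have hsome : ∀ p : F × F, (fun i : Fin 5 => titsVec ρ (some p) i.castSucc) = 
      ![1, p.1, p.1 * ρ p.1 + ρ p.2, p.2, p.1 * p.2 + (p.1 * ρ p.1 + ρ p.2) ^ 2] := by
    intro p; ext i; fin_cases i <;> rfl
  refine ⟨ρ, ψ, Q z, w 2, hρ, hc, ?_, ?_, ?_⟩
  · intro y
    rw [hψ, map_add_smul, hez, hQe]
    simp only [pencilForm]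
    simp
    ring
  · rw [← hw, hψ]
    simp only [Matrix.cons_val, zero_smul, add_zero]
    congr 1
    ext i
    fin_cases i <;> simp [hw0, hw1, hw3, hw4]
  · rw [hT]
    ext P
    constructor
    · rintro (h1 | ⟨x, y, z, hz, h1⟩)
      · exact ⟨none, by rw [h1, htits, hnone]⟩
      · have : z = x * ρ x + ρ y := by
          apply sq_injective_char_two
          rw [hz, pow_add, ← hρ', ← hρ']
          linear_combination -(x * ρ x * ρ y) * CharTwo.two_eq_zero (R := F)
        subst this
        exact ⟨some (x, y), by rw [h1, htits, hsome]⟩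
    · rintro ⟨s, hs⟩
      rw [htits] at hs
      cases s with
      | none => exact Or.inl (by rw [hs, hnone])
      | some p =>
        refine Or.inr ⟨p.1, p.2, p.1 * ρ p.1 + ρ p.2, ?_, by rw [hs, hsome]⟩
        rw [pow_add, ← hρ', ← hρ']
        linear_combination (p.1 * ρ p.1 * ρ p.2) * CharTwo.two_eq_zero (R := F)

namespace IsSuzukiFrame

variable {Q : QuadraticForm F (Fin 6 → F)} {v : Fin 6 → F} {T : Set (ℙ F (Fin 6 → F))} {ρ : F →+* F}
  {ψ : (Fin 6 → F) ≃ₗ[F] (Fin 6 → F)} {κ c : F} (h : IsSuzukiFrame Q v T ρ ψ κ c)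

include h

lemma polar_eq (y y' : Fin 6 → F) : QuadraticMap.polar Q (ψ y) (ψ y') = pencilPolar y y' := by
  rw [QuadraticMap.polar, ← map_add, h.form_eq, h.form_eq, h.form_eq, pencilForm_add]; ring

lemma polar_vertex (y : Fin 6 → F) : QuadraticMap.polar Q v (ψ y) = c * y 5 := by
  rw [h.vertex_eq, h.polar_eq]
  simp [pencilPolar]

lemma member_eq (t : F) (y : Fin 6 → F) : 
    member Q v t (ψ y) = pencilForm (κ + t * c ^ 2) y := by
  rw [member_apply, h.form_eq, h.polar_vertex, pencilForm, pencilForm]; ring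

/-- A root x would make the vectors (a, b, sx, 0, 0, s) a totally singular 3-space. -/
lemma anisotropic {t : F} (ht : IsElliptic (member Q v t)) (x : F) : 
    x ^ 2 + x + (κ + t * c ^ 2) ≠ 0 := by
  intro hx
  let f : (Fin 3 → F) →ₗ[F] (Fin 6 → F) := 
    { toFun := fun a => ![a 0, a 1, a 2 * x, 0, 0, a 2]
      map_add' := fun a b => by ext i; fin_cases i <;> simp [add_mul]
      map_smul' := fun a b => by ext i; fin_cases i <;> simp [mul_assoc] }
  have hf : ∀ a, f a = ![a 0, a 1, a 2 * x, 0, 0, a 2] := fun a => rfl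
  have hinj : Function.Injective (ψ.toLinearMap ∘ₗ f) := by
    rw [LinearMap.coe_comp]
    refine ψ.injective.comp fun a b hab => ?_
    have h0 := congrFun hab 0
    have h1 := congrFun hab 1
    have h2 := congrFun hab 5
    simp [hf] at h0 h1 h2
    ext i
    fin_cases i
    exacts [h0, h1, h2]
  have h1 := ht.2.2 (LinearMap.range (ψ.toLinearMap ∘ₗ f)) (by
    rintro _ ⟨a, rfl⟩
    rw [LinearMap.comp_apply, LinearEquiv.coe_coe, h.member_eq, hf]
    simp [pencilForm]
    linear_combination a 2 ^ 2 * hx)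
  rw [LinearMap.finrank_range_of_inj hinj] at h1
  simp at h1

end IsSuzukiFrame

end Suzuki

/-! ### The Suzuki group contains the standard generators -/

section Suzuki

open scoped commutatorElement

variable {F : Type u} [Field F] [CharP F 2]

namespace IsSuzukiFrame

variable {Q : QuadraticForm F (Fin 6 → F)} {v : Fin 6 → F} {T : Set (ℙ F (Fin 6 → F))} {ρ : F →+* F}
  {ψ : (Fin 6 → F) ≃ₗ[F] (Fin 6 → F)} {κ c : F} (h : IsSuzukiFrame Q v T ρ ψ κ c)

include h

lemma mk_mem_ovoid {y : Fin 6 → F} (hy : ψ y ≠ 0) : Projectivization.mk F (ψ y) hy ∈ T ↔ IsTitsVec ρ y := by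
  rw [h.ovoid_eq, Set.mem_ofPred_eq]
  constructor
  · rintro ⟨s, hs⟩
    have h1 : ψ y ∈ F ∙ ψ (titsVec ρ s) := by
      rw [← hs, submodule_mk]; exact Submodule.mem_span_singleton_self _
    obtain ⟨d, hd⟩ := Submodule.mem_span_singleton.1 h1
    rw [← map_smul] at hd
    have hyd := ψ.injective hd
    refine ⟨s, d, ?_, hyd.symm⟩
    rintro rfl
    rw [zero_smul] at hyd
    rw [← hyd, map_zero] at hy
    exact hy rfl
  · rintro ⟨s, d, hd, rfl⟩
    refine ⟨s, ?_⟩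
    rw [submodule_mk, map_smul]
    exact Submodule.span_singleton_smul_eq (IsUnit.mk0 d hd) _

omit h [CharP F 2] in
lemma conj_apply (g : (Fin 6 → F) ≃ₗ[F] (Fin 6 → F)) (y : Fin 6 → F) :
    MulAut.conj ψ g (ψ y) = ψ (g y) := by
  rw [MulAut.conj_apply, LinearEquiv.mul_apply, LinearEquiv.mul_apply]
  congr 2
  exact ψ.symm_apply_apply y

lemma mem_stabT_iff [Finite F] {g : (Fin 6 → F) ≃ₗ[F] (Fin 6 → F)} : 
    MulAut.conj ψ g ∈ stabT Q v T ↔ (∀ y, pencilForm κ (g y) = pencilForm κ y) ∧ 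
      g ![0, 0, c, 0, 0, 0] = ![0, 0, c, 0, 0, 0] ∧ 
      ∀ s, ∃ s', ∃ d : F, d ≠ 0 ∧ g (titsVec ρ s) = d • titsVec ρ s' := by
  have hne : ∀ s, ψ (titsVec ρ s) ≠ 0 := fun s => ψ.map_ne_zero_iff.2 (titsVec_ne_zero ρ s)
  rw [stabT, Subgroup.mem_inf, Subgroup.mem_inf, MulAction.mem_stabilizer_iff, 
    MulAction.mem_stabilizer_iff, and_assoc]
  refine and_congr ?_ (and_congr ?_ ?_)
  · change (∀ x, Q (MulAut.conj ψ g x) = Q x) ↔ _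
    constructor
    · intro h1 y
      have := h1 (ψ y)
      rwa [conj_apply, h.form_eq, h.form_eq] at this
    · intro h1 x
      obtain ⟨y, rfl⟩ := ψ.surjective x
      rw [conj_apply, h.form_eq, h.form_eq, h1]
  · rw [LinearEquiv.smul_def, h.vertex_eq, conj_apply, ψ.injective.eq_iff]
  · have hact : ∀ (y : Fin 6 → F) (hy : ψ y ≠ 0), MulAut.conj ψ g • Projectivization.mk F (ψ y) hy = 
        Projectivization.mk F (ψ (g y)) (ψ.map_ne_zero_iff.2 (g.map_ne_zero_iff.2 (ψ.map_ne_zero_iff.1 hy))) := by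
      intro y hy
      rw [smul_mk]
      congr 1
      exact conj_apply g y
    constructor
    · intro h1 s
      have h2 : Projectivization.mk F (ψ (titsVec ρ s)) (hne s) ∈ T := 
        (h.mk_mem_ovoid _).2 ⟨s, 1, one_ne_zero, (one_smul _ _).symm⟩
      have h3 : MulAut.conj ψ g • Projectivization.mk F (ψ (titsVec ρ s)) (hne s) ∈ 
          MulAut.conj ψ g • T := Set.smul_mem_smul_set h2
      rw [h1, hact, h.mk_mem_ovoid] at h3
      exact h3
    · intro h1
      -- By finiteness it is enough that g maps the ovoid into itself.
      apply Set.eq_of_subset_of_ncard_le _ (Set.ncard_smul_set _ _).ge (Set.toFinite _)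
      rintro _ ⟨P, hP, rfl⟩
      induction P using Projectivization.ind with
      | h x hx =>
        obtain ⟨y, rfl⟩ := ψ.surjective x
        obtain ⟨s, d, hd, rfl⟩ := (h.mk_mem_ovoid hx).1 hP
        obtain ⟨s', d', hd', hs'⟩ := h1 s
        change MulAut.conj ψ g • Projectivization.mk F (ψ _) hx ∈ T
        rw [hact, h.mk_mem_ovoid]
        exact ⟨s', d * d', mul_ne_zero hd hd', by rw [map_smul, hs', smul_smul]⟩

lemma conj_tau_mem [Finite F] (a b : F) : MulAut.conj ψ (tau h.rho_rho a b) ∈ stabT Q v T := by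
  rw [h.mem_stabT_iff]
  refine ⟨pencilForm_tau h.rho_rho κ a b, ?_, ?_⟩
  · rw [tau_apply]
    ext i
    fin_cases i <;> simp
  · intro s
    cases s with
    | none => exact ⟨none, 1, one_ne_zero, by rw [tau_titsVec_none, one_smul]⟩
    | some p => exact ⟨_, 1, one_ne_zero, by rw [tau_titsVec_some, one_smul]⟩

lemma conj_tor_mem [Finite F] {l : F} (hl : l ≠ 0) : 
    MulAut.conj ψ (tor (ρ := ρ) hl) ∈ stabT Q v T := by
  rw [h.mem_stabT_iff]
  refine ⟨pencilForm_tor κ hl, ?_, tor_titsVec h.rho_rho hl⟩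
  rw [tor_apply]
  ext i
  fin_cases i <;> simp

lemma conj_rev_mem [Finite F] : MulAut.conj ψ rev ∈ stabT Q v T := by
  rw [h.mem_stabT_iff]
  refine ⟨pencilForm_rev κ, ?_, rev_titsVec (fun p hp h1 => 
    hp ((mul_add_sq_eq_zero_iff h.rho_rho).1 h1)) (rev_titsVec_identity h.rho_rho)⟩
  rw [rev_apply]
  ext i
  fin_cases i <;> simp

omit h in
lemma suzuki_le : suzuki Q v T ≤ stabT Q v T := by
  rw [suzuki, Subgroup.commutator_le]
  intro g₁ h1 g₂ h2
  rw [commutatorElement_def]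
  exact mul_mem (mul_mem (mul_mem h1 h2) (inv_mem h1)) (inv_mem h2)

lemma titsCount_le [Finite F] {g : (Fin 6 → F) ≃ₗ[F] (Fin 6 → F)} 
    (hg : MulAut.conj ψ g ∈ stabT Q v T) (y : Fin 6 → F) : titsCount ρ y ≤ titsCount ρ (g y) := by
  obtain ⟨h1, -, h2⟩ := h.mem_stabT_iff.1 hg
  choose π d hd hπ using h2
  have hpol : ∀ x x', pencilPolar (g x) (g x') = pencilPolar x x' := by
    intro x x'
    have h3 := pencilForm_add κ (g x) (g x')
    rw [← map_add, h1, h1, h1, pencilForm_add] at h3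
    exact (add_left_cancel h3).symm
  refine Set.ncard_le_ncard_of_injOn π ?_ ?_ (Set.toFinite _)
  · intro s hs
    have hs : pencilPolar (titsVec ρ s) y = 0 := hs
    rw [← hpol, hπ, pencilPolar_smul_left] at hs
    exact (mul_eq_zero.1 hs).resolve_left (hd s)
  · intro s _ s' _ hss'
    apply eq_of_titsVec_eq_smul ρ (c := d s * (d s')⁻¹)
    apply g.injective
    rw [map_smul, hπ, hπ, hss', smul_smul, mul_assoc, inv_mul_cancel₀ (hd s'), mul_one]

/-- The stabilizer contains the unipotent elements, the torus and the reversal, and the required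
generators are commutators of these. Isometries fixing v preserve B(v, ·), that is the last
coordinate, and permuting the ovoid they preserve `titsCount`. -/
theorem actsAsSuzuki [Fintype F] (hF : 2 < Fintype.card F) : 
    ActsAsSuzuki h.rho_rho ((suzuki Q v T).comap (MulAut.conj ψ).toMonoidHom) := by
  -- This is where q > 2 is needed: a nontrivial torus element produces the unipotent commutators.
  obtain ⟨l, hl0, hl1⟩ : ∃ l : F, l ≠ 0 ∧ l ≠ 1 := by
    classical
    by_contra! hcon
    have h1 : (Finset.univ : Finset F) ⊆ {0, 1} := by
      intro x _
      rw [Finset.mem_insert, Finset.mem_singleton]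
      by_cases hx : x = 0
      · exact Or.inl hx
      · exact Or.inr (hcon x hx)
    have h2 := Finset.card_le_card h1
    rw [Finset.card_univ, Finset.card_pair zero_ne_one] at h2
    omega
  have hmem : ∀ g, g ∈ (suzuki Q v T).comap (MulAut.conj ψ).toMonoidHom ↔ 
      MulAut.conj ψ g ∈ suzuki Q v T := fun g => Iff.rfl
  have hcomm : ∀ g g', MulAut.conj ψ g ∈ stabT Q v T → MulAut.conj ψ g' ∈ stabT Q v T →
      MulAut.conj ψ ⁅g, g'⁆ ∈ suzuki Q v T := by
    intro g g' hg hg'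
    rw [map_commutatorElement]
    exact Subgroup.commutator_mem_commutator hg hg'
  have hstab : ∀ g, g ∈ (suzuki Q v T).comap (MulAut.conj ψ).toMonoidHom → 
      MulAut.conj ψ g ∈ stabT Q v T := fun g hg => suzuki_le hg
  have hform : ∀ g ∈ (suzuki Q v T).comap (MulAut.conj ψ).toMonoidHom, ∀ y, 
      pencilForm κ (g y) = pencilForm κ y := fun g hg => (h.mem_stabT_iff.1 (hstab g hg)).1
  have hfive : ∀ g ∈ (suzuki Q v T).comap (MulAut.conj ψ).toMonoidHom, ∀ y, g y 5 = y 5 := by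
    intro g hg y
    obtain ⟨h1, h2, -⟩ := h.mem_stabT_iff.1 (hstab g hg)
    have h3 := pencilForm_add κ (g ![0, 0, c, 0, 0, 0]) (g y)
    rw [← map_add, h1, h1, h1, pencilForm_add, h2] at h3
    have h4 := add_left_cancel h3
    simp only [pencilPolar, Matrix.cons_val, zero_mul, zero_add, add_zero] at h4
    exact (mul_left_cancel₀ h.ne_zero h4).symm
  refine ⟨fun a b => ?_, fun m hm => ?_, fun a b => ?_, fun g hg t y => ?_, hfive, fun g hg y => ?_⟩
  · obtain ⟨a', b', hab⟩ := tau_eq_commutator h.rho_rho hl0 hl1 a b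
    rw [hmem, ← hab]
    exact hcomm _ _ (h.conj_tor_mem hl0) (h.conj_tau_mem a' b')
  · obtain ⟨m', hm', hmm⟩ := tor_eq_commutator h.rho_rho hm
    rw [hmem, ← hmm]
    exact hcomm _ _ h.conj_rev_mem (h.conj_tor_mem hm')
  · obtain ⟨a', b', hab⟩ := tau_eq_commutator h.rho_rho hl0 hl1 a b
    have h1 : rev * tau h.rho_rho a b * rev = ⁅rev * tor (ρ := ρ) hl0 * rev⁻¹, 
        rev * tau h.rho_rho a' b' * rev⁻¹⁆ := by
      rw [← conjugate_commutatorElement, hab, rev_inv]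
    have h2 : ∀ g, MulAut.conj ψ g ∈ stabT Q v T → 
        MulAut.conj ψ (rev * g * rev⁻¹) ∈ stabT Q v T := by
      intro g hg
      rw [map_mul, map_mul, map_inv]
      exact mul_mem (mul_mem h.conj_rev_mem hg) (inv_mem h.conj_rev_mem)
    rw [hmem, h1]
    exact hcomm _ _ (h2 _ (h.conj_tor_mem hl0)) (h2 _ (h.conj_tau_mem a' b'))
  · have h1 := hform g hg y
    rw [pencilForm, pencilForm, hfive g hg] at h1
    rw [pencilForm, pencilForm, hfive g hg]
    linear_combination h1
  · apply le_antisymm _ (h.titsCount_le (hstab g hg) y)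
    have h1 := h.titsCount_le (hstab _ (inv_mem hg)) (g y)
    have h2 : g⁻¹ (g y) = y := g.symm_apply_apply y
    rwa [h2] at h1

end IsSuzukiFrame

end Suzuki

/-! ### Suzuki orbits on elliptic quadrics and tangent lines -/

section Suzuki

variable {F : Type u} [Field F] [CharP F 2]

namespace IsSuzukiFrame

variable {Q : QuadraticForm F (Fin 6 → F)} {v : Fin 6 → F} {T : Set (ℙ F (Fin 6 → F))} {ρ : F →+* F}
  {ψ : (Fin 6 → F) ≃ₗ[F] (Fin 6 → F)} {κ c : F} 

lemma apply_ne_zero {y : Fin 6 → F} (hy : y 5 = 1) : ψ y ≠ 0 := by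
  rw [ψ.map_ne_zero_iff]
  rintro rfl
  simp at hy

lemma eq_of_mk_eq {y z : Fin 6 → F} (hy : y 5 = 1) (hz : z 5 = 1) 
    (hyz : Projectivization.mk F (ψ y) (apply_ne_zero hy) = 
      Projectivization.mk F (ψ z) (apply_ne_zero hz)) : y = z := by
  obtain ⟨a, ha⟩ := (mk_eq_mk_iff' F _ _ _ _).1 hyz
  rw [← map_smul] at ha
  have h1 := ψ.injective ha
  have h2 := congrFun h1 5
  rw [Pi.smul_apply, hz, hy, smul_eq_mul, mul_one] at h2
  rw [← h1, h2, one_smul]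

variable (h : IsSuzukiFrame Q v T ρ ψ κ c)

include h

lemma mk_mem_diff {t : F} {y : Fin 6 → F} (hy : ψ y ≠ 0) : 
    Projectivization.mk F (ψ y) hy ∈ zeroLocus (member Q v t) \ base Q v ↔ 
      pencilForm (κ + t * c ^ 2) y = 0 ∧ y 5 ≠ 0 := by
  rw [mk_mem_zeroLocus_diff, h.member_eq, h.polar_vertex, mul_ne_zero_iff, and_iff_right h.ne_zero]

variable [Fintype F] (hF : 2 < Fintype.card F)

include hF

/-- The group preserves `titsCount` and is transitive on points of the quadric with a given nonzero
value, so orbits are level sets. -/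
lemma ncard_orbit {t : F} (ht : IsElliptic (member Q v t)) {r : ℤ} 
    (hr : r ^ 2 = 2 * Fintype.card F) {y : Fin 6 → F} 
    (hy : y ∈ affineQuadric (κ + t * c ^ 2)) : 
    (MulAction.orbit (suzuki Q v T) (Projectivization.mk F (ψ y) (apply_ne_zero hy.2))).ncard = 
      {z ∈ affineQuadric (κ + t * c ^ 2) | titsCount ρ z = titsCount ρ y}.ncard := by
  have hS := h.actsAsSuzuki hF
  have hκ := h.anisotropic ht
  symm
  have hact : ∀ (g : (Fin 6 → F) ≃ₗ[F] (Fin 6 → F)) (z : Fin 6 → F) (hz : ψ z ≠ 0), 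
      MulAut.conj ψ g • Projectivization.mk F (ψ z) hz = Projectivization.mk F (ψ (g z)) 
        (ψ.map_ne_zero_iff.2 (g.map_ne_zero_iff.2 (ψ.map_ne_zero_iff.1 hz))) := by
    intro g z hz
    rw [smul_mk]
    congr 1
    exact conj_apply g z
  refine Set.ncard_congr (fun z hz => Projectivization.mk F (ψ z) (apply_ne_zero hz.1.2)) ?_ 
    (fun z z' hz hz' => eq_of_mk_eq hz.1.2 hz'.1.2) ?_
  · intro z hz
    have h0 : titsCount ρ y ≠ 0 := by
      intro h0
      have hpos : 0 < Fintype.card F := Fintype.card_pos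
      rcases hS.titsCount_eq_or hκ hr hy with h1 | h1 <;> rw [h0] at h1 <;> push_cast at h1 <;> 
        nlinarith [sq_nonneg ((Fintype.card F : ℤ) - 1), sq_nonneg (Fintype.card F : ℤ)]
    obtain ⟨g, hg, hgy⟩ := hS.exists_apply_eq hκ hy hz.1 h0 hz.2.symm
    refine ⟨⟨MulAut.conj ψ g, hg⟩, ?_⟩
    change MulAut.conj ψ g • Projectivization.mk F (ψ y) _ = _
    rw [hact]
    congr 2
  · rintro _ ⟨⟨g, hg⟩, rfl⟩
    obtain ⟨g, rfl⟩ := (MulAut.conj ψ).surjective g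
    have hg' : g ∈ (suzuki Q v T).comap (MulAut.conj ψ).toMonoidHom := hg
    exact ⟨g y, ⟨hS.apply_mem hg' hy, hS.count_eq g hg' y⟩, (hact g y _).symm⟩

/-- The points on the orbits of a given size are those on given numbers of tangent hyperplanes
of the ovoid. -/
lemma mk_mem_suzukiOrbit {t : F} (ht : IsElliptic (member Q v t)) {r : ℤ} 
    (hr : r ^ 2 = 2 * Fintype.card F) {y : Fin 6 → F} 
    (hy : y ∈ affineQuadric (κ + t * c ^ 2)) : 
    Projectivization.mk F (ψ y) (apply_ne_zero hy.2) ∈ suzukiOrbit Q v T (member Q v t)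
      (((Fintype.card F : ℤ) ^ 3 - (Fintype.card F : ℤ) ^ 2) * ((Fintype.card F : ℤ) - r + 1)) ↔ 
      (titsCount ρ y : ℤ) = Fintype.card F + 1 + r := by
  have hS := h.actsAsSuzuki hF
  have hκ := h.anisotropic ht
  rw [suzukiOrbit, Set.mem_ofPred_eq, and_iff_right ((h.mk_mem_diff _).2 ⟨hy.1, by rw [hy.2]; simp⟩),
    h.ncard_orbit hF ht hr hy]
  have hqz : (2 : ℤ) < Fintype.card F := by exact_mod_cast hF
  have hr0 : r ≠ 0 := by rintro rfl; omega
  have hq0 : (Fintype.card F : ℤ) ^ 3 - (Fintype.card F : ℤ) ^ 2 ≠ 0 := by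
    have : (Fintype.card F : ℤ) ^ 3 - (Fintype.card F : ℤ) ^ 2 = 
      (Fintype.card F : ℤ) ^ 2 * (Fintype.card F - 1) := by ring
    rw [this]
    exact mul_ne_zero (pow_ne_zero _ (by omega)) (by omega)
  have key : ∀ s : ℤ, s ^ 2 = 2 * Fintype.card F → (titsCount ρ y : ℤ) = Fintype.card F + 1 + s →
      2 * ({z ∈ affineQuadric (κ + t * c ^ 2) | titsCount ρ z = titsCount ρ y}.ncard : ℤ) = 
        ((Fintype.card F : ℤ) ^ 3 - Fintype.card F ^ 2) * (Fintype.card F + 1 - s) := by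
    intro s hs hys
    rw [← hS.two_mul_ncard hκ hs]
    simp only [← hys, Nat.cast_inj]
  rcases hS.titsCount_eq_or hκ hr hy with h1 | h1
  · rw [key r hr h1]
    simp only [h1, iff_true]
    ring
  · rw [key (-r) (by rw [neg_sq, hr]) (by rw [h1]; ring), h1]
    constructor
    · intro h2
      have := mul_left_cancel₀ hq0 h2
      omega
    · intro h2
      omega

-- The affine points of a tangent line at p are x + t p with t in F, and they are counted by t. The
-- base point itself belongs to no set disjoint from the base.
omit hF in
lemma tangent_param {t : F} {p : Fin 6 → F} {hp : ψ p ≠ 0} {L : Submodule F (Fin 6 → F)}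
    (hL : IsTangentLine (member Q v t) Q v (Projectivization.mk F (ψ p) hp) L) : 
    p 5 = 0 ∧ (∀ s, pencilForm s p = 0) ∧ ∃ x ∈ affineQuadric (κ + t * c ^ 2), 
      pencilPolar x p = 0 ∧ ∀ A : Set (ℙ F (Fin 6 → F)), Disjoint A (base Q v) → 
        (A ∩ pointsOf L).ncard = {s : F | ψ (x + s • p) ∈ cone A}.ncard := by
  have hP : Projectivization.mk F (ψ p) hp ∈ base Q v ∩ pointsOf L := by rw [hL.inter_eq]; rfl
  have hpL : ψ p ∈ L := (mk_mem_pointsOf hp).1 hP.2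
  obtain ⟨hQp, hvp⟩ := (mk_mem_base Q v hp).1 hP.1
  rw [h.form_eq] at hQp
  rw [h.polar_vertex, mul_eq_zero, or_iff_right h.ne_zero] at hvp
  have hform : ∀ s, pencilForm s p = 0 := by
    intro s
    rw [← hQp, pencilForm, pencilForm, hvp]; ring
  obtain ⟨z, hz, hvz⟩ : ∃ z ∈ L, QuadraticMap.polar Q v z ≠ 0 := by
    by_contra! hcon
    have h1 : pointsOf L ⊆ base Q v := by
      rw [pointsOf_subset_iff]
      intro z hz
      have := hL.singular z hz
      rw [member_apply, hcon z hz] at this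
      exact mem_cone_base.2 ⟨by simpa using this, hcon z hz⟩
    have h2 := ncard_pointsOf_of_finrank_two hL.finrank_eq
    rw [← Set.inter_eq_right.2 h1, hL.inter_eq, Set.ncard_singleton] at h2
    have : 0 < Nat.card F := Nat.card_pos
    omega
  obtain ⟨y, rfl⟩ := ψ.surjective z
  rw [h.polar_vertex] at hvz
  have hy5 : y 5 ≠ 0 := right_ne_zero_of_mul hvz
  obtain ⟨x, hx5, hxL⟩ : ∃ x : Fin 6 → F, x 5 = 1 ∧ ψ x ∈ L := 
    ⟨(y 5)⁻¹ • y, by simp [hy5], by rw [map_smul]; exact L.smul_mem _ hz⟩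
  have hxform : pencilForm (κ + t * c ^ 2) x = 0 := by rw [← h.member_eq, hL.singular _ hxL]
  refine ⟨hvp, hform, x, ⟨hxform, hx5⟩, ?_, fun A hA => ?_⟩
  · have h1 := hL.singular _ (L.add_mem hxL hpL)
    rw [← map_add, h.member_eq, pencilForm_add, hxform, hform] at h1
    simpa using h1
  · have h5 : ∀ s : F, (x + s • p) 5 = 1 := fun s => by simp [hx5, hvp]
    have hli : LinearIndependent F ![ψ p, ψ x] := by
      rw [LinearIndependent.pair_iff' hp]
      intro a ha
      rw [← map_smul] at ha
      have := congrFun (ψ.injective ha) 5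
      rw [Pi.smul_apply, hvp, hx5] at this
      simp at this
    have hspan := eq_span_pair hL.finrank_eq hpL hxL hli
    symm
    refine Set.ncard_congr (fun s _ => Projectivization.mk F (ψ (x + s • p)) (apply_ne_zero (h5 s))) 
      ?_ ?_ ?_
    · intro s hs
      refine ⟨(mem_cone_of_ne _).1 hs, (mk_mem_pointsOf _).2 ?_⟩
      rw [map_add, map_smul]
      exact L.add_mem hxL (L.smul_mem _ hpL)
    · intro s s' _ _ hss
      have h1 := add_left_cancel (eq_of_mk_eq (h5 s) (h5 s') hss)
      exact smul_left_injective F (ψ.map_ne_zero_iff.1 hp) h1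
    · rintro R ⟨hRA, hRL⟩
      induction R using Projectivization.ind with
      | h z hz0 =>
        have hzL := (mk_mem_pointsOf hz0).1 hRL
        rw [← hspan, mem_pair_iff] at hzL
        obtain ⟨a, b, rfl⟩ := hzL
        have hb : b ≠ 0 := by
          rintro rfl
          apply Set.disjoint_left.1 hA hRA
          rw [mk_mem_base, zero_smul, add_zero, form_smul, QuadraticMap.polar_smul_right,
            h.form_eq, hQp, h.polar_vertex, hvp]
          simp
        have heq : Projectivization.mk F (ψ (x + (b⁻¹ * a) • p)) (apply_ne_zero (h5 _)) = 
            Projectivization.mk F (a • ψ p + b • ψ x) hz0 := by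
          rw [mk_eq_mk_iff']
          refine ⟨b⁻¹, ?_⟩
          rw [smul_add, smul_smul, smul_smul, inv_mul_cancel₀ hb, one_smul, map_add, map_smul, 
            add_comm]
        refine ⟨b⁻¹ * a, ?_, heq⟩
        rw [Set.mem_ofPred_eq, mem_cone_of_ne (apply_ne_zero (h5 _)), heq]
        exact hRA

omit h hF in
lemma suzukiOrbit_disjoint (t : F) (s : ℤ) : 
    Disjoint (suzukiOrbit Q v T (member Q v t) s) (base Q v) := by
  rw [Set.disjoint_left]
  exact fun P hP => hP.1.2

lemma ncard_suzukiOrbit_inter {t : F} (ht : IsElliptic (member Q v t)) {r : ℤ} 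
    (hr : r ^ 2 = 2 * Fintype.card F) {p : Fin 6 → F} {hp : ψ p ≠ 0} {L : Submodule F (Fin 6 → F)}
    (hL : IsTangentLine (member Q v t) Q v (Projectivization.mk F (ψ p) hp) L) : ∃ n : ℤ, 
    (((suzukiOrbit Q v T (member Q v t) (((Fintype.card F : ℤ) ^ 3 - (Fintype.card F : ℤ) ^ 2) * 
      ((Fintype.card F : ℤ) - r + 1))) ∩ pointsOf L).ncard : ℤ) + n = Fintype.card F ∧ 
    r * (((suzukiOrbit Q v T (member Q v t) (((Fintype.card F : ℤ) ^ 3 - (Fintype.card F : ℤ) ^ 2) * 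
      ((Fintype.card F : ℤ) - r + 1))) ∩ pointsOf L).ncard - n) = ActsAsSuzuki.lineDefect ρ p ∧
    (r < -2 ∨ 0 < r → (((suzukiOrbit Q v T (member Q v t) (((Fintype.card F : ℤ) ^ 3 - 
      (Fintype.card F : ℤ) ^ 2) * ((Fintype.card F : ℤ) - r + 1))) ∩ pointsOf L).ncard : ℤ) < 
        Fintype.card F) := by
  have hS := h.actsAsSuzuki hF
  have hκ := h.anisotropic ht
  obtain ⟨hp5, hform, x, hx, hxp, hA⟩ := h.tangent_param hL
  have hp0 := ψ.map_ne_zero_iff.1 hp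
  obtain ⟨h1, h2⟩ := hS.line_counts hκ hr hx hp0 hp5 (hform _) hxp
  have h3 : {s : F | ψ (x + s • p) ∈ cone (suzukiOrbit Q v T (member Q v t) 
      (((Fintype.card F : ℤ) ^ 3 - (Fintype.card F : ℤ) ^ 2) * ((Fintype.card F : ℤ) - r + 1)))} =
      {s : F | (titsCount ρ (x + s • p) : ℤ) = Fintype.card F + 1 + r} := by
    ext s
    have hmem : x + s • p ∈ affineQuadric (κ + t * c ^ 2) := by
      refine ⟨?_, by simp [hp5, hx.2]⟩
      rw [pencilForm_add, pencilForm_smul, hform, hx.1, pencilPolar_comm, pencilPolar_smul_left, 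
        pencilPolar_comm, hxp]
      simp
    rw [Set.mem_ofPred_eq, Set.mem_ofPred_eq, mem_cone_of_ne (apply_ne_zero hmem.2), 
      h.mk_mem_suzukiOrbit hF ht hr hmem]
  rw [hA _ (suzukiOrbit_disjoint t _), h3]
  exact ⟨_, h1, h2, fun hr2 => hS.line_count_lt hκ hr hr2 hx hp0 hp5 (hform _) hxp⟩

/-- The smaller orbit belongs to r and the larger one to -r. The class difference at P is the same
on both quadrics, so the excess over q/2 on one line is the deficit on the other. -/
theorem isBalanced (hpen : IsPencil Q v) {j k : F} (hjk : j ≠ k) (hj : IsElliptic (member Q v j)) 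
    (hk : IsElliptic (member Q v k)) {r : ℤ} (hr : r ^ 2 = 2 * Fintype.card F) (hr2 : 2 < r) : 
    IsBalanced Q v j k (suzukiOrbit Q v T (member Q v j) (((Fintype.card F : ℤ) ^ 3 - 
      (Fintype.card F : ℤ) ^ 2) * ((Fintype.card F : ℤ) - r + 1))) 
      (suzukiOrbit Q v T (member Q v k) (((Fintype.card F : ℤ) ^ 3 - 
      (Fintype.card F : ℤ) ^ 2) * ((Fintype.card F : ℤ) + r + 1))) := by
  have hneg : (Fintype.card F : ℤ) + r + 1 = Fintype.card F - -r + 1 := by ring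
  have hr' : (-r) ^ 2 = 2 * Fintype.card F := by rw [neg_sq, hr]
  have hP : ∀ P : ℙ F (Fin 6 → F), ∃ (p : Fin 6 → F) (hp : ψ p ≠ 0), 
      Projectivization.mk F (ψ p) hp = P := by
    intro P
    induction P using Projectivization.ind with
    | h x hx =>
      obtain ⟨p, rfl⟩ := ψ.surjective x
      exact ⟨p, hx, rfl⟩
  rw [hneg]
  refine ⟨hpen, hjk, hj, hk, fun P hP => hP.1, fun P hP => hP.1, ?_, ?_, ?_⟩
  · intro P L M hL hM
    obtain ⟨p, hp, rfl⟩ := hP P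
    obtain ⟨n, h1, h2, -⟩ := h.ncard_suzukiOrbit_inter hF hj hr hL
    obtain ⟨m, h3, h4, -⟩ := h.ncard_suzukiOrbit_inter hF hk hr' hM
    rw [Nat.card_eq_fintype_card]
    zify
    rw [← h4, neg_mul, ← mul_neg] at h2
    have := mul_left_cancel₀ (by omega) h2
    omega
  · intro P L hL
    obtain ⟨p, hp, rfl⟩ := hP P
    obtain ⟨n, -, -, h1⟩ := h.ncard_suzukiOrbit_inter hF hj hr hL
    rw [Nat.card_eq_fintype_card]
    zify
    exact h1 (by omega)
  · intro P L hL
    obtain ⟨p, hp, rfl⟩ := hP P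
    obtain ⟨n, -, -, h1⟩ := h.ncard_suzukiOrbit_inter hF hk hr' hL
    rw [Nat.card_eq_fintype_card]
    zify
    exact h1 (by omega)

/-- At a base point orthogonal to q + 1 ovoid points the defect is -2q = -r², so the two classes on
the line differ by -r. -/
lemma exists_tangentLine {t : F} (ht : IsElliptic (member Q v t)) {r : ℤ} 
    (hr : r ^ 2 = 2 * Fintype.card F) : ∃ P L, IsTangentLine (member Q v t) Q v P L ∧ 
    2 * (((suzukiOrbit Q v T (member Q v t) (((Fintype.card F : ℤ) ^ 3 - (Fintype.card F : ℤ) ^ 2) * 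
      ((Fintype.card F : ℤ) - r + 1))) ∩ pointsOf L).ncard : ℤ) = Fintype.card F - r := by
  have hS := h.actsAsSuzuki hF
  let p : Fin 6 → F := ![0, 1, 0, 0, 0, 0]
  let x : Fin 6 → F := ![1, 0, 0, 0, κ + t * c ^ 2, 1]
  have hp0 : p ≠ 0 := fun h0 => by simpa [p] using congrFun h0 1
  have hp : ψ p ≠ 0 := ψ.map_ne_zero_iff.2 hp0
  have hpform : ∀ s, pencilForm s p = 0 := fun s => by simp [p, pencilForm]
  have hpol : pencilPolar p x = 0 := by simp [pencilPolar, p, x]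
  have hxform : pencilForm (κ + t * c ^ 2) x = 0 := by
    simp [x, pencilForm]
    exact add_self_char_two _
  have hli : LinearIndependent F ![ψ p, ψ x] := by
    rw [LinearIndependent.pair_iff' hp]
    intro a ha
    rw [← map_smul] at ha
    have := congrFun (ψ.injective ha) 5
    simp [p, x] at this
  have h2 := finrank_span_pair_eq_two hli
  obtain ⟨P, hL⟩ := isTangentLine_of_mem (t := t) h2 (by
    intro z hz
    obtain ⟨a, b, rfl⟩ := mem_pair_iff.1 hz
    rw [← map_smul, ← map_smul, ← map_add, h.member_eq, pencilForm_add, pencilForm_smul, 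
      pencilForm_smul, hpform, hxform, pencilPolar_smul_left, pencilPolar_comm, 
      pencilPolar_smul_left, pencilPolar_comm, hpol]
    simp) (x := ψ x) (Submodule.subset_span (by simp)) (by
      rw [h.polar_vertex]
      simpa [x] using h.ne_zero)
  have hP : Projectivization.mk F (ψ p) hp = P := by
    have h3 : Projectivization.mk F (ψ p) hp ∈ base Q v ∩ pointsOf (Submodule.span F {ψ p, ψ x}) := by
      refine ⟨?_, (mk_mem_pointsOf hp).2 (Submodule.subset_span (by simp))⟩
      rw [mk_mem_base, h.form_eq, hpform, h.polar_vertex]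
      simp [p]
    rwa [hL.inter_eq] at h3
  subst hP
  refine ⟨_, _, hL, ?_⟩
  obtain ⟨n, h3, h4, -⟩ := h.ncard_suzukiOrbit_inter hF ht hr hL
  have hT : ¬ IsTitsVec ρ p := by
    rintro ⟨s, d, hd, hs⟩
    cases s with
    | none => simpa [p, titsVec] using congrFun hs 1
    | some y => 
      have := congrFun hs 0
      simp [p, titsVec] at this
      exact hd this.symm
  have hcount : titsCount ρ p = Fintype.card F + 1 := by
    refine (hS.titsCount_of_singular hp0 (by simp [p]) (hpform 0) hT).resolve_left ?_
    intro h0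
    rw [titsCount, Set.ncard_eq_zero] at h0
    have : (none : Option (F × F)) ∈ {s | pencilPolar (titsVec ρ s) p = 0} := by
      rw [Set.mem_ofPred_eq, pencilPolar_titsVec_none]; simp [p]
    rw [h0] at this
    exact this
  rw [ActsAsSuzuki.lineDefect, if_neg hT, hcount] at h4
  have hr0 : r ≠ 0 := by
    rintro rfl
    have : (2 : ℤ) < Fintype.card F := by exact_mod_cast hF
    omega
  have h5 := mul_left_cancel₀ hr0 (h4.trans (show _ = r * -r by push_cast; linear_combination hr))
  omega

end IsSuzukiFrame

end Suzuki

/-! ### Comparison of hemisystems with Suzuki orbits -/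

section Comparison

variable {F : Type u} [Field F] [CharP F 2] [Fintype F]

lemma IsSuzukiOvoid.exists_isBalanced {Q : QuadraticForm F (Fin 6 → F)} {v : Fin 6 → F} 
    {X : Set (ℙ F (Fin 6 → F))} (h : IsSuzukiOvoid Q v X) : ∃ j k A C, IsBalanced Q v j k A C ∧
      X = A ∪ C ∪ base Q v ∧ ∃ r : ℤ, r ^ 2 = 2 * Fintype.card F ∧ 2 < r ∧ 
      ∃ P L, IsTangentLine (member Q v j) Q v P L ∧
        2 * ((A ∩ pointsOf L).ncard : ℤ) = Fintype.card F - r := by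
  obtain ⟨hp, m, T, j, k, hm, hF, hT, hjk, hj, hk, rfl⟩ := h
  obtain ⟨ρ, ψ, κ, c, hfr⟩ := exists_isSuzukiFrame hF hp hT
  have hr : ((2 : ℤ) ^ (m + 1)) ^ 2 = 2 * Fintype.card F := by
    rw [hF]; push_cast; ring
  have hr2 : (2 : ℤ) < 2 ^ (m + 1) := by
    calc (2 : ℤ) = 2 ^ 1 := by norm_num
      _ < 2 ^ (m + 1) := pow_lt_pow_right₀ (by norm_num) (by omega)
  have hF2 : 2 < Fintype.card F := by
    rw [hF]
    calc 2 = 2 ^ 1 := by norm_num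
      _ < 2 ^ (2 * m + 1) := Nat.pow_lt_pow_right (by norm_num) (by omega)
  exact ⟨j, k, _, _, hfr.isBalanced hF2 hp hjk hj hk hr hr2, rfl, _, hr, hr2, 
    hfr.exists_tangentLine hF2 hj hr⟩

/-- The invariant `tangentNumbers` takes only the values 1 and q/2 + 1 on the hemisystem side, but
contains (q - r)/2 + 1 with r² = 2q on the Suzuki side. -/
theorem not_isomorphic_hemisystem_suzuki {Q Q' : QuadraticForm F (Fin 6 → F)} {v v' : Fin 6 → F} 
    {X X' : Set (ℙ F (Fin 6 → F))} (h : IsHemisystemOvoid Q v X) (h' : IsSuzukiOvoid Q' v' X') :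
    ¬ Isomorphic (perpOf Q) X (perpOf Q') X' := by
  intro hiso
  obtain ⟨j, k, A, C, hb, rfl, hA, hC⟩ := h.exists_isBalanced
  obtain ⟨j', k', A', C', hb', rfl, r, hr, hr2, P, L, hL, hn⟩ := h'.exists_isBalanced
  have h1 := hb'.mem_tangentNumbers hL
  rw [← hiso.tangentNumbers_eq] at h1
  rcases hb.tangentNumbers_cases h1 with h2 | ⟨P₁, M, hM, h2⟩ | ⟨P₁, M, hM, h2⟩
  -- The value 1 would mean q = r, hence r² = 2r, against r > 2.
  · have h3 : (Fintype.card F : ℤ) = r := by omega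
    rw [h3] at hr
    nlinarith
  · have h3 := hA P₁ M hM
    rw [Nat.card_eq_fintype_card] at h3
    omega
  · have h3 := hC P₁ M hM
    rw [Nat.card_eq_fintype_card] at h3
    omega

end Comparison

end OvoidW5

/-! ### The main theorem -/

open OvoidW5
theorem mainTheorem4 {F : Type*} [Field F] [Fintype F] [CharP F 2]
    {K : Type*} [Field K] [Algebra F K] (hK : Module.finrank F K = 2)
    (q : ℕ) (hq : Fintype.card F = q)
    -- data of the ovoid `O`
    (ω γ : K) (hω : ω ∉ (algebraMap F K).range) (hω1 : ω + ω ^ q = 1)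
    (hγ : Irreducible (Polynomial.X ^ 2 + Polynomial.X + Polynomial.C γ : Polynomial K))
    -- data of the ovoid `O'`
    (δ μ : F)
    (hδ : Irreducible (Polynomial.X ^ 2 + Polynomial.X + Polynomial.C δ : Polynomial F))
    (hμ : μ ≠ 0) :
    -- `O`
    (IsOvoidW5 (perpBaer F ω) (q + 1) (ovoidSecond F ω γ) ∧
      (linesIn (perpBaer F ω) (ovoidSecond F ω γ)).ncard = q ^ 2 + 1 ∧
      ¬ IsClassical (perpBaer F ω) (ovoidSecond F ω γ) ∧
      ¬ FromOneSystem (perpBaer F ω) (ovoidSecond F ω γ)) ∧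
    -- `O'`
    (IsOvoidW5 perpZero (q + 1) (ovoidFirst δ μ) ∧
      (linesIn perpZero (ovoidFirst δ μ)).ncard = q ^ 2 * (q + 1) + 1 ∧
      ¬ IsClassical perpZero (ovoidFirst δ μ) ∧
      ¬ FromOneSystem perpZero (ovoidFirst δ μ)) ∧
    ¬ Isomorphic (perpBaer F ω) (ovoidSecond F ω γ) perpZero (ovoidFirst δ μ) ∧
    -- `O₁`
    (∀ (Q₁ : QuadraticForm F (Fin 6 → F)) (v₁ : Fin 6 → F) (O₁ : Set (ℙ F (Fin 6 → F))),
      IsHemisystemOvoid Q₁ v₁ O₁ →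
        IsOvoidW5 (perpOf Q₁) (q + 1) O₁ ∧
        (linesIn (perpOf Q₁) O₁).ncard = (q + 1) * (q ^ 2 + 1) ∧
        ¬ Isomorphic (perpOf Q₁) O₁ (perpBaer F ω) (ovoidSecond F ω γ) ∧
        ¬ Isomorphic (perpOf Q₁) O₁ perpZero (ovoidFirst δ μ)) ∧
    -- `O₂`
    (∀ (Q₂ : QuadraticForm F (Fin 6 → F)) (v₂ : Fin 6 → F) (O₂ : Set (ℙ F (Fin 6 → F))),
      IsSuzukiOvoid Q₂ v₂ O₂ →
        IsOvoidW5 (perpOf Q₂) (q + 1) O₂ ∧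
        (linesIn (perpOf Q₂) O₂).ncard = (q + 1) * (q ^ 2 + 1) ∧
        ¬ Isomorphic (perpOf Q₂) O₂ (perpBaer F ω) (ovoidSecond F ω γ) ∧
        ¬ Isomorphic (perpOf Q₂) O₂ perpZero (ovoidFirst δ μ)) ∧
    -- `O₁` and `O₂`
    (∀ (Q₁ Q₂ : QuadraticForm F (Fin 6 → F)) (v₁ v₂ : Fin 6 → F)
        (O₁ O₂ : Set (ℙ F (Fin 6 → F))),
      IsHemisystemOvoid Q₁ v₁ O₁ → IsSuzukiOvoid Q₂ v₂ O₂ →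
        ¬ Isomorphic (perpOf Q₁) O₁ (perpOf Q₂) O₂) := by
  subst hq
  have hδ' := no_root_of_irreducible hδ
  have hD : IsBaerDatum F ω γ := ⟨hK, hω, hω1, no_root_of_irreducible hγ⟩
  have hq1 : 1 < Fintype.card F := Fintype.one_lt_card
  have hcard : Nat.card F = Fintype.card F := Nat.card_eq_fintype_card
  have hO := hD.isOvoidW5_ovoidSecond
  have hO' := isOvoidW5_ovoidFirst (μ := μ) hδ'
  have hl := hD.ncard_linesIn_ovoidSecond
  have hl' := ncard_linesIn_ovoidFirst hδ' hμ
  rw [hcard] at hO hO' hl hl'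
  have hne1 : Fintype.card F ^ 2 + 1 ≠ Fintype.card F ^ 2 * (Fintype.card F + 1) + 1 := by
    nlinarith
  have hne2 : (Fintype.card F + 1) * (Fintype.card F ^ 2 + 1) ≠ Fintype.card F ^ 2 + 1 := by
    nlinarith
  have hne3 : (Fintype.card F + 1) * (Fintype.card F ^ 2 + 1) ≠
      Fintype.card F ^ 2 * (Fintype.card F + 1) + 1 := by
    nlinarith
  -- Both kinds of pencil ovoids are balanced, so their common properties are derived once; line
  -- counts separate them from O and O'.
  have key : ∀ (Q : QuadraticForm F (Fin 6 → F)) (v : Fin 6 → F) (j k : F)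
      (A C : Set (ℙ F (Fin 6 → F))), IsBalanced Q v j k A C →
        IsOvoidW5 (perpOf Q) (Fintype.card F + 1) (A ∪ C ∪ base Q v) ∧
        (linesIn (perpOf Q) (A ∪ C ∪ base Q v)).ncard =
          (Fintype.card F + 1) * (Fintype.card F ^ 2 + 1) ∧
        ¬ Isomorphic (perpOf Q) (A ∪ C ∪ base Q v) (perpBaer F ω) (ovoidSecond F ω γ) ∧
        ¬ Isomorphic (perpOf Q) (A ∪ C ∪ base Q v) perpZero (ovoidFirst δ μ) := by
    intro Q v j k A C hb
    have h1 := hb.isOvoidW5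
    have h2 := hb.ncard_linesIn
    rw [hcard] at h1 h2
    exact ⟨h1, h2, fun h => hne2 (h2.symm.trans (h.ncard_linesIn_eq.trans hl)),
      fun h => hne3 (h2.symm.trans (h.ncard_linesIn_eq.trans hl'))⟩
  refine ⟨⟨hO, hl, fun h => hD.not_isPartitioned_ovoidSecond (h.isPartitioned hO.1.1),
      fun h => hD.not_isPartitioned_ovoidSecond h.isPartitioned⟩,
    ⟨hO', hl', fun h => not_isPartitioned_ovoidFirst hδ' hμ (h.isPartitioned hO'.1.1),
      fun h => not_isPartitioned_ovoidFirst hδ' hμ h.isPartitioned⟩,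
    fun h => hne1 (hl.symm.trans (h.ncard_linesIn_eq.trans hl')), ?_, ?_, ?_⟩
  · intro Q v X h
    obtain ⟨j, k, A, C, hb, rfl, -⟩ := h.exists_isBalanced
    exact key Q v j k A C hb
  · intro Q v X h
    obtain ⟨j, k, A, C, hb, rfl, -⟩ := h.exists_isBalanced
    exact key Q v j k A C hb
  · intro Q Q' v v' X X' h h'
    exact not_isomorphic_hemisystem_suzuki h h'
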